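/- Let $k$ be a finite field with $q$ elements, $\bar k$ an algebraic closure of $k$, $r\ge 1$, and $k_r\subset\bar k$ the extension of $k$ of degree $r$. Let $X$ be a scheme of finite type over $k$, let $Y=X\times_k \operatorname{Spec} k_r$, let $\pi:Y\to X$ be the projection, and let $G=\operatorname{Gal}(k_r/k)$ act on $Y$ over $X$ through the second factor. Let $\ell$ be a prime different from the characteristic of $k$, $E_\lambda$ a finite extension of $\mathbb Q_\ell$, $\mathfrak o_\lambda$ its ring of integers, $\mathfrak m_\lambda$ the maximal ideal of $\mathfrak o_\lambda$, and let $A$ be one of $E_\lambda$, $\mathfrak o_\lambda$, or $\mathfrak o_\lambda/\mathfrak m_\lambda^n$ with $n\ge 1$. Sheaves are étale sheaves; as usual, a constructible sheaf of $\mathfrak o_\lambda$-modules is an $\mathfrak m_\lambda$-adic system $(\mathcal F_n)_n$ of constructible sheaves of $\mathfrak o_\lambda/\mathfrak m_\lambda^n$-modules, and constructible sheaves of $E_\lambda$-modules are constructible sheaves of $\mathfrak o_\lambda$-modules with morphisms tensored with $E_\lambda$. A sheaf of free $A$-modules is one whose stalks at all geometric points are free $A$-modules. For a sheaf $\mathcal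 F$ of $A$-modules on $Y$, a tensor direct image of $\mathcal F$ by $\pi$ is a sheaf $\pi_{\otimes *}\mathcal F$ of $A$-modules on $X$ together with an isomorphism $$\pi^*(\pi_{\otimes *}\mathcal F)\;\cong\;\bigotimes_{\tau\in G}\tau^*\mathcal F$$ which, for every $\sigma\in G$, carries the canonical isomorphism $\pi^*(\pi_{\otimes *}\mathcal F)\cong\sigma^*\pi^*(\pi_{\otimes *}\mathcal F)$ to the permutation isomorphism $$\Psi_\sigma:\bigotimes_{\tau\in G}\tau^*\mathcal F\to\sigma^*\Big(\bigotimes_{\tau\in G}\tau^*\mathcal F\Big)=\bigotimes_{\tau\in G}(\tau\sigma)^*\mathcal F,\qquad \bigotimes_\tau m_\tau\mapsto\bigotimes_\tau m_{\tau\sigma}.$$ Let $\mathcal F$ be a constructible sheaf of free $A$-modules on $Y$, and let $x\in X(k)$. Let $\bar x$ be the geometric point $\operatorname{Spec}\bar k\to\operatorname{Spec} k\xrightarrow{x} X$, let $x_r\in Y(k_r)$ be the point with components $\operatorname{Spec}k_r\to\operatorname{Spec}k\xrightarrow{x}X$ and $\mathrm{id}_{\operatorname{Spec} k_r}$, and let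 $\bar x_r:\operatorname{Spec}\bar k\to Y$ be the geometric point over $x_r$. Let $F_x\in\operatorname{Gal}(\bar k/k)$ be the geometric Frobenius element, that is, the inverse of $a\mapsto a^q$; it acts on stalks at $\bar x$ of sheaves on $X$, and $F_x^r\in\operatorname{Gal}(\bar k/k_r)$ acts on stalks at $\bar x_r$ of sheaves on $Y$. Then a tensor direct image $\pi_{\otimes *}\mathcal F$ exists, and every tensor direct image of $\mathcal F$ satisfies $$\operatorname{Tr}\big(F_x\,|\,(\pi_{\otimes *}\mathcal F)_{\bar x}\big)=\operatorname{Tr}\big(F_x^r\,|\,\mathcal F_{\bar x_r}\big).$$ -/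

import Mathlib

open CategoryTheory AlgebraicGeometry Limits Opposite
open scoped TensorProduct

universe u

namespace EtaleSheaf

/-- Etale morphisms of schemes, as a `MorphismProperty`. -/
abbrev etaleProp : MorphismProperty Scheme.{u} := @Etale.{u}

instance : etaleProp.{u}.IsMultiplicative := by unfold etaleProp; infer_instance

instance : etaleProp.{u}.IsStableUnderBaseChange := by unfold etaleProp; infer_instance

instance : etaleProp.{u}.HasOfPostcompProperty etaleProp := by unfold etaleProp; infer_instance

noncomputable section

section Sites

variable {X Y : Scheme.{u}}

/-! ### The small étale site: base change and composition -/

/-- The source `U` of an object `U ⟶ X` of the small étale site. -/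
def dom (U : X.Etale) : Scheme.{u} := U.left
/-- The structure morphism of an object of the small étale site. -/
def str (U : X.Etale) : dom U ⟶ X := U.hom
instance (U : X.Etale) : Etale (str U) := U.prop
/-- The object of the small étale site given by an étale morphism. -/
def obj {U : Scheme.{u}} (p : U ⟶ X) [hp : Etale p] : X.Etale := MorphismProperty.Over.mk (P := etaleProp) ⊤ p hp
/-- The morphism of schemes underlying a morphism of the small étale site. -/
def homDom {U V : X.Etale} (a : U ⟶ V) : dom U ⟶ dom V := a.left
theorem homDom_str {U V : X.Etale} (a : U ⟶ V) : homDom a ≫ str V = str U := MorphismProperty.Over.w a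
/-- A morphism of `X`-schemes, as a morphism of the small étale site. -/
def homOf {U V : X.Etale} (a : dom U ⟶ dom V) (w : a ≫ str V = str U) : U ⟶ V :=
  MorphismProperty.Over.homMk (P := etaleProp) a w
theorem hom_ext' {U V : X.Etale} {a b : U ⟶ V} (h : homDom a = homDom b) : a = b :=
  MorphismProperty.Over.Hom.ext h
theorem homDom_comp {U V W : X.Etale} (a : U ⟶ V) (b : V ⟶ W) : homDom (a ≫ b) = homDom a ≫ homDom b := rfl

/-- `U ↦ U ×_X Y`, for any morphism `f : Y ⟶ X`. -/
def baseChange (f : Y ⟶ X) : X.Etale ⥤ Y.Etale := MorphismProperty.Over.pullback etaleProp ⊤ f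
/-- `(U ⟶ Y) ↦ (U ⟶ Y ⟶ X)`, for an étale morphism `f : Y ⟶ X`. -/
def compose (f : Y ⟶ X) [hf : Etale f]: Y.Etale ⥤ X.Etale := MorphismProperty.Over.map (P := etaleProp) ⊤ hf
/-- `compose f` is left adjoint to `baseChange f`. -/
def composeAdj (f : Y ⟶ X) [hf : Etale f] : compose f ⊣ baseChange f := MorphismProperty.Over.mapPullbackAdj etaleProp ⊤ f hf trivial

theorem mem_smallEtaleTopology_iff {W : X.Etale} (S : Sieve W) :
    S ∈ X.smallEtaleTopology W ↔
      ∀ w : dom W, ∃ (Z : X.Etale) (f : Z ⟶ W) (z : dom Z), S f ∧ homDom f z = w := by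
  obtain ⟨ι, Z, g, rfl⟩ := S.exists_eq_ofArrows
  rw [Scheme.ofArrows_mem_smallEtaleTopology_iff]
  constructor
  · intro h w
    have : w ∈ ⋃ i, Set.range (g i).left := h ▸ Set.mem_univ w
    obtain ⟨i, z, hz⟩ := Set.mem_iUnion.1 this
    exact ⟨Z i, g i, z, Sieve.ofArrows_mk _ _ i, hz⟩
  · intro h
    ext w
    simp only [Set.mem_iUnion, Set.mem_univ, iff_true]
    obtain ⟨V, f, z, ⟨_, a, _, ⟨i⟩, rfl⟩, rfl⟩ := h w
    exact ⟨i, homDom a z, rfl⟩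

/-- The projection `U ×_X Y ⟶ U`. -/
def bcFst (f : Y ⟶ X) (U : X.Etale) : dom ((baseChange f).obj U) ⟶ dom U := pullback.fst (str U) f
theorem bc_isPullback (f : Y ⟶ X) (U : X.Etale) :
    IsPullback (bcFst f U) (str ((baseChange f).obj U)) (str U) f := IsPullback.of_hasPullback _ _
theorem bc_map_fst (f : Y ⟶ X) {U V : X.Etale} (a : U ⟶ V) :
    homDom ((baseChange f).map a) ≫ bcFst f V = bcFst f U ≫ homDom a :=
  pullback.lift_fst (f := str V) (g := f) _ _ _

theorem baseChange_compatiblePreserving (f : Y ⟶ X) :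
    CompatiblePreserving.{u+1} Y.smallEtaleTopology (baseChange f) := by
  constructor
  intro ℱ Z T x hx Y₁ Y₂ W f₁ f₂ g₁ g₂ hg₁ hg₂ h
  let p₁ := pullback.fst (homDom g₁) (homDom g₂)
  let p₂ := pullback.snd (homDom g₁) (homDom g₂)
  have hp : p₁ ≫ homDom g₁ = p₂ ≫ homDom g₂ := pullback.condition
  have hg : Etale (homDom g₂) := by
    have : Etale (homDom g₂ ≫ str Z) := by rw [homDom_str]; infer_instance
    exact MorphismProperty.of_postcomp etaleProp _ (str Z) (inferInstance : Etale (str Z)) this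
  have : Etale p₁ := inferInstanceAs (Etale (pullback.fst _ _))
  let P : X.Etale := obj (p₁ ≫ str Y₁)
  let q₁ : P ⟶ Y₁ := homOf p₁ rfl
  let q₂ : P ⟶ Y₂ := homOf p₂ (by
    change p₂ ≫ str Y₂ = p₁ ≫ str Y₁
    rw [← homDom_str g₁, ← homDom_str g₂, reassoc_of% hp])
  have hq : q₁ ≫ g₁ = q₂ ≫ g₂ := hom_ext' hp
  have hs₁ := homDom_str f₁
  have hs₂ := homDom_str f₂
  have h' : homDom f₁ ≫ homDom ((baseChange f).map g₁) = homDom f₂ ≫ homDom ((baseChange f).map g₂) :=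
    congrArg homDom h
  have h'' : (homDom f₁ ≫ bcFst f Y₁) ≫ homDom g₁ = (homDom f₂ ≫ bcFst f Y₂) ≫ homDom g₂ := by
    rw [Category.assoc, Category.assoc, ← bc_map_fst, ← bc_map_fst, reassoc_of% h']
  let l : dom W ⟶ dom P := pullback.lift (homDom f₁ ≫ bcFst f Y₁) (homDom f₂ ≫ bcFst f Y₂) h''
  have hl₁ : l ≫ homDom q₁ = homDom f₁ ≫ bcFst f Y₁ := pullback.lift_fst _ _ _
  have hl₂ : l ≫ homDom q₂ = homDom f₂ ≫ bcFst f Y₂ := pullback.lift_snd _ _ _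
  have hl : l ≫ str P = str W ≫ f := by
    rw [← homDom_str q₁, reassoc_of% hl₁, (bc_isPullback f Y₁).w, reassoc_of% hs₁]
  let m : W ⟶ (baseChange f).obj P := homOf ((bc_isPullback f P).lift l (str W) hl)
    ((bc_isPullback f P).lift_snd _ _ _)
  have hm : homDom m ≫ bcFst f P = l := (bc_isPullback f P).lift_fst _ _ _
  have e₁ : f₁ = m ≫ (baseChange f).map q₁ := by
    apply hom_ext'
    apply (bc_isPullback f Y₁).hom_ext
    · rw [homDom_comp, Category.assoc, bc_map_fst, reassoc_of% hm, hl₁]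
    · rw [homDom_str, homDom_str]
  have e₂ : f₂ = m ≫ (baseChange f).map q₂ := by
    apply hom_ext'
    apply (bc_isPullback f Y₂).hom_ext
    · rw [homDom_comp, Category.assoc, bc_map_fst, reassoc_of% hm, hl₂]
    · rw [homDom_str, homDom_str]
  have key := hx q₁ q₂ hg₁ hg₂ hq
  rw [e₁, e₂, op_comp, op_comp, ℱ.obj.map_comp, ℱ.obj.map_comp]
  exact congrArg (ℱ.obj.map m.op) key

theorem exists_preimage_of_isPullback {P X Y Z : Scheme.{u}} {a : P ⟶ X} {b : P ⟶ Y} {f : X ⟶ Z}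
    {g : Y ⟶ Z} (h : IsPullback a b f g) (x : X) (y : Y) (hxy : f x = g y) :
    ∃ p : P, a p = x ∧ b p = y := by
  obtain ⟨z, hz, hz'⟩ := Scheme.Pullback.exists_preimage_pullback x y hxy
  refine ⟨h.isoPullback.inv z, ?_, ?_⟩
  · rw [← hz, ← h.isoPullback_inv_fst]; rfl
  · rw [← hz', ← h.isoPullback_inv_snd]; rfl

theorem baseChange_coverPreserving (f : Y ⟶ X) :
    CoverPreserving X.smallEtaleTopology Y.smallEtaleTopology (baseChange f) := by
  constructor
  intro W S hS
  rw [mem_smallEtaleTopology_iff] at hS ⊢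
  intro w
  obtain ⟨Z, g, z, hg, hz⟩ := hS (bcFst f W w)
  have hp : IsPullback (homDom ((baseChange f).map g)) (bcFst f Z) (bcFst f W) (homDom g) := by
    refine IsPullback.of_right ?_ (bc_map_fst f g) (bc_isPullback f W).flip
    rw [homDom_str, homDom_str]
    exact (bc_isPullback f Z).flip
  obtain ⟨a, ha, -⟩ := exists_preimage_of_isPullback hp w z hz.symm
  exact ⟨_, (baseChange f).map g, a, Sieve.image_mem_functorPushforward _ _ hg, ha⟩

theorem compose_coverPreserving (f : Y ⟶ X) [hf : Etale f] :
    CoverPreserving Y.smallEtaleTopology X.smallEtaleTopology (compose f) := by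
  constructor
  intro W S hS
  rw [mem_smallEtaleTopology_iff] at hS ⊢
  intro w
  obtain ⟨Z, g, z, hg, hz⟩ := hS w
  exact ⟨(compose f).obj Z, (compose f).map g, z, Sieve.image_mem_functorPushforward _ _ hg, hz⟩

theorem compose_compatiblePreserving (f : Y ⟶ X) [hf : Etale f] :
    CompatiblePreserving.{u+1} X.smallEtaleTopology (compose f) := by
  constructor
  intro ℱ Z T x hx Y₁ Y₂ W f₁ f₂ g₁ g₂ hg₁ hg₂ h
  let b₁ : dom W ⟶ dom Y₁ := homDom f₁
  let b₂ : dom W ⟶ dom Y₂ := homDom f₂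
  have h' : b₁ ≫ homDom g₁ = b₂ ≫ homDom g₂ := congrArg homDom h
  have v₁ : (b₁ ≫ str Y₁) ≫ f = str W := (Category.assoc _ _ _).trans (homDom_str f₁)
  have het : Etale (b₁ ≫ str Y₁) := by
    have : Etale ((b₁ ≫ str Y₁) ≫ f) := by rw [v₁]; infer_instance
    exact MorphismProperty.of_postcomp etaleProp _ f hf this
  let W' : Y.Etale := obj (b₁ ≫ str Y₁)
  let a₁ : W' ⟶ Y₁ := homOf b₁ rfl
  let a₂ : W' ⟶ Y₂ := homOf b₂
    (by change b₂ ≫ str Y₂ = b₁ ≫ str Y₁; rw [← homDom_str g₁, ← homDom_str g₂, reassoc_of% h'])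
  have ha : a₁ ≫ g₁ = a₂ ≫ g₂ := hom_ext' h'
  let e : W ⟶ (compose f).obj W' := homOf (𝟙 (dom W)) ((Category.id_comp _).trans v₁)
  have e₁ : f₁ = e ≫ (compose f).map a₁ := hom_ext' (Category.id_comp _).symm
  have e₂ : f₂ = e ≫ (compose f).map a₂ := hom_ext' (Category.id_comp _).symm
  have key := hx a₁ a₂ hg₁ hg₂ ha
  rw [e₁, e₂, op_comp, op_comp, ℱ.obj.map_comp, ℱ.obj.map_comp]
  exact congrArg (ℱ.obj.map e.op) key

instance (f : Y ⟶ X) : (baseChange f).IsContinuous X.smallEtaleTopology Y.smallEtaleTopology :=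
  Functor.isContinuous_of_coverPreserving (baseChange_compatiblePreserving f) (baseChange_coverPreserving f)
instance (f : Y ⟶ X) [Etale f] : (compose f).IsContinuous Y.smallEtaleTopology X.smallEtaleTopology :=
  Functor.isContinuous_of_coverPreserving (compose_compatiblePreserving f) (compose_coverPreserving f)

/-! ### Sheaves of modules, direct and inverse images -/

/-- Sheaves of `A`-modules on the small étale site of `X`. -/
abbrev Shv (A : Type u) [CommRing A] (X : Scheme.{u}) :=
  Sheaf X.smallEtaleTopology (ModuleCat.{u} A)

variable {A : Type u} [CommRing A]

/-- The direct image `f_*`, `(f_* F)(U) = F(U ×_X Y)`. -/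
def pushforward (f : Y ⟶ X) : Shv A Y ⥤ Shv A X :=
  (baseChange f).sheafPushforwardContinuous _ _ _

theorem isRightAdjoint_of_isGrothendieckAbelian {C D : Type (u + 1)} [Category.{u + 1} C]
    [Abelian C] [IsGrothendieckAbelian.{u} C] [Category.{u + 1} D] [LocallySmall.{u} D]
    (G : C ⥤ D) [PreservesLimitsOfSize.{u, u} G] : G.IsRightAdjoint := by
  let e := ShrinkHoms.equivalence.{u} C
  let e' := ShrinkHoms.equivalence.{u} D
  have : (e.inverse ⋙ G ⋙ e'.functor).IsRightAdjoint :=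
    isRightAdjoint_of_preservesLimits_of_isCoseparating.{u} (isCoseparator_coseparator _) _
  have h : (e.functor ⋙ (e.inverse ⋙ G ⋙ e'.functor) ⋙ e'.inverse).IsRightAdjoint := inferInstance
  let i : e.functor ⋙ (e.inverse ⋙ G ⋙ e'.functor) ⋙ e'.inverse ≅ G :=
    Functor.isoWhiskerRight e.unitIso.symm (G ⋙ e'.functor ⋙ e'.inverse) ≪≫
      Functor.isoWhiskerLeft G e'.unitIso.symm
  exact Functor.isRightAdjoint_of_iso i

instance (f : Y ⟶ X) : PreservesLimitsOfSize.{u, u} (pushforward (A := A) f) := by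
  have : PreservesLimitsOfSize.{u, u} (pushforward (A := A) f ⋙ sheafToPresheaf _ _) :=
    inferInstanceAs (PreservesLimitsOfSize.{u, u}
      (sheafToPresheaf Y.smallEtaleTopology (ModuleCat.{u} A) ⋙
        (Functor.whiskeringLeft _ _ _).obj (baseChange f).op))
  exact preservesLimits_of_reflects_of_preserves _ (sheafToPresheaf _ _)

instance (f : Y ⟶ X) : (pushforward (A := A) f).IsRightAdjoint := by
  have : IsGrothendieckAbelian.{u} (Shv A Y) :=
    Scheme.isGrothendieckAbelian_sheaf_smallEtaleTopology Y (ModuleCat.{u} A)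
  have : IsGrothendieckAbelian.{u} (Shv A X) :=
    Scheme.isGrothendieckAbelian_sheaf_smallEtaleTopology X (ModuleCat.{u} A)
  have : LocallySmall.{u} (Shv A X) := IsGrothendieckAbelian.locallySmall
  exact isRightAdjoint_of_isGrothendieckAbelian (pushforward (A := A) f)

/-- The inverse image `f^*` along an arbitrary morphism: the left adjoint of `f_*`. -/
def inverseImage (f : Y ⟶ X) : Shv A X ⥤ Shv A Y := (pushforward f).leftAdjoint

/-- The inverse image along an étale morphism `f : Y ⟶ X`, in its usual explicit form
`(f^* F)(U ⟶ Y) = F(U ⟶ Y ⟶ X)`. -/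
def restrict (f : Y ⟶ X) [Etale f] : Shv A X ⥤ Shv A Y :=
  (compose f).sheafPushforwardContinuous _ _ _

/-- For étale `f`, the explicit inverse image is left adjoint to `f_*`. -/
def restrictAdj (f : Y ⟶ X) [Etale f] : restrict (A := A) f ⊣ pushforward f :=
  Adjunction.sheafPushforwardContinuous (E := ModuleCat.{u} A) (composeAdj f) _ _

/-- For étale `f` the two inverse images agree. -/
def restrictIsoInverseImage (f : Y ⟶ X) [Etale f] : restrict (A := A) f ≅ inverseImage f :=
  Adjunction.leftAdjointUniq (restrictAdj f) (Adjunction.ofIsRightAdjoint _)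

/-- If `h = g ∘ f`, the identity of `U`, as a morphism from `U ⟶ Z ⟶ Y ⟶ X`
to `U ⟶ Z ⟶ X` (`f : Z ⟶ Y`, `g : Y ⟶ X`). -/
def composeComp {Z : Scheme.{u}} (f : Z ⟶ Y) (g : Y ⟶ X) (h : Z ⟶ X) [Etale f] [Etale g] [Etale h]
    (w : f ≫ g = h) : compose f ⋙ compose g ⟶ compose h where
  app U := homOf (U := (compose g).obj ((compose f).obj U)) (V := (compose h).obj U) (𝟙 (dom U)) (by
    subst w
    exact (Category.id_comp _).trans (Category.assoc (str U) f g).symm)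
  naturality U V a := hom_ext' ((Category.comp_id (homDom a)).trans
    (Category.id_comp (homDom a)).symm)

/-- The canonical transformation `h^* ⟶ f^* g^*` if `h = g ∘ f`. -/
def restrictComp {Z : Scheme.{u}} (f : Z ⟶ Y) (g : Y ⟶ X) (h : Z ⟶ X) [Etale f] [Etale g] [Etale h]
    (w : f ≫ g = h) : restrict (A := A) h ⟶ restrict g ⋙ restrict f where
  app F := ⟨Functor.whiskerRight (NatTrans.op (composeComp f g h w)) F.obj⟩
  naturality F F' φ := by
    apply Sheaf.hom_ext
    apply NatTrans.ext
    funext U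
    exact (φ.hom.naturality ((composeComp f g h w).app U.unop).op).symm

/-! ### Stalks, constructible sheaves -/

section Stalks

variable {Ω : Type u} [Field Ω] [IsSepClosed Ω]

/-- The stalk at a geometric point `s : Spec Ω ⟶ X`: the colimit of the `F(U)` over the étale
neighbourhoods `(U, u)` of `s`. -/
def stalk (s : Spec (.of Ω) ⟶ X) : Shv A X ⥤ ModuleCat.{u} A :=
  (Scheme.pointSmallEtale s).sheafFiber

/-- An endomorphism `h` of `Spec Ω` with `s ∘ h = s` acts on the étale neighbourhoods of `s` by
`(U, u) ↦ (U, u ∘ h)`. -/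
def pointHom (s : Spec (.of Ω) ⟶ X) (h : Spec (.of Ω) ⟶ Spec (.of Ω)) (w : h ≫ s = s) :
    Scheme.pointSmallEtale s ⟶ Scheme.pointSmallEtale s where
  hom := Functor.whiskerLeft (Scheme.Etale.forget X)
    (coyoneda.map (Over.homMk h w : Over.mk s ⟶ Over.mk s).op)

/-- The induced endomorphism of the stalk at `s`. -/
def stalkEnd (s : Spec (.of Ω) ⟶ X) (h : Spec (.of Ω) ⟶ Spec (.of Ω)) (w : h ≫ s = s) :
    stalk (A := A) s ⟶ stalk s :=
  (pointHom s h w).sheafFiber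

variable {k : Type u} [Field k] [Algebra k Ω]

variable (Ω) in
/-- The geometric point over a `k`-valued point `x`. -/
def geomPoint (x : Spec (.of k) ⟶ X) : Spec (.of Ω) ⟶ X :=
  Spec.map (CommRingCat.ofHom (algebraMap k Ω)) ≫ x

set_option linter.unusedSectionVars false in
theorem galois_comp_geomPoint (x : Spec (.of k) ⟶ X) (g : Ω ≃ₐ[k] Ω) :
    Spec.map (CommRingCat.ofHom (g : Ω →+* Ω)) ≫ geomPoint Ω x = geomPoint Ω x := by
  unfold geomPoint
  rw [← Spec.map_comp_assoc, ← CommRingCat.ofHom_comp]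
  congr 3
  exact RingHom.ext g.commutes

/-- The (left) action of `Gal(Ω/k)` on the stalk of `F` at the geometric point over the
`k`-valued point `x`. -/
def galStalk (x : Spec (.of k) ⟶ X) (g : Ω ≃ₐ[k] Ω) (F : Shv A X) :
    (stalk (geomPoint Ω x)).obj F →ₗ[A] (stalk (geomPoint Ω x)).obj F :=
  ((stalkEnd _ _ (galois_comp_geomPoint x g)).app F).hom

end Stalks

/-- Locally (for the étale topology) isomorphic to a constant sheaf. -/
def IsLocallyConstant (F : Shv A X) : Prop :=
  ∀ z : X, ∃ (U : Scheme.{u}) (j : U ⟶ X) (_ : Etale j) (M : ModuleCat.{u} A),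
    z ∈ Set.range j ∧
      Nonempty ((restrict j).obj F ≅ (constantSheaf U.smallEtaleTopology (ModuleCat.{u} A)).obj M)

/-- Constructible sheaves on a noetherian scheme: `X` is a finite disjoint union of locally closed
subschemes on which `F` is locally constant, and the stalks are finitely generated. -/
structure IsConstructible (F : Shv A X) : Prop where
  exists_stratification : ∃ (m : ℕ) (Z : Fin m → Scheme.{u}) (i : ∀ a, Z a ⟶ X),
    (∀ a, IsImmersion (i a)) ∧ (∀ z : X, ∃! a, z ∈ Set.range (i a)) ∧
      ∀ a, IsLocallyConstant ((inverseImage (i a)).obj F)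
  finite_stalk : ∀ (Ω : Type u) [Field Ω] [IsSepClosed Ω] (s : Spec (.of Ω) ⟶ X),
    Module.Finite A ((stalk s).obj F)

/-- Sheaves of free modules: all stalks at geometric points are free. -/
def HasFreeStalks (F : Shv A X) : Prop :=
  ∀ (Ω : Type u) [Field Ω] [IsSepClosed Ω] (s : Spec (.of Ω) ⟶ X),
    Module.Free A ((stalk s).obj F)

/-! ### The tensor direct image -/

section Tensor

variable {π : Y ⟶ X} {G : Type u} [Group G] (ρ : G →* Aut (Over.mk π))

/-- The automorphism of `Y` given by `σ`. -/
def act (σ : G) : Y ⟶ Y := (ρ σ).hom.left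

instance (σ : G) : IsIso (act ρ σ) := ((Over.forget X).mapIso (ρ σ)).isIso_hom

theorem act_comp_proj (σ : G) : act ρ σ ≫ π = π := Over.w (ρ σ).hom

theorem act_comp_act (σ τ : G) : act ρ σ ≫ act ρ τ = act ρ (τ * σ) := by
  unfold act
  rw [map_mul]
  rfl

/-- The presheaf `U ↦ ⨂_τ (τ^* F)(U)`. -/
def tensorPresheaf (F : Shv A Y) : Y.Etaleᵒᵖ ⥤ ModuleCat.{u} A where
  obj U := ModuleCat.of A (⨂[A] τ : G, ((restrict (act ρ τ)).obj F).obj.obj U)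
  map a := ModuleCat.ofHom
    (PiTensorProduct.map fun τ => (((restrict (act ρ τ)).obj F).obj.map a).hom)
  map_id U := by
    ext : 1
    simp only [CategoryTheory.Functor.map_id, ModuleCat.hom_id, ModuleCat.hom_ofHom]
    exact PiTensorProduct.map_id
  map_comp a b := by
    ext : 1
    simp only [CategoryTheory.Functor.map_comp, ModuleCat.hom_comp, ModuleCat.hom_ofHom]
    exact PiTensorProduct.map_comp _ _

/-- The map `⨂_τ (τ^* F)(U) ⟶ ⨂_τ (τ^* F')(U)` induced by `F ⟶ F'`. -/
def tensorPresheafMap {F F' : Shv A Y} (φ : F ⟶ F') : tensorPresheaf ρ F ⟶ tensorPresheaf ρ F' where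
  app U := ModuleCat.ofHom
    (PiTensorProduct.map fun τ => (((restrict (act ρ τ)).map φ).hom.app U).hom)
  naturality U V a := by
    ext : 1
    refine (PiTensorProduct.map_comp _ _).symm.trans (Eq.trans ?_ (PiTensorProduct.map_comp _ _))
    congr 1
    funext τ
    exact congrArg ModuleCat.Hom.hom (((restrict (act ρ τ)).map φ).hom.naturality a)

/-- The sheaf `⨂_τ τ^* F` on `Y`. -/
def tensorSheaf (F : Shv A Y) : Shv A Y :=
  (presheafToSheaf Y.smallEtaleTopology (ModuleCat.{u} A)).obj (tensorPresheaf ρ F)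

/-- The morphism `⨂_τ τ^* F ⟶ ⨂_τ τ^* F'` induced by `F ⟶ F'`. -/
def tensorSheafMap {F F' : Shv A Y} (φ : F ⟶ F') : tensorSheaf ρ F ⟶ tensorSheaf ρ F' :=
  (presheafToSheaf Y.smallEtaleTopology (ModuleCat.{u} A)).map (tensorPresheafMap ρ φ)

/-- The canonical map `((τσ)^* F)(U) ⟶ (σ^* τ^* F)(U)`. -/
def permFactor (F : Shv A Y) (σ τ : G) (U : Y.Etaleᵒᵖ) :
    ((restrict (act ρ ((Equiv.mulRight σ).symm.symm τ))).obj F).obj.obj U →ₗ[A]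
      ((restrict (act ρ τ)).obj F).obj.obj ((compose (act ρ σ)).op.obj U) :=
  (((restrictComp (act ρ σ) (act ρ τ) (act ρ (τ * σ)) (act_comp_act ρ σ τ)).app F).hom.app U).hom

/-- The permutation `⨂_τ m_τ ↦ ⨂_τ m_{τσ}`, where `m_{τσ}` in `(τσ)^* F` is seen in `σ^* τ^* F`. -/
def permMap (F : Shv A Y) (σ : G) (U : Y.Etaleᵒᵖ) :
    (⨂[A] τ : G, ((restrict (act ρ τ)).obj F).obj.obj U) →ₗ[A]
      ⨂[A] τ : G, ((restrict (act ρ τ)).obj F).obj.obj ((compose (act ρ σ)).op.obj U) :=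
  PiTensorProduct.map (permFactor ρ F σ · U) ∘ₗ
    (PiTensorProduct.reindex A (fun τ => ((restrict (act ρ τ)).obj F).obj.obj U)
      (Equiv.mulRight σ).symm).toLinearMap

theorem permMap_tprod (F : Shv A Y) (σ : G) (U : Y.Etaleᵒᵖ)
    (m : ∀ τ : G, ((restrict (act ρ τ)).obj F).obj.obj U) :
    permMap ρ F σ U (PiTensorProduct.tprod A m) =
      PiTensorProduct.tprod A fun τ => permFactor ρ F σ τ U (m (τ * σ)) := by
  have h₁ := PiTensorProduct.reindex_tprod (R := A) (Equiv.mulRight σ).symm m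
  have h₂ := PiTensorProduct.map_tprod (permFactor ρ F σ · U)
    (fun τ => m ((Equiv.mulRight σ).symm.symm τ))
  exact (congrArg (PiTensorProduct.map (permFactor ρ F σ · U)) h₁).trans h₂

/-- The permutation `⨂_τ m_τ ↦ ⨂_τ m_{τσ}`, as a morphism of presheaves. -/
def permPresheaf (F : Shv A Y) (σ : G) :
    tensorPresheaf ρ F ⟶ (compose (act ρ σ)).op ⋙ tensorPresheaf ρ F where
  app U := ModuleCat.ofHom (permMap ρ F σ U)
  naturality U V a := by
    ext : 1
    apply PiTensorProduct.ext
    ext m : 1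
    refine (congrArg (permMap ρ F σ V) (PiTensorProduct.map_tprod _ m)).trans ?_
    refine (permMap_tprod ρ F σ V _).trans ?_
    refine Eq.trans ?_ (congrArg (PiTensorProduct.map _) (permMap_tprod ρ F σ U m)).symm
    refine Eq.trans ?_ (PiTensorProduct.map_tprod _ _).symm
    congr 1
    funext τ
    exact ConcreteCategory.congr_hom
      (((restrictComp (act ρ σ) (act ρ τ) (act ρ (τ * σ)) (act_comp_act ρ σ τ)).app
        F).hom.naturality a) (m (τ * σ))

/-- The isomorphism `Ψ_σ : ⨂_τ τ^* F ⟶ σ^* (⨂_τ τ^* F)`: the morphism of sheaves induced by the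
permutation `⨂_τ m_τ ↦ ⨂_τ m_{τσ}`. -/
def permSheaf (F : Shv A Y) (σ : G) :
    tensorSheaf ρ F ⟶ (restrict (act ρ σ)).obj (tensorSheaf ρ F) :=
  ⟨sheafifyLift Y.smallEtaleTopology
    (permPresheaf ρ F σ ≫ Functor.whiskerLeft (compose (act ρ σ)).op
      (toSheafify Y.smallEtaleTopology (tensorPresheaf ρ F)))
    ((restrict (act ρ σ)).obj (tensorSheaf ρ F)).property⟩

variable [Etale π]

/-- The canonical isomorphism `π^* 𝒢 ⟶ σ^* π^* 𝒢`. -/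
def canonical (𝒢 : Shv A X) (σ : G) :
    (restrict π).obj 𝒢 ⟶ (restrict (act ρ σ)).obj ((restrict π).obj 𝒢) :=
  (restrictComp (act ρ σ) π π (act_comp_proj ρ σ)).app 𝒢

/-- A tensor direct image of `F`: a sheaf `𝒢` on `X` such that `π^* 𝒢`, with its canonical
isomorphisms `π^* 𝒢 ⟶ σ^* π^* 𝒢`, is isomorphic to `⨂_τ τ^* F` with the isomorphisms `Ψ_σ`. -/
structure TensorDirectImage (F : Shv A Y) where
  sheaf : Shv A X
  iso : (restrict π).obj sheaf ≅ tensorSheaf ρ F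
  comm : ∀ σ : G, iso.hom ≫ permSheaf ρ F σ =
    canonical ρ sheaf σ ≫ (restrict (act ρ σ)).map iso.hom

end Tensor

/-! ### Adic sheaves -/

section Adic

/-- `𝔪`-adic sheaves `(F_n)`: `F_n` is a sheaf of `O ⧸ 𝔪 ^ n`-modules (that is, of `O`-modules
killed by `𝔪 ^ n`), and `F_{n+1} ⟶ F_n` induces `F_{n+1} / 𝔪 ^ n F_{n+1} ≅ F_n`. -/
structure AdicSheaf (X : Scheme.{u}) {O : Type u} [CommRing O] (𝔪 : Ideal O) where
  level : ℕ → Shv O X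
  trans : ∀ n, level (n + 1) ⟶ level n
  smul_eq_zero : ∀ (n : ℕ) (U : X.Etaleᵒᵖ) (s : (level n).obj.obj U), ∀ a ∈ 𝔪 ^ n, a • s = 0
  stalk_surjective : ∀ (n : ℕ) (Ω : Type u) [Field Ω] [IsSepClosed Ω] (s : Spec (.of Ω) ⟶ X),
    Function.Surjective ((stalk s).map (trans n)).hom
  stalk_ker : ∀ (n : ℕ) (Ω : Type u) [Field Ω] [IsSepClosed Ω] (s : Spec (.of Ω) ⟶ X),
    LinearMap.ker ((stalk s).map (trans n)).hom =
      𝔪 ^ n • (⊤ : Submodule O ((stalk s).obj (level (n + 1))))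

namespace AdicSheaf

variable {O : Type u} [CommRing O] {𝔪 : Ideal O}

/-- Every `F_n` is constructible. -/
def IsConstructible (F : AdicSheaf X 𝔪) : Prop := ∀ n, EtaleSheaf.IsConstructible (F.level n)

section Stalks

variable {Ω : Type u} [Field Ω] [IsSepClosed Ω]

/-- The stalk of an adic sheaf: the inverse limit of the stalks of the `F_n`. -/
def stalk (F : AdicSheaf X 𝔪) (s : Spec (.of Ω) ⟶ X) :
    Submodule O (∀ n, (EtaleSheaf.stalk s).obj (F.level n)) where
  carrier := {v | ∀ n, ((EtaleSheaf.stalk s).map (F.trans n)).hom (v (n + 1)) = v n}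
  add_mem' := fun {v w} hv hw n => by simp [hv n, hw n]
  zero_mem' := fun n => by simp
  smul_mem' := fun a v hv n => by simp [hv n]

variable {k : Type u} [Field k] [Algebra k Ω]

/-- The action of `Gal(Ω/k)` on the stalk of an adic sheaf. -/
def galStalk (x : Spec (.of k) ⟶ X) (g : Ω ≃ₐ[k] Ω) (F : AdicSheaf X 𝔪) :
    F.stalk (geomPoint Ω x) →ₗ[O] F.stalk (geomPoint Ω x) :=
  LinearMap.restrict
    (LinearMap.pi fun n => EtaleSheaf.galStalk x g (F.level n) ∘ₗ LinearMap.proj n)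
    (fun v hv n => by
      have h := ConcreteCategory.congr_hom
        ((stalkEnd _ _ (galois_comp_geomPoint x g)).naturality (F.trans n)) (v (n + 1))
      refine h.symm.trans ?_
      exact congrArg (EtaleSheaf.galStalk x g (F.level n)) (hv n))

end Stalks

/-- Adic sheaves of free `O`-modules: all stalks at geometric points are free over `O`. -/
def HasFreeStalks (F : AdicSheaf X 𝔪) : Prop :=
  ∀ (Ω : Type u) [Field Ω] [IsSepClosed Ω] (s : Spec (.of Ω) ⟶ X), Module.Free O (F.stalk s)

section Tensor

variable {π : Y ⟶ X} {G : Type u} [Group G] (ρ : G →* Aut (Over.mk π)) [Etale π]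

/-- A tensor direct image of the adic sheaf `F = (F_n)` (as a sheaf of `O`-modules): an adic sheaf
`(𝒢_n)` on `X` with isomorphisms `π^* 𝒢_n ≅ ⨂_τ τ^* F_n`, compatible with the transition maps, and
with the canonical isomorphisms on the left and the `Ψ_σ` on the right. -/
structure TensorDirectImage (F : AdicSheaf Y 𝔪) where
  sheaf : AdicSheaf X 𝔪
  iso : ∀ n, (restrict π).obj (sheaf.level n) ≅ tensorSheaf ρ (F.level n)
  comm : ∀ (n : ℕ) (σ : G), (iso n).hom ≫ permSheaf ρ (F.level n) σ =
    canonical ρ (sheaf.level n) σ ≫ (restrict (act ρ σ)).map (iso n).hom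
  comm_trans : ∀ n, (iso (n + 1)).hom ≫ tensorSheafMap ρ (F.trans n) =
    (restrict π).map (sheaf.trans n) ≫ (iso n).hom

/-- A tensor direct image of the sheaf of `E`-modules `F ⊗ E` (`E` the fraction field of `O`).
Morphisms of sheaves of `E`-modules are fractions `α / a`, with `α` a morphism of adic sheaves and
`a ≠ 0` in `O`, so that, up to scalars in `E`, an isomorphism and its inverse are given by
morphisms `hom` and `inv` of adic sheaves whose two composites are the multiplication by some
`c ≠ 0` in `O`. -/
structure RationalTensorDirectImage (F : AdicSheaf Y 𝔪) where
  sheaf : AdicSheaf X 𝔪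
  hom : ∀ n, (restrict π).obj (sheaf.level n) ⟶ tensorSheaf ρ (F.level n)
  inv : ∀ n, tensorSheaf ρ (F.level n) ⟶ (restrict π).obj (sheaf.level n)
  hom_trans : ∀ n, hom (n + 1) ≫ tensorSheafMap ρ (F.trans n) =
    (restrict π).map (sheaf.trans n) ≫ hom n
  inv_trans : ∀ n, inv (n + 1) ≫ (restrict π).map (sheaf.trans n) =
    tensorSheafMap ρ (F.trans n) ≫ inv n
  c : O
  c_ne_zero : c ≠ 0
  hom_inv : ∀ n, hom n ≫ inv n = c • 𝟙 _
  inv_hom : ∀ n, inv n ≫ hom n = c • 𝟙 _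
  comm : ∀ (n : ℕ) (σ : G), hom n ≫ permSheaf ρ (F.level n) σ =
    canonical ρ (sheaf.level n) σ ≫ (restrict (act ρ σ)).map (hom n)

end Tensor

end AdicSheaf

end Adic

end Sites

/-! ### Extension of scalars of a scheme over a finite field -/

section FiniteField

variable {k : Type u} [Field k] (K : Type u) [Field K] [Algebra k K]

/-- `Spec K ⟶ Spec k`. -/
abbrev specMap (k : Type u) [Field k] (K : Type u) [Field K] [Algebra k K] :
    Spec (.of K) ⟶ Spec (.of k) :=
  Spec.map (CommRingCat.ofHom (algebraMap k K))

variable {X : Scheme.{u}} (f : X ⟶ Spec (.of k))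

/-- The extension of scalars `Y = X ×_k K`. -/
abbrev extend : Scheme.{u} := Limits.pullback f (specMap k K)

/-- The projection `π : Y ⟶ X`. -/
abbrev extendProj : extend K f ⟶ X := pullback.fst f (specMap k K)

instance etale_specMap [Finite k] [FiniteDimensional k K] : Etale (specMap k K) := by
  have : Algebra.FormallyEtale k K := Algebra.FormallyEtale.of_isSeparable k K
  have : Algebra.Etale k K := { finitePresentation := Algebra.FinitePresentation.of_finiteType.1 inferInstance }
  rw [HasRingHomProperty.Spec_iff (P := @Etale)]
  exact RingHom.etale_algebraMap.2 this

instance etale_extendProj [Finite k] [FiniteDimensional k K] : Etale (extendProj K f) :=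
  inferInstance

theorem galAut_condition (g : K ≃ₐ[k] K) :
    pullback.fst f (specMap k K) ≫ f = (pullback.snd f (specMap k K) ≫
      Spec.map (CommRingCat.ofHom (g.symm : K →+* K))) ≫ specMap k K := by
  have h : Spec.map (CommRingCat.ofHom (g.symm : K →+* K)) ≫ specMap k K = specMap k K := by
    rw [← Spec.map_comp, ← CommRingCat.ofHom_comp]
    exact congrArg (fun φ => Spec.map (CommRingCat.ofHom φ)) (RingHom.ext g.symm.commutes)
  rw [Category.assoc, h, pullback.condition]

/-- The automorphism `1 × Spec(g⁻¹)` of `Y = X ×_k K` over `X`. -/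
def galAutHom (g : K ≃ₐ[k] K) : Over.mk (extendProj K f) ⟶ Over.mk (extendProj K f) :=
  Over.homMk (pullback.lift (pullback.fst _ _)
    (pullback.snd _ _ ≫ Spec.map (CommRingCat.ofHom (g.symm : K →+* K)))
    (galAut_condition K f g)) (pullback.lift_fst _ _ _)

theorem galAutHom_comp (g h : K ≃ₐ[k] K) :
    galAutHom K f g ≫ galAutHom K f h = galAutHom K f (h * g) := by
  ext : 1
  apply pullback.hom_ext
  · simp only [galAutHom, Over.comp_left, Over.homMk_left, Category.assoc, pullback.lift_fst]
  · simp only [galAutHom, Over.comp_left, Over.homMk_left, Category.assoc, pullback.lift_snd,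
      pullback.lift_snd_assoc]
    rw [← Spec.map_comp, ← CommRingCat.ofHom_comp]
    rfl

theorem galAutHom_one : galAutHom K f (1 : K ≃ₐ[k] K) = 𝟙 _ := by
  ext : 1
  apply pullback.hom_ext
  · simp only [galAutHom, Over.homMk_left, pullback.lift_fst]
    exact (Category.id_comp _).symm
  · simp only [galAutHom, Over.homMk_left, pullback.lift_snd]
    refine Eq.trans ?_ (Category.id_comp _).symm
    refine Eq.trans ?_ (Category.comp_id _)
    congr 1
    exact Spec.map_id _

/-- The action of `Gal(K/k)` on `Y = X ×_k K` by automorphisms over `X`. -/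
def galAut : (K ≃ₐ[k] K) →* Aut (Over.mk (extendProj K f)) where
  toFun g :=
    { hom := galAutHom K f g
      inv := galAutHom K f g.symm
      hom_inv_id := by
        rw [galAutHom_comp, ← galAutHom_one]
        exact congrArg _ (inv_mul_cancel g)
      inv_hom_id := by
        rw [galAutHom_comp, ← galAutHom_one]
        exact congrArg _ (mul_inv_cancel g) }
  map_one' := Aut.ext (galAutHom_one K f)
  map_mul' g h := Aut.ext (galAutHom_comp K f h g).symm

/-- The `K`-valued point of `Y = X ×_k K` given by a `k`-valued point of `X`. -/
def extendPoint (x : Spec (.of k) ⟶ X) (hx : x ≫ f = 𝟙 _) : Spec (.of K) ⟶ extend K f :=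
  pullback.lift (specMap k K ≫ x) (𝟙 _) (by rw [Category.assoc, hx, Category.comp_id, Category.id_comp])

variable (k) (Ω : Type u) [Field Ω] [Algebra k Ω] [Algebra.IsAlgebraic k Ω]

/-- The geometric Frobenius element of `Gal(Ω/k)`: the inverse of `a ↦ a ^ #k`. -/
def geomFrob [Fintype k] : Ω ≃ₐ[k] Ω := (FiniteField.frobeniusAlgEquivOfAlgebraic k Ω)⁻¹

variable [Algebra K Ω] [IsScalarTower k K Ω]

set_option linter.unusedSectionVars false in
theorem geomFrob_pow_algebraMap [Fintype k] [FiniteDimensional k K] (a : K) :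
    (geomFrob k Ω ^ Module.finrank k K) (algebraMap K Ω a) = algebraMap K Ω a := by
  have : Finite K := Module.finite_of_finite k
  have : Fintype K := Fintype.ofFinite K
  have h : (FiniteField.frobeniusAlgEquivOfAlgebraic k Ω ^ Module.finrank k K)
      (algebraMap K Ω a) = algebraMap K Ω a := by
    rw [AlgEquiv.coe_pow, FiniteField.coe_frobeniusAlgEquivOfAlgebraic_iterate,
      ← Module.card_eq_pow_finrank]
    exact (map_pow (algebraMap K Ω) a _).symm.trans (congrArg _ (FiniteField.pow_card a))
  unfold geomFrob
  rw [inv_pow]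
  conv_lhs => rw [← h]
  exact AlgEquiv.symm_apply_apply _ _

/-- The power `F ^ r` (`r = [K : k]`) of the geometric Frobenius element of `Gal(Ω/k)`, as an
element of the subgroup `Gal(Ω/K)`. -/
def geomFrobPow [Fintype k] [FiniteDimensional k K] : Ω ≃ₐ[K] Ω :=
  AlgEquiv.ofRingEquiv (f := ((geomFrob k Ω ^ Module.finrank k K : Ω ≃ₐ[k] Ω) : Ω ≃+* Ω))
    (geomFrob_pow_algebraMap k K Ω)

end FiniteField

end

end EtaleSheaf

/-! Existence is Galois descent. The projection π is étale and G acts simply transitively on its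
geometric fibres, so a sheaf on Y with a compatible action of G is the inverse image of a sheaf on
X, whose sections over U are the invariant sections over U ×_X Y (`descendIso`). The permutations
Ψ_σ form such an action on ⨂_τ τ^*F (`tensorEquivariant`).

For the trace, let t be the geometric point over x_r, L the stalk of F at t, φ = Spec(F_x), and σ ∈
G the restriction of F_x, a generator of G. Since σ^i ∘ t ∘ φ^i = t, precomposing étale
neighbourhoods with φ^i identifies the stalk of (σ^i)^*F at t with L, for 0 ≤ i < r. Tensor products
commute with filtered colimits (`stalkTensor_bijective`), so the stalk at x of a tensor direct image
becomes the tensor power of L indexed by G. Compatibility with Ψ_σ turns F_x into the shift ⨂ y_τ ↦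
⨂ y_{τσ}, except that at the one factor where the exponent wraps from r back to 0 an extra F_x^r is
applied (`germ_factor_succ`, `comparison_stalkEnd`). In a basis (e_j) of L, a diagonal coefficient
of this operator vanishes unless the basis tensor is e_j ⊗ ... ⊗ e_j, and then it is the j-th
diagonal coefficient of F_x^r; hence the trace is Tr(F_x^r | L) (`trace_cyclic`). Only the
isomorphism with ⨂_τ τ^*F and its compatibility with Ψ_σ enter, so the argument covers every tensor
direct image.

For adic sheaves the same maps are taken at every level and passed to the limit. Compactness of ℤ_ℓ
makes O linearly compact, so the limit L of the stalks is a finite O-module whose reduction modulo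
𝔪^n is the n-th stalk (`ker_adicLimitProj`), and the tensor power of L is the limit of the tensor
powers (`AdicSheaf.tensorPowerLimit`). Over E the comparison map is invertible only up to a nonzero
scalar c and L may have torsion; dividing by the torsion gives a free module, and extension of
scalars to E sees neither c nor the torsion (`trace_baseChange_of_isogeny`). -/

namespace EtaleSheaf
noncomputable section

/-! ### Germs -/

section Germ

variable {X : Scheme.{u}} {A : Type u} [CommRing A] {Ω : Type u} [Field Ω] [IsSepClosed Ω]

/-- An étale neighbourhood as an element of the fibre functor. -/
def nbhd (s : Spec (.of Ω) ⟶ X) (V : X.Etale) (v : Spec (.of Ω) ⟶ dom V) (hv : v ≫ str V = s) :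
    (Scheme.pointSmallEtale s).fiber.obj V :=
  Over.homMk (U := Over.mk s) (V := (Scheme.Etale.forget X).obj V) v hv

/-- The geometric point of `V` underlying an element of the fibre functor. -/
def nbhdPt {s : Spec (.of Ω) ⟶ X} {V : X.Etale} (x : (Scheme.pointSmallEtale s).fiber.obj V) :
    Spec (.of Ω) ⟶ dom V :=
  Over.Hom.left (show Over.mk s ⟶ (Scheme.Etale.forget X).obj V from x)

theorem nbhdPt_str {s : Spec (.of Ω) ⟶ X} {V : X.Etale}
    (x : (Scheme.pointSmallEtale s).fiber.obj V) : nbhdPt x ≫ str V = s :=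
  Over.w (show Over.mk s ⟶ (Scheme.Etale.forget X).obj V from x)

theorem exists_nbhd (s : Spec (.of Ω) ⟶ X) (V : X.Etale)
    (x : (Scheme.pointSmallEtale s).fiber.obj V) :
    ∃ (v : Spec (.of Ω) ⟶ dom V) (hv : v ≫ str V = s), x = nbhd s V v hv :=
  ⟨nbhdPt x, nbhdPt_str x, rfl⟩

/-- The stalk of a presheaf at a geometric point. -/
def preStalk (s : Spec (.of Ω) ⟶ X) : (X.Etaleᵒᵖ ⥤ ModuleCat.{u} A) ⥤ ModuleCat.{u} A :=
  (Scheme.pointSmallEtale s).presheafFiber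

/-- The germ of a section over an étale neighbourhood. -/
def germ (s : Spec (.of Ω) ⟶ X) (P : X.Etaleᵒᵖ ⥤ ModuleCat.{u} A) (V : X.Etale)
    (v : Spec (.of Ω) ⟶ dom V) (hv : v ≫ str V = s) :
    P.obj (op V) →ₗ[A] (preStalk s).obj P :=
  ((Scheme.pointSmallEtale s).toPresheafFiber V (nbhd s V v hv) P).hom

theorem exists_germ (s : Spec (.of Ω) ⟶ X) (P : X.Etaleᵒᵖ ⥤ ModuleCat.{u} A)
    (p : (preStalk s).obj P) :
    ∃ (V : X.Etale) (v : Spec (.of Ω) ⟶ dom V) (hv : v ≫ str V = s) (m : P.obj (op V)),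
      germ s P V v hv m = p := by
  obtain ⟨V, x, m, h⟩ := (Scheme.pointSmallEtale s).toPresheafFiber_jointly_surjective (P := P) p
  obtain ⟨v, hv, rfl⟩ := exists_nbhd s V x
  exact ⟨V, v, hv, m, h⟩

theorem germ_res (s : Spec (.of Ω) ⟶ X) (P : X.Etaleᵒᵖ ⥤ ModuleCat.{u} A) {U V : X.Etale}
    (a : U ⟶ V) (u : Spec (.of Ω) ⟶ dom U) (hu : u ≫ str U = s) (v : Spec (.of Ω) ⟶ dom V)
    (hv : v ≫ str V = s) (huv : u ≫ homDom a = v) (m : P.obj (op V)) :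
    germ s P U u hu ((P.map a.op).hom m) = germ s P V v hv m := by
  subst huv
  exact ConcreteCategory.congr_hom
    ((Scheme.pointSmallEtale s).toPresheafFiber_w a (nbhd s U u hu) P) m

theorem germ_eq_iff (s : Spec (.of Ω) ⟶ X) (P : X.Etaleᵒᵖ ⥤ ModuleCat.{u} A) (V : X.Etale)
    (v : Spec (.of Ω) ⟶ dom V) (hv : v ≫ str V = s) (m m' : P.obj (op V)) :
    germ s P V v hv m = germ s P V v hv m' ↔
      ∃ (U : X.Etale) (a : U ⟶ V) (u : Spec (.of Ω) ⟶ dom U) (_ : u ≫ str U = s),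
        u ≫ homDom a = v ∧ (P.map a.op).hom m = (P.map a.op).hom m' := by
  refine ((Scheme.pointSmallEtale s).toPresheafFiber_eq_iff' V (nbhd s V v hv) m m').trans ?_
  constructor
  · rintro ⟨U, a, x, hx, h⟩
    obtain ⟨u, hu, rfl⟩ := exists_nbhd s U x
    exact ⟨U, a, u, hu, congrArg nbhdPt hx, h⟩
  · rintro ⟨U, a, u, hu, rfl, h⟩
    exact ⟨U, a, nbhd s U u hu, rfl, h⟩

theorem preStalk_map_germ (s : Spec (.of Ω) ⟶ X) {P Q : X.Etaleᵒᵖ ⥤ ModuleCat.{u} A} (φ : P ⟶ Q)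
    (V : X.Etale) (v : Spec (.of Ω) ⟶ dom V) (hv : v ≫ str V = s) (m : P.obj (op V)) :
    ((preStalk s).map φ).hom (germ s P V v hv m) = germ s Q V v hv ((φ.app (op V)).hom m) :=
  ConcreteCategory.congr_hom
    ((Scheme.pointSmallEtale s).toPresheafFiber_naturality φ V (nbhd s V v hv)) m

/-- The étale neighbourhoods of a geometric point form a cofiltered category, so finitely many of
them are dominated by one. This is the source of every finiteness assumption on index sets below. -/
theorem exists_common_nbhd (s : Spec (.of Ω) ⟶ X) {ι : Type*} [Finite ι] (V : ι → X.Etale)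
    (v : ∀ i, Spec (.of Ω) ⟶ dom (V i)) (hv : ∀ i, v i ≫ str (V i) = s) :
    ∃ (W : X.Etale) (w : Spec (.of Ω) ⟶ dom W) (_ : w ≫ str W = s) (a : ∀ i, W ⟶ V i),
      ∀ i, w ≫ homDom (a i) = v i := by
  classical
  have : IsCofiltered (Scheme.pointSmallEtale s).fiber.Elements :=
    (Scheme.pointSmallEtale s).isCofiltered
  cases nonempty_fintype ι
  let e : ι → (Scheme.pointSmallEtale s).fiber.Elements :=
    fun i => ⟨V i, nbhd s (V i) (v i) (hv i)⟩
  obtain ⟨⟨W, x⟩, h⟩ := IsCofiltered.inf_objs_exists (Finset.univ.image e)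
  obtain ⟨w, hw, rfl⟩ := exists_nbhd s W x
  have a := fun i => h (Finset.mem_image_of_mem e (Finset.mem_univ i))
  exact ⟨W, w, hw, fun i => (a i).some.1, fun i => congrArg nbhdPt (a i).some.2⟩

/-- A linear map out of the stalk of a presheaf, given by its values on germs. -/
def preStalkLift (s : Spec (.of Ω) ⟶ X) (P : X.Etaleᵒᵖ ⥤ ModuleCat.{u} A) {N : Type u}
    [AddCommGroup N] [Module A N]
    (g : ∀ (V : X.Etale) (v : Spec (.of Ω) ⟶ dom V) (_ : v ≫ str V = s), P.obj (op V) →ₗ[A] N)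
    (hg : ∀ {U V : X.Etale} (a : U ⟶ V) (u : Spec (.of Ω) ⟶ dom U) (hu : u ≫ str U = s)
      (m : P.obj (op V)),
      g U u hu ((P.map a.op).hom m) =
        g V (u ≫ homDom a) (by rw [Category.assoc, homDom_str, hu]) m) :
    (preStalk s).obj P →ₗ[A] N :=
  ((Scheme.pointSmallEtale s).presheafFiberDesc (P := P) (T := ModuleCat.of A N)
    (fun V x => ModuleCat.ofHom (g V (nbhdPt x) (nbhdPt_str x))) (fun U V a x => by
      ext m
      exact hg a (nbhdPt x) (nbhdPt_str x) m)).hom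

theorem preStalkLift_germ (s : Spec (.of Ω) ⟶ X) (P : X.Etaleᵒᵖ ⥤ ModuleCat.{u} A) {N : Type u}
    [AddCommGroup N] [Module A N]
    (g : ∀ (V : X.Etale) (v : Spec (.of Ω) ⟶ dom V) (_ : v ≫ str V = s), P.obj (op V) →ₗ[A] N)
    (hg : _) (V : X.Etale) (v : Spec (.of Ω) ⟶ dom V) (hv : v ≫ str V = s) (m : P.obj (op V)) :
    preStalkLift s P g hg (germ s P V v hv m) = g V v hv m := by
  exact ConcreteCategory.congr_hom
    ((Scheme.pointSmallEtale s).toPresheafFiber_presheafFiberDesc (P := P) (T := ModuleCat.of A N)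
      _ _ V (nbhd s V v hv)) m

theorem stalk_map_germ (s : Spec (.of Ω) ⟶ X) {F F' : Shv A X} (φ : F ⟶ F')
    (V : X.Etale) (v : Spec (.of Ω) ⟶ dom V) (hv : v ≫ str V = s) (m : F.obj.obj (op V)) :
    ((stalk s).map φ).hom (germ s F.obj V v hv m) = germ s F'.obj V v hv ((φ.hom.app (op V)).hom m) :=
  preStalk_map_germ s φ.hom V v hv m

theorem stalkEnd_germ (s : Spec (.of Ω) ⟶ X) (h : Spec (.of Ω) ⟶ Spec (.of Ω)) (w : h ≫ s = s)
    (F : Shv A X) (V : X.Etale) (v : Spec (.of Ω) ⟶ dom V) (hv : v ≫ str V = s)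
    (m : F.obj.obj (op V)) :
    ((stalkEnd s h w).app F).hom (germ s F.obj V v hv m) =
      germ s F.obj V (h ≫ v) (by rw [Category.assoc, hv, w]) m := by
  have key : (Scheme.pointSmallEtale s).toPresheafFiber V (nbhd s V v hv) F.obj ≫
      (pointHom s h w).presheafFiber.app F.obj = (Scheme.pointSmallEtale s).toPresheafFiber V
        ((pointHom s h w).hom.app V (nbhd s V v hv)) F.obj := by
    simp only [GrothendieckTopology.Point.Hom.presheafFiber_app,
      GrothendieckTopology.Point.toPresheafFiber_presheafFiberDesc]
  exact ConcreteCategory.congr_hom key m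

/-- A geometric point is a point of the étale site, so its fibre functor inverts sheafification.
Stalks of ⨂_τ τ^*F can therefore be computed on the presheaf tensor product. -/
theorem toSheafify_stalk_bijective (s : Spec (.of Ω) ⟶ X) (P : X.Etaleᵒᵖ ⥤ ModuleCat.{u} A) :
    Function.Bijective
      ((preStalk s).map (toSheafify X.smallEtaleTopology P)).hom :=
  (Scheme.pointSmallEtale s).toPresheafFiber_map_bijective (toSheafify X.smallEtaleTopology P)

end Germ

/-! ### Stalks of tensor products of presheaves -/

section TensorStalk

variable {X : Scheme.{u}} {A : Type u} [CommRing A] {Ω : Type u} [Field Ω] [IsSepClosed Ω]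
  {ι : Type u}

/-- The tensor product of a family of presheaves of modules. -/
def tensorPre (P : ι → X.Etaleᵒᵖ ⥤ ModuleCat.{u} A) : X.Etaleᵒᵖ ⥤ ModuleCat.{u} A where
  obj U := ModuleCat.of A (⨂[A] i, (P i).obj U)
  map a := ModuleCat.ofHom (PiTensorProduct.map fun i => ((P i).map a).hom)
  map_id U := by
    ext : 1
    simp only [CategoryTheory.Functor.map_id, ModuleCat.hom_id, ModuleCat.hom_ofHom]
    exact PiTensorProduct.map_id
  map_comp a b := by
    ext : 1
    simp only [CategoryTheory.Functor.map_comp, ModuleCat.hom_comp, ModuleCat.hom_ofHom]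
    exact PiTensorProduct.map_comp _ _

variable (s : Spec (.of Ω) ⟶ X) (P : ι → X.Etaleᵒᵖ ⥤ ModuleCat.{u} A)

theorem exists_germ_family [Finite ι] (x : ∀ i, (preStalk s).obj (P i)) :
    ∃ (V : X.Etale) (v : Spec (.of Ω) ⟶ dom V) (hv : v ≫ str V = s) (m : ∀ i, (P i).obj (op V)),
      ∀ i, germ s (P i) V v hv (m i) = x i := by
  choose V v hv m hm using fun i => exists_germ s (P i) (x i)
  obtain ⟨W, w, hw, a, ha⟩ := exists_common_nbhd s V v hv
  exact ⟨W, w, hw, fun i => ((P i).map (a i).op).hom (m i),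
    fun i => (germ_res s (P i) (a i) w hw (v i) (hv i) (ha i) (m i)).trans (hm i)⟩

theorem exists_res_eq_of_germ_eq [Finite ι] (V : X.Etale) (v : Spec (.of Ω) ⟶ dom V)
    (hv : v ≫ str V = s) (m m' : ∀ i, (P i).obj (op V))
    (h : ∀ i, germ s (P i) V v hv (m i) = germ s (P i) V v hv (m' i)) :
    ∃ (U : X.Etale) (a : U ⟶ V) (u : Spec (.of Ω) ⟶ dom U) (_ : u ≫ str U = s),
      u ≫ homDom a = v ∧ ∀ i, ((P i).map a.op).hom (m i) = ((P i).map a.op).hom (m' i) := by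
  classical
  cases nonempty_fintype ι
  suffices H : ∀ S : Finset ι, ∃ (U : X.Etale) (a : U ⟶ V) (u : Spec (.of Ω) ⟶ dom U)
      (_ : u ≫ str U = s), u ≫ homDom a = v ∧
      ∀ i ∈ S, ((P i).map a.op).hom (m i) = ((P i).map a.op).hom (m' i) by
    obtain ⟨U, a, u, hu, ha, H⟩ := H Finset.univ
    exact ⟨U, a, u, hu, ha, fun i => H i (Finset.mem_univ i)⟩
  intro S
  induction S using Finset.induction_on with
  | empty =>
    exact ⟨V, 𝟙 V, v, hv, Category.comp_id v, fun i hi => absurd hi (Finset.notMem_empty i)⟩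
  | insert j S _ ih =>
    obtain ⟨U, a, u, hu, ha, H⟩ := ih
    have hj := h j
    rw [← germ_res s (P j) a u hu v hv ha, ← germ_res s (P j) a u hu v hv ha, germ_eq_iff] at hj
    obtain ⟨U', b, u', hu', hb, hj⟩ := hj
    have hcomp (i : ι) (z : (P i).obj (op V)) : ((P i).map (b ≫ a).op).hom z =
        ((P i).map b.op).hom (((P i).map a.op).hom z) := by
      rw [op_comp, Functor.map_comp]; rfl
    refine ⟨U', b ≫ a, u', hu', ?_, fun i hi => ?_⟩
    · rw [homDom_comp, ← Category.assoc, hb, ha]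
    · rw [hcomp, hcomp]
      rcases Finset.mem_insert.1 hi with rfl | hi
      · exact hj
      · rw [H i hi]

/-- The germ of a pure tensor. -/
def germTprod (V : X.Etale) (v : Spec (.of Ω) ⟶ dom V) (hv : v ≫ str V = s) :
    MultilinearMap A (fun i => (P i).obj (op V)) ((preStalk s).obj (tensorPre P)) :=
  LinearMap.compMultilinearMap
    (show (⨂[A] i, (P i).obj (op V)) →ₗ[A] _ from germ s (tensorPre P) V v hv)
    (PiTensorProduct.tprod A)

theorem germTprod_res {U V : X.Etale} (a : U ⟶ V) (u : Spec (.of Ω) ⟶ dom U)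
    (hu : u ≫ str U = s) (v : Spec (.of Ω) ⟶ dom V) (hv : v ≫ str V = s)
    (huv : u ≫ homDom a = v) (m : ∀ i, (P i).obj (op V)) :
    germTprod s P V v hv m = germTprod s P U u hu fun i => ((P i).map a.op).hom (m i) := by
  refine (germ_res s (tensorPre P) a u hu v hv huv _).symm.trans ?_
  exact congrArg (germ s (tensorPre P) U u hu)
    (PiTensorProduct.map_tprod (fun i => ((P i).map a.op).hom) m)

/-- Finitely many equalities of germs hold simultaneously on one small enough neighbourhood. This
makes the inverse of `stalkTensor` independent of the chosen representatives. -/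
theorem germTprod_eq [Finite ι] {V V' : X.Etale} {v : Spec (.of Ω) ⟶ dom V}
    {hv : v ≫ str V = s} {v' : Spec (.of Ω) ⟶ dom V'} {hv' : v' ≫ str V' = s}
    (m : ∀ i, (P i).obj (op V)) (m' : ∀ i, (P i).obj (op V'))
    (h : ∀ i, germ s (P i) V v hv (m i) = germ s (P i) V' v' hv' (m' i)) :
    germTprod s P V v hv m = germTprod s P V' v' hv' m' := by
  obtain ⟨W, w, hw, a, ha⟩ := exists_common_nbhd s (ι := Bool) (fun b => cond b V V')
    (fun b => match b with | true => v | false => v')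
    (fun b => match b with | true => hv | false => hv')
  obtain ⟨a₁, ha₁⟩ : ∃ a₁ : W ⟶ V, w ≫ homDom a₁ = v := ⟨a true, ha true⟩
  obtain ⟨a₂, ha₂⟩ : ∃ a₂ : W ⟶ V', w ≫ homDom a₂ = v' := ⟨a false, ha false⟩
  obtain ⟨U, b, u, hu, hb, H⟩ := exists_res_eq_of_germ_eq s P W w hw
    (fun i => ((P i).map a₁.op).hom (m i)) (fun i => ((P i).map a₂.op).hom (m' i)) (fun i => by
      rw [germ_res s (P i) a₁ w hw v hv ha₁, germ_res s (P i) a₂ w hw v' hv' ha₂, h])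
  rw [germTprod_res s P a₁ w hw v hv ha₁, germTprod_res s P a₂ w hw v' hv' ha₂,
    germTprod_res s P b u hu w hw hb, germTprod_res s P b u hu w hw hb]
  exact congrArg _ (funext H)

/-- The stalk of a tensor product maps to the tensor product of the stalks. -/
def stalkTensor : (preStalk s).obj (tensorPre P) →ₗ[A] ⨂[A] i, (preStalk s).obj (P i) :=
  preStalkLift s (tensorPre P)
    (fun V v hv => (PiTensorProduct.map fun i => germ s (P i) V v hv :
      (⨂[A] i, (P i).obj (op V)) →ₗ[A] _))
    (fun {U V} a u hu m => by
      refine (LinearMap.congr_fun (PiTensorProduct.map_comp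
        (fun i => germ s (P i) U u hu) (fun i => ((P i).map a.op).hom)) m).symm.trans ?_
      congr 2
      funext i
      ext z
      exact germ_res s (P i) a u hu _ _ rfl z)

theorem stalkTensor_germTprod (V : X.Etale) (v : Spec (.of Ω) ⟶ dom V) (hv : v ≫ str V = s)
    (m : ∀ i, (P i).obj (op V)) :
    stalkTensor s P (germTprod s P V v hv m) =
      PiTensorProduct.tprod A fun i => germ s (P i) V v hv (m i) :=
  (preStalkLift_germ s (tensorPre P) _ _ V v hv _).trans (PiTensorProduct.map_tprod _ m)

theorem tensorPre_germ_induction {p : (preStalk s).obj (tensorPre P) → Prop}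
    (add : ∀ x y, p x → p y → p (x + y)) (smul : ∀ (a : A) x, p x → p (a • x))
    (tprod : ∀ (V : X.Etale) (v : Spec (.of Ω) ⟶ dom V) (hv : v ≫ str V = s)
      (m : ∀ i, (P i).obj (op V)), p (germTprod s P V v hv m))
    (x : (preStalk s).obj (tensorPre P)) : p x := by
  obtain ⟨V, v, hv, m, rfl⟩ := exists_germ s _ x
  induction (show ⨂[A] i, (P i).obj (op V) from m) using PiTensorProduct.induction_on with
  | smul_tprod r f =>
    refine cast (congrArg p ?_) (smul r _ (tprod V v hv f))
    exact ((germ s (tensorPre P) V v hv).map_smul r _).symm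
  | add x y hx hy =>
    refine cast (congrArg p ?_) (add _ _ hx hy)
    exact ((germ s (tensorPre P) V v hv).map_add x y).symm

theorem germ_update [DecidableEq ι] {x : ∀ i, (preStalk s).obj (P i)} (V : X.Etale)
    (v : Spec (.of Ω) ⟶ dom V) (hv : v ≫ str V = s) {m : ∀ i, (P i).obj (op V)}
    (h : ∀ i, germ s (P i) V v hv (m i) = x i) {i : ι} {n : (P i).obj (op V)}
    {y : (preStalk s).obj (P i)} (hn : germ s (P i) V v hv n = y) (j : ι) :
    germ s (P j) V v hv (Function.update m i n j) = Function.update x i y j := by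
  by_cases hj : j = i
  · subst hj; simpa using hn
  · simpa [hj] using h j

variable [Finite ι]

/-- The map defining the inverse of `stalkTensor`. -/
def stalkTensorInvFun (x : ∀ i, (preStalk s).obj (P i)) : (preStalk s).obj (tensorPre P) :=
  germTprod s P (exists_germ_family s P x).choose
    (exists_germ_family s P x).choose_spec.choose
    (exists_germ_family s P x).choose_spec.choose_spec.choose
    (exists_germ_family s P x).choose_spec.choose_spec.choose_spec.choose

theorem stalkTensorInvFun_eq {x : ∀ i, (preStalk s).obj (P i)} (V : X.Etale)
    (v : Spec (.of Ω) ⟶ dom V) (hv : v ≫ str V = s) (m : ∀ i, (P i).obj (op V))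
    (h : ∀ i, germ s (P i) V v hv (m i) = x i) :
    stalkTensorInvFun s P x = germTprod s P V v hv m :=
  germTprod_eq s P _ m fun j =>
    ((exists_germ_family s P x).choose_spec.choose_spec.choose_spec.choose_spec j).trans (h j).symm

/-- The multilinear map defining the inverse of `stalkTensor`. -/
def stalkTensorInvAux :
    MultilinearMap A (fun i => (preStalk s).obj (P i)) ((preStalk s).obj (tensorPre P)) where
  toFun := stalkTensorInvFun s P
  map_update_add' {inst} x i y z := by
    -- The index type adjoins two elements to ι, so that y, z and all the x j are represented over
    -- the same neighbourhood; additivity then reduces to that of a pure tensor of sections.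
    obtain ⟨V, v, hv, m, hm⟩ := exists_germ_family s (ι := Option (Option ι))
      (fun o => o.elim (P i) (fun o' => o'.elim (P i) P))
      (fun o => match o with | none => y | some none => z | some (some j) => x j)
    let mx : ∀ j, (P j).obj (op V) := fun j => m (some (some j))
    have hx (j : ι) : germ s (P j) V v hv (mx j) = x j := hm (some (some j))
    let my : (P i).obj (op V) := m none
    have hy : germ s (P i) V v hv my = y := hm none
    let mz : (P i).obj (op V) := m (some none)
    have hz : germ s (P i) V v hv mz = z := hm (some none)
    rw [stalkTensorInvFun_eq s P V v hv (Function.update mx i (my + mz))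
        (germ_update s P V v hv hx (by rw [map_add, hy, hz])),
      stalkTensorInvFun_eq s P V v hv (Function.update mx i my) (germ_update s P V v hv hx hy),
      stalkTensorInvFun_eq s P V v hv (Function.update mx i mz) (germ_update s P V v hv hx hz),
      MultilinearMap.map_update_add]
  map_update_smul' {inst} x i c y := by
    obtain ⟨V, v, hv, m, hm⟩ := exists_germ_family s (ι := Option ι)
      (fun o => o.elim (P i) P)
      (fun o => match o with | none => y | some j => x j)
    let mx : ∀ j, (P j).obj (op V) := fun j => m (some j)
    have hx (j : ι) : germ s (P j) V v hv (mx j) = x j := hm (some j)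
    let my : (P i).obj (op V) := m none
    have hy : germ s (P i) V v hv my = y := hm none
    rw [stalkTensorInvFun_eq s P V v hv (Function.update mx i (c • my))
        (germ_update s P V v hv hx (by rw [map_smul, hy])),
      stalkTensorInvFun_eq s P V v hv (Function.update mx i my) (germ_update s P V v hv hx hy),
      MultilinearMap.map_update_smul]

theorem stalkTensorInvAux_germ (V : X.Etale) (v : Spec (.of Ω) ⟶ dom V) (hv : v ≫ str V = s)
    (m : ∀ i, (P i).obj (op V)) :
    stalkTensorInvAux s P (fun i => germ s (P i) V v hv (m i)) = germTprod s P V v hv m :=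
  stalkTensorInvFun_eq s P V v hv m fun _ => rfl

/-- Finite tensor products commute with filtered colimits. The inverse represents all the factors
over one common neighbourhood and takes the germ of the tensor of the representatives. -/
theorem stalkTensor_bijective : Function.Bijective (stalkTensor s P) := by
  refine Function.bijective_iff_has_inverse.2
    ⟨PiTensorProduct.lift (stalkTensorInvAux s P), fun x => ?_, fun y => ?_⟩
  · induction x using tensorPre_germ_induction with
    | add x y hx hy => rw [map_add, map_add, hx, hy]
    | smul a x hx => rw [map_smul, map_smul, hx]
    | tprod V v hv m =>
      rw [stalkTensor_germTprod, PiTensorProduct.lift.tprod, stalkTensorInvAux_germ]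
  · induction y using PiTensorProduct.induction_on with
    | smul_tprod r f =>
      obtain ⟨V, v, hv, m, hm⟩ := exists_germ_family s P f
      obtain rfl : (fun i => germ s (P i) V v hv (m i)) = f := funext hm
      rw [map_smul, map_smul, PiTensorProduct.lift.tprod, stalkTensorInvAux_germ,
        stalkTensor_germTprod]
    | add x y hx hy => rw [map_add, map_add, hx, hy]

end TensorStalk

/-! ### Stalks of inverse images along étale morphisms -/

section PushStalk

variable {Y Z : Scheme.{u}} {A : Type u} [CommRing A] {Ω : Type u} [Field Ω]

theorem etale_homDom {X : Scheme.{u}} {U V : X.Etale} (a : U ⟶ V) : Etale (homDom a) := by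
  have : Etale (homDom a ≫ str V) := by rw [homDom_str]; infer_instance
  exact MorphismProperty.of_postcomp etaleProp _ (str V) (inferInstance : Etale (str V)) this

theorem compose_nbhd (a : Y ⟶ Z) [Etale a] (ψ : Spec (.of Ω) ⟶ Spec (.of Ω))
    {t : Spec (.of Ω) ⟶ Y} {t' : Spec (.of Ω) ⟶ Z} (w : ψ ≫ t ≫ a = t')
    (V : Y.Etale) (v : Spec (.of Ω) ⟶ dom V) (hv : v ≫ str V = t) :
    (ψ ≫ v) ≫ str ((compose a).obj V) = t' :=
  (Category.assoc _ _ _).trans (by rw [← w, ← hv, Category.assoc]; rfl)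

variable [IsSepClosed Ω]

theorem germ_eq_zero_iff (s : Spec (.of Ω) ⟶ Y) (P : Y.Etaleᵒᵖ ⥤ ModuleCat.{u} A) (V : Y.Etale)
    (v : Spec (.of Ω) ⟶ dom V) (hv : v ≫ str V = s) (m : P.obj (op V)) :
    germ s P V v hv m = 0 ↔
      ∃ (U : Y.Etale) (a : U ⟶ V) (u : Spec (.of Ω) ⟶ dom U) (_ : u ≫ str U = s),
        u ≫ homDom a = v ∧ (P.map a.op).hom m = 0 := by
  rw [← map_zero (germ s P V v hv), germ_eq_iff]
  simp only [map_zero]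

/-- The map `(V, v, m) ↦ (V, v ∘ ψ, m)` from the stalk of `a^* F` at `t` to the stalk of `F` at
`t' = a ∘ t ∘ ψ`, where `V` is an étale neighbourhood of `t`. -/
def pushStalk (a : Y ⟶ Z) [Etale a] (ψ : Spec (.of Ω) ⟶ Spec (.of Ω)) {t : Spec (.of Ω) ⟶ Y}
    {t' : Spec (.of Ω) ⟶ Z} (w : ψ ≫ t ≫ a = t') (F : Shv A Z) :
    (stalk t).obj ((restrict a).obj F) →ₗ[A] (stalk t').obj F :=
  preStalkLift t ((restrict a).obj F).obj
    (fun V v hv => germ t' F.obj ((compose a).obj V) (ψ ≫ v)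
      (compose_nbhd a ψ w V v hv))
    (fun b _ _ m => germ_res t' F.obj ((compose a).map b) _ _ _ _ (Category.assoc _ _ _) m)

theorem pushStalk_germ (a : Y ⟶ Z) [Etale a] (ψ : Spec (.of Ω) ⟶ Spec (.of Ω))
    {t : Spec (.of Ω) ⟶ Y} {t' : Spec (.of Ω) ⟶ Z} (w : ψ ≫ t ≫ a = t') (F : Shv A Z)
    (V : Y.Etale) (v : Spec (.of Ω) ⟶ dom V) (hv : v ≫ str V = t)
    (hv' : (ψ ≫ v) ≫ str ((compose a).obj V) = t')
    (m : ((restrict a).obj F).obj.obj (op V)) :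
    pushStalk a ψ w F (germ t ((restrict a).obj F).obj V v hv m) =
      germ t' F.obj ((compose a).obj V) (ψ ≫ v) hv' m :=
  preStalkLift_germ _ _ _ _ V v hv m

/-- A neighbourhood of t' that refines V over Z is also étale over Y through V, so a section that
dies near t' already dies near t. -/
theorem pushStalk_injective (a : Y ⟶ Z) [Etale a] (ψ : Spec (.of Ω) ⟶ Spec (.of Ω)) [IsIso ψ]
    {t : Spec (.of Ω) ⟶ Y} {t' : Spec (.of Ω) ⟶ Z} (w : ψ ≫ t ≫ a = t') (F : Shv A Z) :
    Function.Injective (pushStalk a ψ w F) := by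
  rw [injective_iff_map_eq_zero]
  intro p hp
  obtain ⟨V, v, hv, m, rfl⟩ := exists_germ t ((restrict a).obj F).obj p
  have hv' := compose_nbhd a ψ w V v hv
  have h₀ := (pushStalk_germ a ψ w F V v hv hv' m).symm.trans hp
  obtain ⟨U, b, u, hu, hb, h⟩ := (germ_eq_zero_iff t' F.obj ((compose a).obj V) (ψ ≫ v) hv' m).1 h₀
  have hu' : u ≫ homDom b = ψ ≫ v := hb
  let d : dom U ⟶ dom V := homDom b
  have hd : Etale d := etale_homDom b
  let W : Y.Etale := obj (d ≫ str V)
  let b' : W ⟶ V := homOf d rfl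
  -- The point u lies over ψ ≫ v, so ψ has to be undone to obtain a neighbourhood of t refining (V,
  -- v).
  let u' : Spec (.of Ω) ⟶ dom W := inv ψ ≫ u
  have hW : u' ≫ homDom b' = v := (Category.assoc _ _ _).trans
    ((congrArg (inv ψ ≫ ·) hu').trans (IsIso.inv_hom_id_assoc ψ v))
  have hW' : u' ≫ str W = t := by
    rw [← homDom_str b', ← Category.assoc, hW, hv]
  let e : (compose a).obj W ⟶ U := homOf (𝟙 (dom U))
    ((Category.id_comp _).trans ((homDom_str b).symm.trans (Category.assoc d (str V) a).symm))
  have he : (compose a).map b' = e ≫ b := hom_ext' (Category.id_comp (homDom b)).symm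
  refine (germ_res t ((restrict a).obj F).obj b' u' hW' v hv hW m).symm.trans ?_
  refine (congrArg _ ?_).trans (map_zero (germ t ((restrict a).obj F).obj W u' hW'))
  refine (congrArg (fun c => (F.obj.map (Quiver.Hom.op c)).hom m) he).trans ?_
  refine (congrArg (fun c => (ModuleCat.Hom.hom c) m) (F.obj.map_comp b.op e.op)).trans ?_
  exact (congrArg (F.obj.map e.op).hom h).trans (map_zero _)

/-- A neighbourhood (U, u) of t' pulls back to U ×_Z Y, which is a neighbourhood of t through the
point with components ψ⁻¹ ≫ u and t. -/
theorem pushStalk_surjective (a : Y ⟶ Z) [Etale a] (ψ : Spec (.of Ω) ⟶ Spec (.of Ω)) [IsIso ψ]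
    {t : Spec (.of Ω) ⟶ Y} {t' : Spec (.of Ω) ⟶ Z} (w : ψ ≫ t ≫ a = t') (F : Shv A Z) :
    Function.Surjective (pushStalk a ψ w F) := by
  intro p
  obtain ⟨U, u, hu, m, rfl⟩ := exists_germ t' F.obj p
  let V : Y.Etale := (baseChange a).obj U
  have hut : (inv ψ ≫ u) ≫ str U = t ≫ a := by
    rw [Category.assoc, hu, ← w, IsIso.inv_hom_id_assoc]
  let v : Spec (.of Ω) ⟶ dom V := (bc_isPullback a U).lift (inv ψ ≫ u) t hut
  have hv : v ≫ str V = t := (bc_isPullback a U).lift_snd _ _ _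
  have hv₁ : v ≫ bcFst a U = inv ψ ≫ u := (bc_isPullback a U).lift_fst _ _ _
  let c : (compose a).obj V ⟶ U := homOf (bcFst a U) (bc_isPullback a U).w
  have hv' := compose_nbhd a ψ w V v hv
  refine ⟨germ t ((restrict a).obj F).obj V v hv ((F.obj.map c.op).hom m), ?_⟩
  refine (pushStalk_germ a ψ w F V v hv hv' _).trans ?_
  refine germ_res t' F.obj c (ψ ≫ v) hv' u hu ?_ m
  refine (Category.assoc ψ v (bcFst a U)).trans ?_
  rw [hv₁, IsIso.hom_inv_id_assoc]

/-- `pushStalk` as an isomorphism. -/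
def pushStalkEquiv (a : Y ⟶ Z) [Etale a] (ψ : Spec (.of Ω) ⟶ Spec (.of Ω)) [IsIso ψ]
    {t : Spec (.of Ω) ⟶ Y} {t' : Spec (.of Ω) ⟶ Z} (w : ψ ≫ t ≫ a = t') (F : Shv A Z) :
    (stalk t).obj ((restrict a).obj F) ≃ₗ[A] (stalk t').obj F :=
  LinearEquiv.ofBijective (pushStalk a ψ w F)
    ⟨pushStalk_injective a ψ w F, pushStalk_surjective a ψ w F⟩

theorem pushStalk_naturality (a : Y ⟶ Z) [Etale a] (ψ : Spec (.of Ω) ⟶ Spec (.of Ω))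
    {t : Spec (.of Ω) ⟶ Y} {t' : Spec (.of Ω) ⟶ Z} (w : ψ ≫ t ≫ a = t') {F F' : Shv A Z}
    (φ : F ⟶ F') (p : (stalk t).obj ((restrict a).obj F)) :
    pushStalk a ψ w F' (((stalk t).map ((restrict a).map φ)).hom p) =
      ((stalk t').map φ).hom (pushStalk a ψ w F p) := by
  obtain ⟨V, v, hv, m, rfl⟩ := exists_germ t ((restrict a).obj F).obj p
  have hv' := compose_nbhd a ψ w V v hv
  refine Eq.trans ?_ (congrArg _ (pushStalk_germ a ψ w F V v hv hv' m)).symm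
  refine (congrArg _ (stalk_map_germ t ((restrict a).map φ) V v hv m)).trans ?_
  refine (pushStalk_germ a ψ w F' V v hv hv' _).trans ?_
  exact (stalk_map_germ t' φ _ _ hv' m).symm

end PushStalk

/-! ### Gluing of sections -/

section Glue

variable {X : Scheme.{u}} {A : Type u} [CommRing A]

/-- The restriction map of a presheaf of modules. -/
def res (P : X.Etaleᵒᵖ ⥤ ModuleCat.{u} A) {U V : X.Etale} (a : U ⟶ V) :
    P.obj (op V) →ₗ[A] P.obj (op U) :=
  (P.map a.op).hom

theorem res_res (P : X.Etaleᵒᵖ ⥤ ModuleCat.{u} A) {U V W : X.Etale} (a : U ⟶ V) (b : V ⟶ W)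
    (m : P.obj (op W)) : res P a (res P b m) = res P (a ≫ b) m := by
  unfold res; rw [op_comp, P.map_comp]; rfl

theorem res_id (P : X.Etaleᵒᵖ ⥤ ModuleCat.{u} A) {V : X.Etale} (m : P.obj (op V)) :
    res P (𝟙 V) m = m := by
  unfold res; rw [op_id, P.map_id]; rfl

theorem res_app {P Q : X.Etaleᵒᵖ ⥤ ModuleCat.{u} A} (φ : P ⟶ Q) {U V : X.Etale} (a : U ⟶ V)
    (m : P.obj (op V)) : (φ.app (op U)).hom (res P a m) = res Q a ((φ.app (op V)).hom m) :=
  ConcreteCategory.congr_hom (φ.naturality a.op) m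

theorem isSheaf_type (F : Shv A X) :
    Presieve.IsSheaf X.smallEtaleTopology (F.obj ⋙ forget (ModuleCat.{u} A)) :=
  (isSheaf_iff_isSheaf_of_type _ _).1
    (GrothendieckTopology.HasSheafCompose.isSheaf (F := forget (ModuleCat.{u} A)) _ F.property)

/-- Sections of P glue inside the sheaf N, and locality of the condition of lying in P puts the
glued section back into P. It is applied to invariant sections inside a direct image. -/
theorem isSheaf_of_injective {P : X.Etaleᵒᵖ ⥤ ModuleCat.{u} A} (N : Shv A X) (i : P ⟶ N.obj)
    (hi : ∀ U : X.Etale, Function.Injective (i.app (op U)).hom)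
    (hloc : ∀ (U : X.Etale) (S : Sieve U) (_ : S ∈ X.smallEtaleTopology U) (n : N.obj.obj (op U)),
      (∀ (V : X.Etale) (f : V ⟶ U), S f → res N.obj f n ∈ LinearMap.range (i.app (op V)).hom) →
        n ∈ LinearMap.range (i.app (op U)).hom) :
    Presheaf.IsSheaf X.smallEtaleTopology P := by
  intro E U S hS x hx
  let x' : Presieve.FamilyOfElements (N.obj ⋙ coyoneda.obj (op E)) S.arrows :=
    fun V f hf => (show E ⟶ P.obj (op V) from x f hf) ≫ i.app (op V)
  have hx' : x'.Compatible := fun V₁ V₂ W g₁ g₂ f₁ f₂ h₁ h₂ e => by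
    have h : (show E ⟶ P.obj (op V₁) from x f₁ h₁) ≫ P.map g₁.op =
        (show E ⟶ P.obj (op V₂) from x f₂ h₂) ≫ P.map g₂.op := hx g₁ g₂ h₁ h₂ e
    change ((show E ⟶ P.obj (op V₁) from x f₁ h₁) ≫ i.app (op V₁)) ≫ N.obj.map g₁.op =
      ((show E ⟶ P.obj (op V₂) from x f₂ h₂) ≫ i.app (op V₂)) ≫ N.obj.map g₂.op
    rw [Category.assoc, Category.assoc, ← i.naturality, ← i.naturality, reassoc_of% h]
  obtain ⟨t, ht, hu⟩ := N.property E S hS x' hx'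
  let t' : E ⟶ N.obj.obj (op U) := t
  have ht' (V : X.Etale) (f : V ⟶ U) (hf : S f) :
      t' ≫ N.obj.map f.op = (show E ⟶ P.obj (op V) from x f hf) ≫ i.app (op V) := ht f hf
  let l : E ⟶ P.obj (op U) := ModuleCat.ofHom
    ((LinearEquiv.ofInjective (i.app (op U)).hom (hi U)).symm.toLinearMap ∘ₗ
      t'.hom.codRestrict _ fun e => hloc U S hS _ fun V f hf =>
        ⟨(show E ⟶ P.obj (op V) from x f hf).hom e,
          (ConcreteCategory.congr_hom (ht' V f hf) e).symm⟩)
  have hl : l ≫ i.app (op U) = t' := by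
    ext e
    exact congrArg Subtype.val ((LinearEquiv.ofInjective (i.app (op U)).hom (hi U)).apply_symm_apply _)
  have hinj (V : X.Etale) (a b : E ⟶ P.obj (op V)) (h : a ≫ i.app (op V) = b ≫ i.app (op V)) :
      a = b := by
    ext e
    exact hi V (ConcreteCategory.congr_hom h e)
  refine ⟨l, fun V f hf => hinj V _ _ ?_, fun l' hl' => hinj U _ _ ?_⟩
  · refine Eq.trans ?_ (ht' V f hf)
    change (l ≫ P.map f.op) ≫ i.app (op V) = _
    rw [Category.assoc, i.naturality, reassoc_of% hl]
  · refine Eq.trans (hu _ fun V f hf => ?_) hl.symm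
    have h : (show E ⟶ P.obj (op U) from l') ≫ P.map f.op =
      (show E ⟶ P.obj (op V) from x f hf) := hl' f hf
    change ((show E ⟶ P.obj (op U) from l') ≫ i.app (op U)) ≫ N.obj.map f.op =
      (show E ⟶ P.obj (op V) from x f hf) ≫ i.app (op V)
    rw [Category.assoc, ← i.naturality, reassoc_of% h]

theorem ofArrows_mem {ι : Type*} {V : X.Etale} {W : ι → X.Etale} (f : ∀ i, W i ⟶ V)
    (hf : ∀ z : dom V, ∃ (i : ι) (w : dom (W i)), homDom (f i) w = z) :
    Sieve.generate (Presieve.ofArrows W f) ∈ X.smallEtaleTopology V := by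
  rw [mem_smallEtaleTopology_iff]
  intro z
  obtain ⟨i, w, hw⟩ := hf z
  exact ⟨W i, f i, w, Sieve.le_generate _ _ _ ⟨i⟩, hw⟩

theorem isSheafFor_arrows (F : Shv A X) {ι : Type*} {V : X.Etale} {W : ι → X.Etale}
    (f : ∀ i, W i ⟶ V) (hf : ∀ z : dom V, ∃ (i : ι) (w : dom (W i)), homDom (f i) w = z) :
    (Presieve.ofArrows W f).IsSheafFor (F.obj ⋙ forget (ModuleCat.{u} A)) :=
  (Presieve.isSheafFor_iff_generate _).2 (isSheaf_type F _ (ofArrows_mem f hf))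

theorem section_ext (F : Shv A X) {ι : Type*} {V : X.Etale} {W : ι → X.Etale} (f : ∀ i, W i ⟶ V)
    (hf : ∀ z : dom V, ∃ (i : ι) (w : dom (W i)), homDom (f i) w = z) {m m' : F.obj.obj (op V)}
    (h : ∀ i, res F.obj (f i) m = res F.obj (f i) m') : m = m' :=
  (isSheafFor_arrows F f hf).isSeparatedFor.ext (t₁ := m) (t₂ := m') fun _ _ hg => by
    obtain ⟨i⟩ := hg
    exact h i

theorem section_glue (F : Shv A X) {ι : Type*} {V : X.Etale} {W : ι → X.Etale} (f : ∀ i, W i ⟶ V)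
    (hf : ∀ z : dom V, ∃ (i : ι) (w : dom (W i)), homDom (f i) w = z)
    (m : ∀ i, F.obj.obj (op (W i)))
    (hm : ∀ (i j : ι) (Z : X.Etale) (a : Z ⟶ W i) (b : Z ⟶ W j), a ≫ f i = b ≫ f j →
      res F.obj a (m i) = res F.obj b (m j)) :
    ∃ t : F.obj.obj (op V), ∀ i, res F.obj (f i) t = m i := by
  obtain ⟨t, ht, -⟩ := (Presieve.isSheafFor_arrows_iff _ f).1 (isSheafFor_arrows F f hf) m hm
  exact ⟨t, ht⟩

/-- The empty family covers an empty scheme. The case is needed in gluing, because freeness of an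
action gives no information over the empty scheme. -/
theorem section_eq_of_isEmpty (F : Shv A X) {V : X.Etale} (hV : IsEmpty (dom V))
    (m m' : F.obj.obj (op V)) : m = m' :=
  section_ext F (ι := Empty) (W := fun e => e.elim) (fun e => e.elim) (fun z => hV.elim z)
    (fun e => e.elim)

end Glue

/-! ### Galois descent -/

section Descent

variable {X Y : Scheme.{u}} {π : Y ⟶ X} {A : Type u} [CommRing A] {G : Type u} [Group G]
  (ρ : G →* Aut (Over.mk π))

/-- A sheaf on `Y` with an action of `G` compatible with the action on `Y`. -/
structure Equivariant (H : Shv A Y) where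
  psi (σ : G) (V : Y.Etale) : H.obj.obj (op V) →ₗ[A] H.obj.obj (op ((compose (act ρ σ)).obj V))
  psi_res (σ : G) {U V : Y.Etale} (a : U ⟶ V) (m : H.obj.obj (op V)) :
    psi σ U (res H.obj a m) = res H.obj ((compose (act ρ σ)).map a) (psi σ V m)
  psi_one (V : Y.Etale) (c : (compose (act ρ 1)).obj V ⟶ V) (hc : homDom c = 𝟙 (dom V))
    (m : H.obj.obj (op V)) : psi 1 V m = res H.obj c m
  psi_mul (σ τ : G) (V : Y.Etale) (m : H.obj.obj (op V)) :
    psi τ _ (psi σ V m) = res H.obj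
      ((composeComp (act ρ σ) (act ρ τ) (act ρ (τ * σ)) (act_comp_act ρ σ τ)).app V)
      (psi (τ * σ) V m)

/-- `1 × σ` on `U ×_X Y`. -/
def bcAut (σ : G) (U : X.Etale) :
    (compose (act ρ σ)).obj ((baseChange π).obj U) ⟶ (baseChange π).obj U :=
  homOf ((bc_isPullback π U).lift (bcFst π U) (str ((baseChange π).obj U) ≫ act ρ σ)
    ((bc_isPullback π U).w.trans (Eq.symm ((Category.assoc _ _ _).trans
      (congrArg (str ((baseChange π).obj U) ≫ ·) (act_comp_proj ρ σ))))))
    ((bc_isPullback π U).lift_snd _ _ _)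

theorem bcAut_fst (σ : G) (U : X.Etale) : homDom (bcAut ρ σ U) ≫ bcFst π U = bcFst π U :=
  (bc_isPullback π U).lift_fst _ _ _

theorem bc_hom_ext {W : Y.Etale} {U : X.Etale} {a b : W ⟶ (baseChange π).obj U}
    (h : homDom a ≫ bcFst π U = homDom b ≫ bcFst π U) : a = b := by
  apply hom_ext'
  apply (bc_isPullback π U).hom_ext h
  rw [homDom_str, homDom_str]

theorem bcAut_naturality (σ : G) {U U' : X.Etale} (b : U' ⟶ U) :
    bcAut ρ σ U' ≫ (baseChange π).map b =
      (compose (act ρ σ)).map ((baseChange π).map b) ≫ bcAut ρ σ U := by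
  apply bc_hom_ext
  rw [homDom_comp, Category.assoc, bc_map_fst, ← Category.assoc, bcAut_fst, homDom_comp,
    Category.assoc, bcAut_fst]
  exact (bc_map_fst π b).symm

variable {ρ} {H : Shv A Y} (Ψ : Equivariant ρ H)

/-- The invariant sections over `U ×_X Y`. -/
def invariants (U : X.Etale) : Submodule A (H.obj.obj (op ((baseChange π).obj U))) where
  carrier := {h | ∀ σ, Ψ.psi σ _ h = res H.obj (bcAut ρ σ U) h}
  add_mem' ha hb σ := by rw [map_add, map_add, ha, hb]
  zero_mem' σ := by rw [map_zero, map_zero]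
  smul_mem' c h hh σ := by rw [map_smul, map_smul, hh]

theorem res_mem_invariants {U U' : X.Etale} (b : U' ⟶ U)
    {h : H.obj.obj (op ((baseChange π).obj U))} (hh : h ∈ invariants Ψ U) :
    res H.obj ((baseChange π).map b) h ∈ invariants Ψ U' := fun σ => by
  rw [Ψ.psi_res, hh σ, res_res, res_res, bcAut_naturality]

/-- The presheaf of invariant sections. -/
def descendPre : X.Etaleᵒᵖ ⥤ ModuleCat.{u} A where
  obj U := ModuleCat.of A (invariants Ψ U.unop)
  map {U U'} b := ModuleCat.ofHom
    ((res H.obj ((baseChange π).map b.unop)).restrict fun _ hh => res_mem_invariants Ψ b.unop hh)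
  map_id U := by
    ext h
    exact (congrArg (fun c => res H.obj c h.1) ((baseChange π).map_id U.unop)).trans
      (res_id H.obj h.1)
  map_comp {U V W} b c := by
    ext h
    refine (congrArg (fun c => res H.obj c h.1) ((baseChange π).map_comp c.unop b.unop)).trans ?_
    exact (res_res H.obj _ _ h.1).symm

/-- The inclusion of the invariant sections. -/
def invariantsIncl : descendPre Ψ ⟶ ((pushforward π).obj H).obj where
  app U := ModuleCat.ofHom (invariants Ψ U.unop).subtype

/-- Invariance under σ is the equality of two sections of the sheaf π_* σ^* H, hence a local
condition. -/
theorem descendPre_isSheaf : Presheaf.IsSheaf X.smallEtaleTopology (descendPre Ψ) := by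
  refine isSheaf_of_injective _ (invariantsIncl Ψ) (fun U => Subtype.val_injective)
    fun U S hS n hn => ?_
  let n' : H.obj.obj (op ((baseChange π).obj U)) := n
  suffices h : n' ∈ invariants Ψ U from ⟨⟨n', h⟩, rfl⟩
  intro σ
  let N' : Shv A X := (pushforward π).obj ((restrict (act ρ σ)).obj H)
  refine (isSheaf_type N' S hS).isSeparatedFor.ext fun V f hf => ?_
  obtain ⟨⟨m, hm⟩, hmn⟩ := hn V f hf
  have hmn' : m = res H.obj ((baseChange π).map f) n' := hmn
  have h₁ := Ψ.psi_res σ ((baseChange π).map f) n'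
  rw [← hmn', hm σ, hmn', res_res, bcAut_naturality, ← res_res] at h₁
  exact h₁.symm

/-- The sheaf of invariant sections. -/
def descend : Shv A X := ⟨descendPre Ψ, descendPre_isSheaf Ψ⟩

variable [Etale π]

/-- The graph `V ⟶ V ×_X Y`. -/
def graph (V : Y.Etale) : V ⟶ (baseChange π).obj ((compose π).obj V) :=
  homOf ((bc_isPullback π ((compose π).obj V)).lift (𝟙 (dom V)) (str V) (Category.id_comp _))
    ((bc_isPullback π ((compose π).obj V)).lift_snd _ _ _)

theorem graph_fst (V : Y.Etale) :
    homDom (graph (π := π) V) ≫ bcFst π ((compose π).obj V) = 𝟙 (dom V) :=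
  (bc_isPullback π ((compose π).obj V)).lift_fst _ _ _

theorem graph_naturality {V V' : Y.Etale} (a : V ⟶ V') :
    graph (π := π) V ≫ (baseChange π).map ((compose π).map a) = a ≫ graph V' := by
  apply bc_hom_ext
  rw [homDom_comp, Category.assoc, bc_map_fst, ← Category.assoc, graph_fst, homDom_comp,
    Category.assoc, graph_fst]
  exact (Category.id_comp (homDom a)).trans (Category.comp_id (homDom a)).symm

variable (ρ) in
/-- The graph of `σ`, `V ⟶ V ×_X Y`. -/
def twistedGraph (σ : G) (V : Y.Etale) :
    (compose (act ρ σ)).obj V ⟶ (baseChange π).obj ((compose π).obj V) :=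
  (compose (act ρ σ)).map (graph V) ≫ bcAut ρ σ _

theorem twistedGraph_fst (σ : G) (V : Y.Etale) :
    homDom (twistedGraph ρ σ V) ≫ bcFst π ((compose π).obj V) = 𝟙 (dom V) := by
  unfold twistedGraph
  rw [homDom_comp, Category.assoc, bcAut_fst]
  exact graph_fst V

/-- A morphism to `V` with twisted structure map, as a morphism of schemes to the source of `V`. -/
def untwist {f : Y ⟶ Y} [Etale f] {Z V : Y.Etale} (a : Z ⟶ (compose f).obj V) : dom Z ⟶ dom V :=
  homDom (V := (compose f).obj V) a

theorem untwist_str {f : Y ⟶ Y} [Etale f] {Z V : Y.Etale} (a : Z ⟶ (compose f).obj V) :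
    (untwist a ≫ str V) ≫ f = str Z :=
  (Category.assoc _ _ _).trans (homDom_str (V := (compose f).obj V) a)

theorem untwist_twistedGraph (σ : G) {Z V : Y.Etale} (a : Z ⟶ (compose (act ρ σ)).obj V) :
    homDom (a ≫ twistedGraph ρ σ V) ≫ bcFst π ((compose π).obj V) = untwist a := by
  have h : homDom a ≫ homDom (twistedGraph ρ σ V) ≫ bcFst π ((compose π).obj V) =
    homDom a ≫ 𝟙 (dom ((compose (act ρ σ)).obj V)) := congrArg (homDom a ≫ ·) (twistedGraph_fst σ V)
  rw [Category.comp_id] at h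
  rw [homDom_comp, Category.assoc]
  exact h

omit [Etale π] in
theorem untwist_bcAut (σ : G) {Z : Y.Etale} {U : X.Etale}
    (a : Z ⟶ (compose (act ρ σ)).obj ((baseChange π).obj U)) :
    homDom (a ≫ bcAut ρ σ U) ≫ bcFst π U = untwist a ≫ bcFst π U := by
  have h : homDom a ≫ homDom (bcAut ρ σ U) ≫ bcFst π U = untwist a ≫ bcFst π U :=
    congrArg (homDom a ≫ ·) (bcAut_fst ρ σ U)
  rw [homDom_comp, Category.assoc]
  exact h

/-- Translating the graph of τ by 1 × σ yields the graph of στ: both sides are maps into a fibre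
product over Y with the same first component. This is what makes the glued section of
`descendHom_surjective` invariant. -/
theorem twistedGraph_comp (σ τ : G) (V : Y.Etale)
    (c : (compose (act ρ σ)).obj ((compose (act ρ τ)).obj V) ⟶ (compose (act ρ (σ * τ))).obj V)
    (hc : untwist c = 𝟙 (dom V)) :
    c ≫ twistedGraph ρ (σ * τ) V =
      (compose (act ρ σ)).map (twistedGraph ρ τ V) ≫ bcAut ρ σ ((compose π).obj V) := by
  apply bc_hom_ext
  have h₁ := untwist_twistedGraph (σ * τ) c
  have h₂ := untwist_bcAut σ ((compose (act ρ σ)).map (twistedGraph ρ τ V))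
  have h₃ : untwist ((compose (act ρ σ)).map (twistedGraph ρ τ V)) ≫ bcFst π ((compose π).obj V) =
    𝟙 (dom V) := twistedGraph_fst τ V
  refine h₁.trans ?_
  refine Eq.trans ?_ h₂.symm
  refine Eq.trans ?_ h₃.symm
  exact hc

theorem twistedGraph_eq (σ : G) (V : Y.Etale) (c : (compose π).obj ((compose (act ρ σ)).obj V) ⟶
    (compose π).obj V) (hc : homDom c = 𝟙 (dom V)) :
    twistedGraph ρ σ V = graph ((compose (act ρ σ)).obj V) ≫ (baseChange π).map c := by
  apply bc_hom_ext
  rw [twistedGraph_fst, homDom_comp, Category.assoc, bc_map_fst, ← Category.assoc, graph_fst]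
  exact hc.symm.trans (Category.id_comp (homDom c)).symm

/-- The map from the inverse image of the descended sheaf. -/
def descendHom : (restrict π).obj (descend Ψ) ⟶ H where
  hom :=
    { app V := ModuleCat.ofHom (res H.obj (graph V.unop) ∘ₗ
        (invariants Ψ ((compose π).obj V.unop)).subtype)
      naturality V V' a := by
        ext h
        let h' : invariants Ψ ((compose π).obj V.unop) := h
        refine (res_res H.obj _ _ h'.1).trans ?_
        exact (congrArg (fun c => res H.obj c h'.1) (graph_naturality a.unop)).trans
          (res_res H.obj _ _ _).symm }

/-! ### Effectiveness of descent for a simply transitive action -/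

variable (ρ) in
/-- `G` acts simply transitively on the fibres of `π`. -/
structure IsTorsor : Prop where
  exists_act : ∀ (Ω : Type u) [Field Ω] [IsAlgClosed Ω] (y y' : Spec (.of Ω) ⟶ Y),
    y ≫ π = y' ≫ π → ∃ σ, y ≫ act ρ σ = y'
  eq_of_act : ∀ (W : Scheme.{u}) [Nonempty W] (y : W ⟶ Y) (σ τ : G),
    y ≫ act ρ σ = y ≫ act ρ τ → σ = τ

/-- This is transitivity: V ×_X Y is covered by the graphs of the elements of G, so a section over
it is determined by its restrictions to them. It is checked on a geometric point above each point.
-/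
theorem twistedGraph_cover (hρ : IsTorsor ρ) (V : Y.Etale)
    (z : dom ((baseChange π).obj ((compose π).obj V))) :
    ∃ (σ : G) (w : dom ((compose (act ρ σ)).obj V)), homDom (twistedGraph ρ σ V) w = z := by
  let P := (baseChange π).obj ((compose π).obj V)
  let κ := (dom P).residueField z
  let Ω := AlgebraicClosure κ
  let p : Spec (.of Ω) ⟶ dom P :=
    Spec.map (CommRingCat.ofHom (algebraMap κ Ω)) ≫ (dom P).fromSpecResidueField z
  let b : Spec (.of Ω) := Classical.arbitrary _
  have hp : p b = z := by
    change (dom P).fromSpecResidueField z _ = z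
    exact Scheme.fromSpecResidueField_apply _ _
  let v : Spec (.of Ω) ⟶ dom V := p ≫ bcFst π ((compose π).obj V)
  -- The two components of p give two geometric points of Y with the same image in X; the σ carrying
  -- the first to the second is the one whose graph passes through z.
  obtain ⟨σ, hσ⟩ := hρ.exists_act Ω (v ≫ str V) (p ≫ str P) (by
    refine (Category.assoc _ _ _).trans (Eq.trans ?_ (Category.assoc _ _ _).symm)
    exact (Category.assoc _ _ _).trans (congrArg (p ≫ ·) (bc_isPullback π ((compose π).obj V)).w))
  let g : dom V ⟶ dom P := homDom (U := (compose (act ρ σ)).obj V) (twistedGraph ρ σ V)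
  have hg : g ≫ bcFst π ((compose π).obj V) = 𝟙 (dom V) := twistedGraph_fst σ V
  have hg' : g ≫ str P = str V ≫ act ρ σ := homDom_str (twistedGraph ρ σ V)
  have key : v ≫ g = p := by
    apply (bc_isPullback π ((compose π).obj V)).hom_ext
    · rw [Category.assoc, hg]
      exact Category.comp_id v
    · rw [Category.assoc, hg', ← Category.assoc, hσ]
  refine ⟨σ, v b, ?_⟩
  change g (v b) = z
  refine Eq.trans ?_ hp
  rw [← key]
  rfl

/-- An invariant section is known on the graph of every σ once it is known on the graph of the
identity; with the covering by graphs this gives injectivity of `descendHom`. -/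
theorem res_twistedGraph {V : Y.Etale} {h : H.obj.obj (op ((baseChange π).obj ((compose π).obj V)))}
    (hh : h ∈ invariants Ψ ((compose π).obj V)) (σ : G) :
    res H.obj (twistedGraph ρ σ V) h = Ψ.psi σ V (res H.obj (graph V) h) := by
  rw [Ψ.psi_res, hh σ, res_res]; rfl

theorem descendHom_injective (hρ : IsTorsor ρ) (V : Y.Etale) :
    Function.Injective (res H.obj (graph V) ∘ₗ
      (invariants Ψ ((compose π).obj V)).subtype) := by
  rintro ⟨h, hh⟩ ⟨h', hh'⟩ e
  have e' : res H.obj (graph V) h = res H.obj (graph V) h' := e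
  apply Subtype.ext
  refine section_ext H (twistedGraph ρ · V) (twistedGraph_cover hρ V) fun σ => ?_
  rw [res_twistedGraph Ψ hh, res_twistedGraph Ψ hh', e']

/-- Given m on V, the sections ψ_σ(m) on the graphs of the σ are glued. Freeness of the action makes
graphs of distinct elements disjoint, so there is nothing to match on overlaps. -/
theorem descendHom_surjective (hρ : IsTorsor ρ) (V : Y.Etale) :
    Function.Surjective (res H.obj (graph V) ∘ₗ
      (invariants Ψ ((compose π).obj V)).subtype) := by
  intro m
  obtain ⟨t, ht⟩ := section_glue H (twistedGraph ρ · V) (twistedGraph_cover hρ V)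
    (fun σ => Ψ.psi σ V m) (fun σ τ Z a b e => by
      -- A nonempty Z mapping to the graphs of σ and of τ with the same image forces σ = τ.
      rcases isEmpty_or_nonempty (dom Z) with hZ | hZ
      · exact section_eq_of_isEmpty H hZ _ _
      have e₁ : untwist a = untwist b := by
        rw [← untwist_twistedGraph, ← untwist_twistedGraph, e]
      obtain rfl : σ = τ := hρ.eq_of_act (dom Z) (untwist a ≫ str V) σ τ
        ((untwist_str a).trans ((congrArg (fun c => (c ≫ str V) ≫ act ρ τ) e₁).trans
          (untwist_str b)).symm)
      rw [hom_ext' (show homDom a = homDom b from e₁)])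
  have hmem : t ∈ invariants Ψ ((compose π).obj V) := by
    intro σ
    -- Invariance under σ is tested on the graphs translated by σ, where it becomes the cocycle
    -- relation `psi_mul`.
    refine section_ext H (fun τ => (compose (act ρ σ)).map (twistedGraph ρ τ V)) (fun z => ?_)
      fun τ => ?_
    · exact twistedGraph_cover hρ V z
    · rw [← Ψ.psi_res, ht, Ψ.psi_mul, ← ht, res_res, res_res]
      exact congrArg (fun c => res H.obj c t) (twistedGraph_comp σ τ V _ rfl)
  refine ⟨⟨t, hmem⟩, ?_⟩
  change res H.obj (graph V) t = m
  -- The value on the graph of the identity is read off from the index 1. The twist of V by 1 has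
  -- the same underlying scheme as V, and c and c' are the identity in the two directions.
  let c : (compose (act ρ 1)).obj V ⟶ V := homOf (𝟙 (dom V)) (by
    refine (Category.id_comp _).trans ?_
    refine (Category.comp_id _).symm.trans (congrArg (str V ≫ ·) ?_)
    unfold act
    rw [map_one]; rfl)
  let c' : V ⟶ (compose (act ρ 1)).obj V := homOf (𝟙 (dom V)) ((Category.id_comp _).trans (by
    refine Eq.trans ?_ (Category.comp_id _)
    refine (congrArg (str V ≫ ·) ?_)
    unfold act
    rw [map_one]; rfl))
  have hcc : c' ≫ c = 𝟙 V := hom_ext' (Category.id_comp _)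
  have h₁ := (ht 1).trans (Ψ.psi_one V c rfl m)
  have h₂ : twistedGraph ρ 1 V = c ≫ graph V := by
    apply bc_hom_ext
    have h : homDom c ≫ homDom (graph (π := π) V) ≫ bcFst π ((compose π).obj V) =
      homDom c ≫ 𝟙 (dom V) := congrArg (homDom c ≫ ·) (graph_fst V)
    rw [Category.comp_id] at h
    rw [twistedGraph_fst, homDom_comp, Category.assoc]
    exact h.symm
  rw [h₂, ← res_res] at h₁
  have hc (n : H.obj.obj (op V)) : res H.obj c' (res H.obj c n) = n := by
    rw [res_res, hcc, res_id]
  have h₃ := congrArg (res H.obj c') h₁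
  rwa [hc, hc] at h₃

theorem isIso_of_bijective {F F' : Shv A X} (φ : F ⟶ F')
    (h : ∀ U : X.Etale, Function.Bijective (φ.hom.app (op U)).hom) : IsIso φ := by
  have h' : ∀ U, IsIso (φ.hom.app U) := fun U =>
    (ConcreteCategory.isIso_iff_bijective _).2 (h U.unop)
  have : IsIso φ.hom := NatIso.isIso_of_isIso_app _
  exact (isIso_iff_of_reflects_iso φ (sheafToPresheaf _ _)).1 this

/-- Galois descent: the inverse image of the descended sheaf. -/
def descendIso (hρ : IsTorsor ρ) : (restrict π).obj (descend Ψ) ≅ H :=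
  have : IsIso (descendHom Ψ) := isIso_of_bijective _ fun V =>
    ⟨descendHom_injective Ψ hρ V, descendHom_surjective Ψ hρ V⟩
  asIso (descendHom Ψ)

/-- Restriction to the graph of σ has two readings: as ψ_σ of the restriction to the identity graph,
by invariance, and as the identity graph of the twisted V, by `twistedGraph_eq`. Their equality is
the compatibility required of a tensor direct image. -/
theorem descend_comm (σ : G) (V : Y.Etale)
    (h : ((restrict π).obj (descend Ψ)).obj.obj (op V)) :
    Ψ.psi σ V (((descendHom Ψ).hom.app (op V)).hom h) =
      (((descendHom Ψ).hom.app (op ((compose (act ρ σ)).obj V))).hom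
        (((canonical ρ (descend Ψ) σ).hom.app (op V)).hom h)) := by
  let h' : invariants Ψ ((compose π).obj V) := h
  refine (res_twistedGraph Ψ h'.2 σ).symm.trans ?_
  refine Eq.trans ?_ (res_res H.obj _ _ h'.1).symm
  exact congrArg (fun c => res H.obj c h'.1) (twistedGraph_eq σ V _ rfl)

/-- The map between descended sheaves induced by an equivariant map. -/
def descendMap {H' : Shv A Y} (Ψ' : Equivariant ρ H') (φ : H ⟶ H')
    (hφ : ∀ (σ : G) (V : Y.Etale) (m : H.obj.obj (op V)),
      (φ.hom.app _).hom (Ψ.psi σ V m) = Ψ'.psi σ V ((φ.hom.app (op V)).hom m)) :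
    descend Ψ ⟶ descend Ψ' where
  hom :=
    { app U := ModuleCat.ofHom (LinearMap.restrict (φ.hom.app _).hom
        (p := invariants Ψ U.unop) (q := invariants Ψ' U.unop)
        (fun h hh σ => by rw [← hφ, hh σ, res_app]))
      naturality U U' a := by
        ext h
        apply Subtype.ext
        exact res_app φ.hom _ (Subtype.val (show invariants Ψ U.unop from h)) }

theorem descendMap_comm {H' : Shv A Y} (Ψ' : Equivariant ρ H') (φ : H ⟶ H') (hφ) :
    descendHom Ψ ≫ φ = (restrict π).map (descendMap Ψ Ψ' φ hφ) ≫ descendHom Ψ' := by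
  apply Sheaf.hom_ext
  apply NatTrans.ext
  funext V
  ext h
  exact res_app φ.hom (graph V.unop)
    (Subtype.val (show invariants Ψ ((compose π).obj V.unop) from h))

end Descent

/-! ### The equivariant structure of the tensor product -/

section TensorEquivariant

variable {X Y : Scheme.{u}} {π : Y ⟶ X} {A : Type u} [CommRing A] {G : Type u} [Group G]
  (ρ : G →* Aut (Over.mk π)) (F : Shv A Y)

/-- The section `⨂_τ m_τ` of `⨂_τ τ^* F`. -/
def tens (V : Y.Etale) :
    MultilinearMap A (fun τ : G => F.obj.obj (op ((compose (act ρ τ)).obj V)))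
      ((tensorSheaf ρ F).obj.obj (op V)) :=
  LinearMap.compMultilinearMap
    (show (⨂[A] τ : G, F.obj.obj (op ((compose (act ρ τ)).obj V))) →ₗ[A] _ from
      ((toSheafify Y.smallEtaleTopology (tensorPresheaf ρ F)).app (op V)).hom)
    (PiTensorProduct.tprod A)

variable {F}

/-- By the universal property of sheafification and of the tensor product, a morphism out of ⨂_τ
τ^*F is determined by its values on tensors of sections. Every identity between the Ψ_σ is verified
this way. -/
theorem tensorSheaf_hom_ext {N : Shv A Y} {α β : tensorSheaf ρ F ⟶ N}
    (h : ∀ (V : Y.Etale) (m : ∀ τ : G, F.obj.obj (op ((compose (act ρ τ)).obj V))),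
      (α.hom.app (op V)).hom (tens ρ F V m) = (β.hom.app (op V)).hom (tens ρ F V m)) : α = β := by
  apply Sheaf.hom_ext
  apply sheafify_hom_ext _ _ _ N.property
  apply NatTrans.ext
  funext V
  ext : 1
  apply PiTensorProduct.ext
  ext m
  exact h V.unop m

theorem res_tens {U V : Y.Etale} (a : U ⟶ V)
    (m : ∀ τ : G, F.obj.obj (op ((compose (act ρ τ)).obj V))) :
    res (tensorSheaf ρ F).obj a (tens ρ F V m) =
      tens ρ F U fun τ => res F.obj ((compose (act ρ τ)).map a) (m τ) := by
  refine (ConcreteCategory.congr_hom ((toSheafify Y.smallEtaleTopology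
    (tensorPresheaf ρ F)).naturality a.op) (PiTensorProduct.tprod A m)).symm.trans ?_
  exact congrArg ((toSheafify Y.smallEtaleTopology (tensorPresheaf ρ F)).app (op U)).hom
    (PiTensorProduct.map_tprod _ m)

theorem permSheaf_tens (σ : G) (V : Y.Etale)
    (m : ∀ τ : G, F.obj.obj (op ((compose (act ρ τ)).obj V))) :
    ((permSheaf ρ F σ).hom.app (op V)).hom (tens ρ F V m) =
      tens ρ F ((compose (act ρ σ)).obj V) fun τ => permFactor ρ F σ τ (op V) (m (τ * σ)) := by
  have h := toSheafify_sheafifyLift Y.smallEtaleTopology (permPresheaf ρ F σ ≫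
    Functor.whiskerLeft (compose (act ρ σ)).op
      (toSheafify Y.smallEtaleTopology (tensorPresheaf ρ F)))
    ((restrict (act ρ σ)).obj (tensorSheaf ρ F)).property
  refine (ConcreteCategory.congr_hom (NatTrans.congr_app h (op V))
    (PiTensorProduct.tprod A m)).trans ?_
  exact congrArg ((toSheafify Y.smallEtaleTopology (tensorPresheaf ρ F)).app
    (op ((compose (act ρ σ)).obj V))).hom (permMap_tprod ρ F σ (op V) m)

theorem tensorSheafMap_tens {F' : Shv A Y} (φ : F ⟶ F') (V : Y.Etale)
    (m : ∀ τ : G, F.obj.obj (op ((compose (act ρ τ)).obj V))) :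
    ((tensorSheafMap ρ φ).hom.app (op V)).hom (tens ρ F V m) =
      tens ρ F' V fun τ => (φ.hom.app (op ((compose (act ρ τ)).obj V))).hom (m τ) := by
  refine (ConcreteCategory.congr_hom (NatTrans.congr_app (toSheafify_naturality
    Y.smallEtaleTopology (tensorPresheafMap ρ φ)) (op V)) (PiTensorProduct.tprod A m)).symm.trans ?_
  exact congrArg ((toSheafify Y.smallEtaleTopology (tensorPresheaf ρ F')).app (op V)).hom
    (PiTensorProduct.map_tprod _ m)

/-- Members of a family at equal but not syntactically equal indices, such as τ1 and τ, or (τ'τ)σ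
and τ'(τσ), live in different types; they are compared after restriction along maps with the same
underlying morphism of schemes. -/
theorem res_family_congr {V W : Y.Etale}
    (m : ∀ τ : G, F.obj.obj (op ((compose (act ρ τ)).obj V))) {τ₁ τ₂ : G} (h : τ₁ = τ₂)
    (d₁ : W ⟶ (compose (act ρ τ₁)).obj V) (d₂ : W ⟶ (compose (act ρ τ₂)).obj V)
    (hd : untwist d₁ = untwist d₂) : res F.obj d₁ (m τ₁) = res F.obj d₂ (m τ₂) := by
  subst h
  rw [hom_ext' (show homDom d₁ = homDom d₂ from hd)]

theorem permFactor_eq_res (σ τ : G) (V : Y.Etale)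
    (m : F.obj.obj (op ((compose (act ρ (τ * σ))).obj V))) :
    permFactor ρ F σ τ (op V) m = res F.obj
      ((composeComp (act ρ σ) (act ρ τ) (act ρ (τ * σ)) (act_comp_act ρ σ τ)).app V) m :=
  rfl

theorem act_one : act ρ 1 = 𝟙 Y := by
  unfold act
  rw [map_one]; rfl

/-- The identity of `V` as a morphism from the twist of `V` by `1` to `V`. -/
def oneTwist : compose (act ρ 1) ⟶ 𝟭 Y.Etale where
  app V := homOf (𝟙 (dom V)) ((Category.id_comp _).trans
    ((Category.comp_id _).symm.trans (congrArg (str V ≫ ·) (act_one ρ).symm)))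
  naturality _ _ a := hom_ext' ((Category.comp_id (homDom a)).trans
    (Category.id_comp (homDom a)).symm)

variable (F) in
/-- `⨂_τ τ^* F` with the permutations. -/
def tensorEquivariant : Equivariant ρ (tensorSheaf ρ F) where
  psi σ V := ((permSheaf ρ F σ).hom.app (op V)).hom
  psi_res σ _ _ a m := res_app (permSheaf ρ F σ).hom a m
  psi_one V c hc m := by
    let ω : tensorSheaf ρ F ⟶ (restrict (act ρ 1)).obj (tensorSheaf ρ F) :=
      ⟨Functor.whiskerRight (NatTrans.op (oneTwist ρ)) (tensorSheaf ρ F).obj⟩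
    have h : permSheaf ρ F 1 = ω := by
      apply tensorSheaf_hom_ext
      intro V m
      refine (permSheaf_tens ρ 1 V m).trans ?_
      refine Eq.trans ?_ (res_tens ρ ((oneTwist ρ).app V) m).symm
      congr 1
      funext τ
      exact res_family_congr ρ m (mul_one τ) _ _ rfl
    have hc' : c = (oneTwist ρ).app V := hom_ext' hc
    rw [hc']
    exact LinearMap.congr_fun (congrArg (fun φ : tensorSheaf ρ F ⟶ _ =>
      (φ.hom.app (op V)).hom) h) m
  psi_mul σ τ V m := by
    have h : permSheaf ρ F σ ≫ (restrict (act ρ σ)).map (permSheaf ρ F τ) =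
        permSheaf ρ F (τ * σ) ≫ (restrictComp (act ρ σ) (act ρ τ) (act ρ (τ * σ))
          (act_comp_act ρ σ τ)).app (tensorSheaf ρ F) := by
      apply tensorSheaf_hom_ext
      intro V m
      refine (congrArg ((permSheaf ρ F τ).hom.app _).hom (permSheaf_tens ρ σ V m)).trans ?_
      refine (permSheaf_tens ρ τ _ _).trans ?_
      refine Eq.trans ?_ (congrArg (res (tensorSheaf ρ F).obj _)
        (permSheaf_tens ρ (τ * σ) V m)).symm
      refine Eq.trans ?_ (res_tens ρ _ _).symm
      congr 1
      funext τ'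
      simp only [permFactor_eq_res]
      refine (res_res F.obj _ _ _).trans (Eq.trans ?_ (res_res F.obj _ _ _).symm)
      exact res_family_congr ρ m (mul_assoc τ' τ σ) _ _ rfl
    exact LinearMap.congr_fun (congrArg (fun φ : tensorSheaf ρ F ⟶ _ =>
      (φ.hom.app (op V)).hom) h) m

theorem tensorSheafMap_perm {F' : Shv A Y} (φ : F ⟶ F') (σ : G) (V : Y.Etale)
    (m : (tensorSheaf ρ F).obj.obj (op V)) :
    ((tensorSheafMap ρ φ).hom.app (op ((compose (act ρ σ)).obj V))).hom
        ((tensorEquivariant ρ F).psi σ V m) =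
      (tensorEquivariant ρ F').psi σ V (((tensorSheafMap ρ φ).hom.app (op V)).hom m) := by
  have h : permSheaf ρ F σ ≫ (restrict (act ρ σ)).map (tensorSheafMap ρ φ) =
      tensorSheafMap ρ φ ≫ permSheaf ρ F' σ := by
    apply tensorSheaf_hom_ext
    intro V m
    refine (congrArg ((tensorSheafMap ρ φ).hom.app _).hom (permSheaf_tens ρ σ V m)).trans ?_
    refine (tensorSheafMap_tens ρ φ _ _).trans ?_
    refine Eq.trans ?_ (congrArg ((permSheaf ρ F' σ).hom.app (op V)).hom
      (tensorSheafMap_tens ρ φ V m)).symm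
    refine Eq.trans ?_ (permSheaf_tens ρ σ V _).symm
    congr 1
    funext τ
    exact res_app φ.hom _ (m (τ * σ))
  exact LinearMap.congr_fun (congrArg (fun φ : tensorSheaf ρ F ⟶ _ =>
    (φ.hom.app (op V)).hom) h) m

variable [Etale π]

theorem descendHom_comm (σ : G) :
    descendHom (tensorEquivariant ρ F) ≫ permSheaf ρ F σ =
      canonical ρ (descend (tensorEquivariant ρ F)) σ ≫
        (restrict (act ρ σ)).map (descendHom (tensorEquivariant ρ F)) := by
  apply Sheaf.hom_ext
  apply NatTrans.ext
  funext V
  ext h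
  exact descend_comm (tensorEquivariant ρ F) σ V.unop h

variable (F) in
/-- The tensor direct image obtained by Galois descent. -/
def tensorDirectImage (hρ : IsTorsor ρ) : TensorDirectImage ρ F where
  sheaf := descend (tensorEquivariant ρ F)
  iso := descendIso (tensorEquivariant ρ F) hρ
  comm σ := descendHom_comm ρ σ

end TensorEquivariant

/-! ### The stalk of the tensor product along a cyclic orbit of geometric points -/

section Orbit

variable {X Y : Scheme.{u}} {π : Y ⟶ X} {A : Type u} [CommRing A] {G : Type u} [Group G]
  (ρ : G →* Aut (Over.mk π)) {Ω : Type u} [Field Ω]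

/-! ### The stalk of the sheafified tensor product -/

section TensorSheafStalk

variable [IsSepClosed Ω] (t : Spec (.of Ω) ⟶ Y) (F : Shv A Y)

/-- The stalk of `⨂_τ τ^* F` before sheafification. -/
def sheafifyStalk :
    (preStalk t).obj (tensorPre fun τ : G => ((restrict (act ρ τ)).obj F).obj) ≃ₗ[A]
      (stalk t).obj (tensorSheaf ρ F) :=
  LinearEquiv.ofBijective
    ((preStalk t).map (toSheafify Y.smallEtaleTopology (tensorPresheaf ρ F))).hom
    (toSheafify_stalk_bijective t (tensorPresheaf ρ F))

theorem sheafifyStalk_germTprod (V : Y.Etale) (v : Spec (.of Ω) ⟶ dom V) (hv : v ≫ str V = t)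
    (m : ∀ τ : G, F.obj.obj (op ((compose (act ρ τ)).obj V))) :
    sheafifyStalk ρ t F (germTprod t (fun τ : G => ((restrict (act ρ τ)).obj F).obj) V v hv m) =
      germ t (tensorSheaf ρ F).obj V v hv (tens ρ F V m) :=
  preStalk_map_germ t (toSheafify Y.smallEtaleTopology (tensorPresheaf ρ F)) V v hv
    (PiTensorProduct.tprod A m)

variable {t F} in
theorem tensorSheaf_stalk_induction {p : (stalk t).obj (tensorSheaf ρ F) → Prop}
    (add : ∀ x y, p x → p y → p (x + y)) (smul : ∀ (a : A) x, p x → p (a • x))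
    (tens : ∀ (V : Y.Etale) (v : Spec (.of Ω) ⟶ dom V) (hv : v ≫ str V = t)
      (m : ∀ τ : G, F.obj.obj (op ((compose (act ρ τ)).obj V))),
      p (germ t (tensorSheaf ρ F).obj V v hv (tens ρ F V m)))
    (x : (stalk t).obj (tensorSheaf ρ F)) : p x := by
  obtain ⟨y, rfl⟩ := (sheafifyStalk ρ t F).surjective x
  induction y using tensorPre_germ_induction with
  | add x y hx hy => rw [map_add]; exact add _ _ hx hy
  | smul a x hx => rw [map_smul]; exact smul _ _ hx
  | tprod V v hv m => exact (congrArg p (sheafifyStalk_germTprod ρ t F V v hv m)).mpr (tens V v hv m)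

variable [Finite G]

/-- The stalk of `⨂_τ τ^* F` is the tensor product of the stalks. -/
def tensorSheafStalk :
    (stalk t).obj (tensorSheaf ρ F) ≃ₗ[A] ⨂[A] τ : G, (stalk t).obj ((restrict (act ρ τ)).obj F) :=
  (sheafifyStalk ρ t F).symm.trans
    (LinearEquiv.ofBijective _ (stalkTensor_bijective t fun τ : G =>
      ((restrict (act ρ τ)).obj F).obj))

theorem tensorSheafStalk_germ (V : Y.Etale) (v : Spec (.of Ω) ⟶ dom V) (hv : v ≫ str V = t)
    (m : ∀ τ : G, F.obj.obj (op ((compose (act ρ τ)).obj V))) :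
    tensorSheafStalk ρ t F (germ t (tensorSheaf ρ F).obj V v hv (tens ρ F V m)) =
      PiTensorProduct.tprod A fun τ => germ t ((restrict (act ρ τ)).obj F).obj V v hv (m τ) := by
  have h : (sheafifyStalk ρ t F).symm (germ t (tensorSheaf ρ F).obj V v hv (tens ρ F V m)) =
      germTprod t (fun τ : G => ((restrict (act ρ τ)).obj F).obj) V v hv m :=
    (LinearEquiv.symm_apply_eq _).2 (sheafifyStalk_germTprod ρ t F V v hv m).symm
  exact (congrArg (stalkTensor t fun τ : G => ((restrict (act ρ τ)).obj F).obj) h).trans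
    (stalkTensor_germTprod t (fun τ : G => ((restrict (act ρ τ)).obj F).obj) V v hv m)

end TensorSheafStalk

/-- A geometric point `t` of `Y`, and endomorphisms `φ ^ i` of `Spec Ω`, such that
`σ ^ i ∘ t ∘ φ ^ i = t` for a generator `σ` of the cyclic group `G` of order `r`. -/
structure CyclicOrbit (t : Spec (.of Ω) ⟶ Y) where
  gen : G
  endo : ℕ → (Spec (.of Ω) ⟶ Spec (.of Ω))
  isIso_endo : ∀ i, IsIso (endo i)
  endo_zero : endo 0 = 𝟙 _
  endo_succ : ∀ i, endo i ≫ endo 1 = endo (i + 1)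
  endo_act : ∀ i, endo i ≫ t ≫ act ρ (gen ^ i) = t
  order : ℕ
  order_pos : 0 < order
  gen_pow_order : gen ^ order = 1
  idx : G → ℕ
  gen_pow_idx : ∀ τ, gen ^ idx τ = τ
  idx_lt : ∀ τ, idx τ < order
  idx_gen_pow : ∀ i < order, idx (gen ^ i) = i

/-! ### Tensor powers of a stalk and the twisted shift -/

namespace CyclicOrbit

variable {ρ} {t : Spec (.of Ω) ⟶ Y} (O : CyclicOrbit ρ t)

attribute [instance] isIso_endo

theorem endo_idx_act (τ : G) : O.endo (O.idx τ) ≫ t ≫ act ρ τ = t := by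
  have h := O.endo_act (O.idx τ)
  rwa [O.gen_pow_idx] at h

theorem endo_order : O.endo O.order ≫ t = t := by
  have h := O.endo_act O.order
  rwa [O.gen_pow_order, act_one, Category.comp_id] at h

theorem endo_gen : O.endo 1 ≫ t ≫ act ρ O.gen = t := by
  have h := O.endo_act 1
  rwa [pow_one] at h

theorem idx_mul_gen (τ : G) (h : O.idx τ + 1 ≠ O.order) :
    O.idx (τ * O.gen) = O.idx τ + 1 := by
  have hlt := O.idx_lt τ
  have h' := O.idx_gen_pow (O.idx τ + 1) (by omega)
  rwa [pow_succ, O.gen_pow_idx] at h'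

/-- The exponent wraps around here: indices run over 0, ..., r - 1, so the successor of r - 1 is 0
and not r. -/
theorem idx_mul_gen' (τ : G) (h : O.idx τ + 1 = O.order) : O.idx (τ * O.gen) = 0 := by
  have h' := O.idx_gen_pow 0 O.order_pos
  rwa [pow_zero, ← O.gen_pow_order, ← h, pow_succ, O.gen_pow_idx] at h'

/-- The cyclic operator `⨂_τ y_τ ↦ ⨂_τ y_{τσ}`, twisted by `B` at the factor of index `σ⁻¹`. -/
def cyclic (O : CyclicOrbit ρ t) {N : Type u} [AddCommGroup N] [Module A N] (B : N →ₗ[A] N) :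
    (⨂[A] _ : G, N) →ₗ[A] ⨂[A] _ : G, N :=
  PiTensorProduct.map (fun τ => if O.idx τ + 1 = O.order then B else LinearMap.id) ∘ₗ
    (PiTensorProduct.reindex A (fun _ => N) (Equiv.mulRight O.gen).symm).toLinearMap

theorem cyclic_tprod {N : Type u} [AddCommGroup N] [Module A N] (B : N →ₗ[A] N) (y : G → N) :
    O.cyclic B (PiTensorProduct.tprod A y) = PiTensorProduct.tprod A fun τ =>
      if O.idx τ + 1 = O.order then B (y (τ * O.gen)) else y (τ * O.gen) := by
  unfold cyclic
  rw [LinearMap.comp_apply, LinearEquiv.coe_coe, PiTensorProduct.reindex_tprod,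
    PiTensorProduct.map_tprod]
  congr 1
  funext τ
  split <;> rfl

theorem factor_nbhd (τ : G) (V : Y.Etale) (v : Spec (.of Ω) ⟶ dom V) (hv : v ≫ str V = t) :
    (O.endo (O.idx τ) ≫ v) ≫ str ((compose (act ρ τ)).obj V) = t :=
  compose_nbhd (act ρ τ) _ (O.endo_idx_act τ) V v hv

variable [IsSepClosed Ω]

/-- The stalk of `τ^* F` is the stalk of `F`. -/
def factor (F : Shv A Y) (τ : G) :
    (stalk t).obj ((restrict (act ρ τ)).obj F) ≃ₗ[A] (stalk t).obj F :=
  pushStalkEquiv (act ρ τ) (O.endo (O.idx τ)) (O.endo_idx_act τ) F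

/-- The stalk of `⨂_τ τ^* F` as a tensor power of the stalk of `F`. -/
def tensorPower [Finite G] (F : Shv A Y) :
    (stalk t).obj (tensorSheaf ρ F) ≃ₗ[A] ⨂[A] _ : G, (stalk t).obj F :=
  (tensorSheafStalk ρ t F).trans (PiTensorProduct.congr (O.factor F))

theorem factor_germ (F : Shv A Y) (τ : G) (V : Y.Etale) (v : Spec (.of Ω) ⟶ dom V)
    (hv : v ≫ str V = t) (m : F.obj.obj (op ((compose (act ρ τ)).obj V))) :
    O.factor F τ (germ t ((restrict (act ρ τ)).obj F).obj V v hv m) =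
      germ t F.obj ((compose (act ρ τ)).obj V) (O.endo (O.idx τ) ≫ v)
        (O.factor_nbhd τ V v hv) m :=
  pushStalk_germ (act ρ τ) _ (O.endo_idx_act τ) F V v hv (O.factor_nbhd τ V v hv) m

theorem tensorPower_germ [Finite G] (F : Shv A Y) (V : Y.Etale) (v : Spec (.of Ω) ⟶ dom V)
    (hv : v ≫ str V = t) (m : ∀ τ : G, F.obj.obj (op ((compose (act ρ τ)).obj V))) :
    O.tensorPower F (germ t (tensorSheaf ρ F).obj V v hv (tens ρ F V m)) =
      PiTensorProduct.tprod A fun τ => germ t F.obj ((compose (act ρ τ)).obj V)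
        (O.endo (O.idx τ) ≫ v) (O.factor_nbhd τ V v hv) (m τ) := by
  refine (congrArg (PiTensorProduct.congr (O.factor F))
    (tensorSheafStalk_germ ρ t F V v hv m)).trans ?_
  refine (PiTensorProduct.congr_tprod _ _).trans ?_
  exact congrArg _ (funext fun τ => O.factor_germ F τ V v hv (m τ))

theorem tensorPower_naturality [Finite G] {F F' : Shv A Y} (α : F ⟶ F')
    (p : (stalk t).obj (tensorSheaf ρ F)) :
    O.tensorPower F' (((stalk t).map (tensorSheafMap ρ α)).hom p) =
      PiTensorProduct.map (fun _ => ((stalk t).map α).hom) (O.tensorPower F p) := by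
  induction p using tensorSheaf_stalk_induction with
  | add x y hx hy => rw [map_add, map_add, hx, hy, map_add, map_add]
  | smul a x hx => rw [map_smul, map_smul, hx, map_smul, map_smul]
  | tens V v hv m =>
    refine Eq.trans ?_ (congrArg (PiTensorProduct.map fun _ => ((stalk t).map α).hom)
      (O.tensorPower_germ F V v hv m)).symm
    refine Eq.trans ?_ (PiTensorProduct.map_tprod _ _).symm
    refine (congrArg _ (stalk_map_germ t (tensorSheafMap ρ α) V v hv _)).trans ?_
    rw [tensorSheafMap_tens]
    refine (O.tensorPower_germ F' V v hv _).trans ?_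
    exact congrArg _ (funext fun τ => (stalk_map_germ t α _ _ (O.factor_nbhd τ V v hv) (m τ)).symm)

/-- The `r`-th power of the Frobenius on the stalk of `F`. -/
def monodromy (F : Shv A Y) : (stalk t).obj F →ₗ[A] (stalk t).obj F :=
  ((stalkEnd t (O.endo O.order) O.endo_order).app F).hom

/-- The factor τ, seen through the generator, is read at the point φ^{i+1} ≫ v with i the index of
τ, whereas the factor of τσ is read at φ^{i'} ≫ v with i' the index of τσ. These exponents agree
except when i + 1 = r and i' = 0, where the discrepancy φ^r is the monodromy. -/
theorem germ_factor_succ (F : Shv A Y) (τ : G) (V : Y.Etale) (v : Spec (.of Ω) ⟶ dom V)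
    (hv : v ≫ str V = t) (hv' : (O.endo 1 ≫ v) ≫ str ((compose (act ρ O.gen)).obj V) = t)
    (m : F.obj.obj (op ((compose (act ρ (τ * O.gen))).obj V))) :
    germ t F.obj ((compose (act ρ τ)).obj ((compose (act ρ O.gen)).obj V))
        (O.endo (O.idx τ) ≫ O.endo 1 ≫ v) (O.factor_nbhd τ _ _ hv')
        (permFactor ρ F O.gen τ (op V) m) =
      if O.idx τ + 1 = O.order then
        O.monodromy F (germ t F.obj ((compose (act ρ (τ * O.gen))).obj V)
          (O.endo (O.idx (τ * O.gen)) ≫ v) (O.factor_nbhd _ V v hv) m)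
      else germ t F.obj ((compose (act ρ (τ * O.gen))).obj V)
          (O.endo (O.idx (τ * O.gen)) ≫ v) (O.factor_nbhd _ V v hv) m := by
  have key : O.endo (O.idx τ) ≫ O.endo 1 ≫ v = O.endo (O.idx τ + 1) ≫ v := by
    rw [← Category.assoc, O.endo_succ]
  let c := (composeComp (act ρ O.gen) (act ρ τ) (act ρ (τ * O.gen))
    (act_comp_act ρ O.gen τ)).app V
  let u : Spec (.of Ω) ⟶ dom ((compose (act ρ τ)).obj ((compose (act ρ O.gen)).obj V)) :=
    O.endo (O.idx τ) ≫ O.endo 1 ≫ v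
  have hc : u ≫ homDom c = O.endo (O.idx τ + 1) ≫ v := (Category.comp_id u).trans key
  by_cases h : O.idx τ + 1 = O.order
  · refine Eq.trans ?_ (if_pos h).symm
    refine Eq.trans ?_ (stalkEnd_germ t (O.endo O.order) O.endo_order F _ _
      (O.factor_nbhd _ V v hv) m).symm
    refine germ_res t F.obj c _ _ _ _ (hc.trans ?_) m
    rw [h, O.idx_mul_gen' τ h, O.endo_zero]
    exact congrArg (O.endo O.order ≫ ·) (Category.id_comp v).symm
  · refine Eq.trans ?_ (if_neg h).symm
    refine germ_res t F.obj c _ _ _ _ (hc.trans ?_) m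
    exact congrArg (fun i => O.endo i ≫ v) (O.idx_mul_gen τ h).symm

/-- On tensors of germs, Ψ for the generator shifts the factors and `germ_factor_succ` records the
effect of the chosen identifications, so exactly one factor carries the monodromy. -/
theorem tensorPower_perm [Finite G] (F : Shv A Y) (p : (stalk t).obj (tensorSheaf ρ F)) :
    O.tensorPower F (pushStalk (act ρ O.gen) (O.endo 1) O.endo_gen (tensorSheaf ρ F)
        (((stalk t).map (permSheaf ρ F O.gen)).hom p)) =
      O.cyclic (O.monodromy F) (O.tensorPower F p) := by
  induction p using tensorSheaf_stalk_induction with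
  | add x y hx hy => simp only [map_add, hx, hy]
  | smul a x hx => simp only [map_smul, hx]
  | tens V v hv m =>
    have hv' := compose_nbhd (act ρ O.gen) _ O.endo_gen V v hv
    refine Eq.trans ?_ (congrArg (O.cyclic (O.monodromy F)) (O.tensorPower_germ F V v hv m)).symm
    refine Eq.trans ?_ (O.cyclic_tprod _ _).symm
    refine (congrArg (fun z => O.tensorPower F (pushStalk (act ρ O.gen) (O.endo 1) O.endo_gen
      (tensorSheaf ρ F) z)) (stalk_map_germ t (permSheaf ρ F O.gen) V v hv _)).trans ?_
    rw [permSheaf_tens]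
    refine (congrArg (O.tensorPower F) (pushStalk_germ (act ρ O.gen) (O.endo 1) O.endo_gen
      (tensorSheaf ρ F) V v hv hv' _)).trans ?_
    refine (O.tensorPower_germ F _ _ hv' _).trans ?_
    congr 1
    funext τ
    exact O.germ_factor_succ F τ V v hv hv' (m (τ * O.gen))

variable [Etale π]

/-- The Frobenius at s moves the point of a neighbourhood by φ. Upstairs this moves t off itself,
and the canonical isomorphism π^*𝒢 → σ^*π^*𝒢 brings it back, since σ ∘ t ∘ φ = t. -/
theorem pushStalk_stalkEnd (𝒢 : Shv A X) {s : Spec (.of Ω) ⟶ X} (hs : 𝟙 _ ≫ t ≫ π = s)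
    (w : O.endo 1 ≫ s = s) (p : (stalk t).obj ((restrict π).obj 𝒢)) :
    ((stalkEnd s (O.endo 1) w).app 𝒢).hom (pushStalk π (𝟙 _) hs 𝒢 p) =
      pushStalk π (𝟙 _) hs 𝒢 (pushStalk (act ρ O.gen) (O.endo 1) O.endo_gen
        ((restrict π).obj 𝒢) (((stalk t).map (canonical ρ 𝒢 O.gen)).hom p)) := by
  obtain ⟨V, v, hv, m, rfl⟩ := exists_germ t ((restrict π).obj 𝒢).obj p
  have hv₁ := compose_nbhd π (𝟙 _) hs V v hv
  have hv₂ := compose_nbhd (act ρ O.gen) _ O.endo_gen V v hv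
  have hv₃ := compose_nbhd π (𝟙 _) hs _ _ hv₂
  refine (congrArg _ (pushStalk_germ π (𝟙 _) hs 𝒢 V v hv hv₁ m)).trans ?_
  refine (stalkEnd_germ s (O.endo 1) w 𝒢 _ _ hv₁ m).trans ?_
  refine Eq.symm ?_
  refine (congrArg (fun z => pushStalk π (𝟙 _) hs 𝒢 (pushStalk (act ρ O.gen) (O.endo 1) O.endo_gen
      ((restrict π).obj 𝒢) z)) (stalk_map_germ t (canonical ρ 𝒢 O.gen) V v hv m)).trans ?_
  refine (congrArg (pushStalk π (𝟙 _) hs 𝒢) (pushStalk_germ (act ρ O.gen) (O.endo 1) O.endo_gen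
      ((restrict π).obj 𝒢) V v hv hv₂ _)).trans ?_
  refine (pushStalk_germ π (𝟙 _) hs 𝒢 _ _ hv₂ hv₃ _).trans ?_
  refine germ_res s 𝒢.obj _ _ _ _ _ ?_ m
  refine (Category.comp_id _).trans ?_
  refine (Category.id_comp _).trans ?_
  exact congrArg (O.endo 1 ≫ ·) (Category.id_comp v).symm

/-- The map from the stalk of `𝒢` to the tensor power of the stalk of `F` given by
`π^* 𝒢 ⟶ ⨂_τ τ^* F`. -/
def comparison [Finite G] {F : Shv A Y} {𝒢 : Shv A X} {s : Spec (.of Ω) ⟶ X}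
    (hs : 𝟙 _ ≫ t ≫ π = s) (h : (restrict π).obj 𝒢 ⟶ tensorSheaf ρ F) :
    (stalk s).obj 𝒢 →ₗ[A] ⨂[A] _ : G, (stalk t).obj F :=
  (O.tensorPower F).toLinearMap ∘ₗ ((stalk t).map h).hom ∘ₗ
    (pushStalkEquiv π (𝟙 _) hs 𝒢).symm.toLinearMap

theorem comparison_pushStalk [Finite G] {F : Shv A Y} {𝒢 : Shv A X} {s : Spec (.of Ω) ⟶ X}
    (hs : 𝟙 _ ≫ t ≫ π = s) (h : (restrict π).obj 𝒢 ⟶ tensorSheaf ρ F)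
    (p : (stalk t).obj ((restrict π).obj 𝒢)) :
    O.comparison hs h (pushStalk π (𝟙 _) hs 𝒢 p) =
      O.tensorPower F (((stalk t).map h).hom p) :=
  congrArg (fun z => O.tensorPower F (((stalk t).map h).hom z))
    ((pushStalkEquiv π (𝟙 _) hs 𝒢).symm_apply_apply p)

/-- The compatibility of h with the canonical isomorphism and Ψ, for the generator alone, replaces
the first by the second in `pushStalk_stalkEnd`; then `tensorPower_perm` applies. Invertibility of h
plays no role, which is what allows isogenies later. -/
theorem comparison_stalkEnd [Finite G] {F : Shv A Y} {𝒢 : Shv A X} {s : Spec (.of Ω) ⟶ X}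
    (hs : 𝟙 _ ≫ t ≫ π = s) (w : O.endo 1 ≫ s = s) (h : (restrict π).obj 𝒢 ⟶ tensorSheaf ρ F)
    (hc : h ≫ permSheaf ρ F O.gen = canonical ρ 𝒢 O.gen ≫ (restrict (act ρ O.gen)).map h)
    (p : (stalk s).obj 𝒢) :
    O.comparison hs h (((stalkEnd s (O.endo 1) w).app 𝒢).hom p) =
      O.cyclic (O.monodromy F) (O.comparison hs h p) := by
  obtain ⟨q, rfl⟩ := pushStalk_surjective π (𝟙 _) hs 𝒢 p
  rw [pushStalk_stalkEnd, comparison_pushStalk, comparison_pushStalk, ← tensorPower_perm,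
    ← pushStalk_naturality]
  have h₁ := congrArg (fun α => ((stalk t).map α).hom q) hc
  simp only [Functor.map_comp] at h₁
  exact congrArg (fun z => O.tensorPower F
    (pushStalk (act ρ O.gen) (O.endo 1) O.endo_gen (tensorSheaf ρ F) z)) h₁.symm

theorem comparison_naturality [Finite G] {F F' : Shv A Y} {𝒢 𝒢' : Shv A X} {s : Spec (.of Ω) ⟶ X}
    (hs : 𝟙 _ ≫ t ≫ π = s) (h : (restrict π).obj 𝒢 ⟶ tensorSheaf ρ F)
    (h' : (restrict π).obj 𝒢' ⟶ tensorSheaf ρ F') (α : F ⟶ F') (β : 𝒢 ⟶ 𝒢')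
    (hc : h ≫ tensorSheafMap ρ α = (restrict π).map β ≫ h') (p : (stalk s).obj 𝒢) :
    O.comparison hs h' (((stalk s).map β).hom p) =
      PiTensorProduct.map (fun _ => ((stalk t).map α).hom) (O.comparison hs h p) := by
  obtain ⟨q, rfl⟩ := pushStalk_surjective π (𝟙 _) hs 𝒢 p
  rw [comparison_pushStalk, ← tensorPower_naturality, ← pushStalk_naturality, comparison_pushStalk]
  have h₁ := congrArg (fun α => ((stalk t).map α).hom q) hc
  simp only [Functor.map_comp] at h₁
  exact congrArg (O.tensorPower F') h₁.symm

end CyclicOrbit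

end Orbit

/-! ### The extension of scalars of a scheme over a finite field -/

section Extend

variable {k : Type u} [Field k] {K : Type u} [Field K] [Algebra k K]
  {X : Scheme.{u}} (f : X ⟶ Spec (.of k))

theorem act_galAut_fst (σ : K ≃ₐ[k] K) :
    act (galAut K f) σ ≫ pullback.fst f (specMap k K) = pullback.fst f (specMap k K) :=
  act_comp_proj (galAut K f) σ

theorem act_galAut_snd (σ : K ≃ₐ[k] K) :
    act (galAut K f) σ ≫ pullback.snd f (specMap k K) = pullback.snd f (specMap k K) ≫
      Spec.map (CommRingCat.ofHom (σ.symm : K →+* K)) :=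
  pullback.lift_snd _ _ _

theorem exists_spec_map {R S : Type u} [CommRing R] [CommRing S] (g : Spec (.of S) ⟶ Spec (.of R)) :
    ∃ φ : R →+* S, g = Spec.map (CommRingCat.ofHom φ) :=
  ⟨(Spec.preimage g).hom, (Spec.map_preimage g).symm⟩

theorem spec_map_inj {R S : Type u} [CommRing R] [CommRing S] {φ ψ : R →+* S}
    (h : Spec.map (CommRingCat.ofHom φ) = Spec.map (CommRingCat.ofHom ψ)) : φ = ψ :=
  congrArg CommRingCat.Hom.hom (Spec.map_injective h)

theorem spec_map_comp {R S T : Type u} [CommRing R] [CommRing S] [CommRing T] (φ : R →+* S)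
    (ψ : S →+* T) : Spec.map (CommRingCat.ofHom ψ) ≫ Spec.map (CommRingCat.ofHom φ) =
      Spec.map (CommRingCat.ofHom (ψ.comp φ)) := by
  rw [← Spec.map_comp, ← CommRingCat.ofHom_comp]

/-- Two embeddings of a normal extension that agree on k differ by an automorphism. The field Ω is
made a K-algebra through ψ, and φ then restricts to an automorphism of K. -/
theorem exists_algEquiv_comp_eq [Normal k K] {Ω : Type u} [Field Ω] (φ ψ : K →+* Ω)
    (h : φ.comp (algebraMap k K) = ψ.comp (algebraMap k K)) :
    ∃ σ : K ≃ₐ[k] K, φ.comp (σ.symm : K →+* K) = ψ := by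
  let : Algebra k Ω := (ψ.comp (algebraMap k K)).toAlgebra
  let : Algebra K Ω := ψ.toAlgebra
  have : IsScalarTower k K Ω := IsScalarTower.of_algebraMap_eq fun _ => rfl
  let φ' : K →ₐ[k] Ω := { φ with commutes' := fun a => RingHom.congr_fun h a }
  let ψ' : K →ₐ[k] Ω := { ψ with commutes' := fun a => rfl }
  have hψ (a : K) : algebraMap K Ω a = ψ a := rfl
  refine ⟨AlgHom.restrictNormal' φ' K, RingHom.ext fun a => ?_⟩
  have h := φ'.restrictNormal_commutes K ((AlgHom.restrictNormal' φ' K).symm a)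
  refine Eq.trans ?_ (h.symm.trans ?_)
  · rfl
  · refine (hψ _).trans (congrArg ψ ?_)
    exact (AlgHom.restrictNormal' φ' K).apply_symm_apply a

/-- A point of X ×_k K over a given point of X amounts to an embedding of K compatible with k, so
transitivity is that of Gal(K/k) on embeddings, and freeness is injectivity of field homomorphisms
after restriction to a residue field. -/
theorem isTorsor_galAut [Normal k K] : IsTorsor (galAut K f) where
  exists_act Ω _ _ y y' h := by
    obtain ⟨φ, hφ⟩ := exists_spec_map (y ≫ pullback.snd f (specMap k K))
    obtain ⟨ψ, hψ⟩ := exists_spec_map (y' ≫ pullback.snd f (specMap k K))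
    have e : φ.comp (algebraMap k K) = ψ.comp (algebraMap k K) := by
      apply spec_map_inj
      rw [← spec_map_comp, ← spec_map_comp, ← hφ, ← hψ, Category.assoc, Category.assoc,
        ← pullback.condition, reassoc_of% h]
    obtain ⟨σ, hσ⟩ := exists_algEquiv_comp_eq φ ψ e
    refine ⟨σ, pullback.hom_ext ?_ ?_⟩
    · rw [Category.assoc, act_galAut_fst, h]
    · rw [Category.assoc, act_galAut_snd, ← Category.assoc, hφ, hψ, spec_map_comp, hσ]
  eq_of_act W _ y σ τ h := by
    let w : W := Classical.arbitrary W
    let p : Spec (.of (W.residueField w)) ⟶ W := W.fromSpecResidueField w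
    obtain ⟨φ, hφ⟩ := exists_spec_map (p ≫ y ≫ pullback.snd f (specMap k K))
    have e : φ.comp (σ.symm : K →+* K) = φ.comp (τ.symm : K →+* K) := by
      apply spec_map_inj
      rw [← spec_map_comp, ← spec_map_comp, ← hφ]
      simp only [Category.assoc]
      rw [← act_galAut_snd, ← act_galAut_snd, reassoc_of% h]
    have e' : σ.symm = τ.symm := AlgEquiv.ext fun a => φ.injective (RingHom.congr_fun e a)
    rw [← AlgEquiv.symm_symm σ, e', AlgEquiv.symm_symm]

/-- The projection is surjective and étale, so even a separably closed field suffices to lift a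
geometric point. The stalk conditions on an adic sheaf over X can therefore be checked upstairs. -/
theorem exists_lift_geomPoint [Finite k] [FiniteDimensional k K] {Ω : Type u} [Field Ω]
    [IsSepClosed Ω] (s : Spec (.of Ω) ⟶ X) :
    ∃ t : Spec (.of Ω) ⟶ extend K f, t ≫ extendProj K f = s := by
  have : Surjective (specMap k K) := ⟨fun x => ⟨Classical.arbitrary _, Subsingleton.elim _ _⟩⟩
  have : Surjective (extendProj K f) := inferInstanceAs (Surjective (pullback.fst f (specMap k K)))
  obtain ⟨y, hy⟩ := (extendProj K f).surjective (s default)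
  obtain ⟨t, ht, -⟩ := Scheme.exists_fac_of_etale_of_isSepClosed (extendProj K f) s y hy
  exact ⟨t, ht⟩

variable {Ω : Type u} [Field Ω] [Algebra k Ω] [Algebra K Ω] [IsScalarTower k K Ω]
  (x : Spec (.of k) ⟶ X) (hx : x ≫ f = 𝟙 _)

theorem geomPoint_extendPoint_fst :
    geomPoint Ω (extendPoint K f x hx) ≫ pullback.fst f (specMap k K) = geomPoint Ω x := by
  unfold geomPoint extendPoint
  rw [Category.assoc, pullback.lift_fst, ← Category.assoc, spec_map_comp,
    ← IsScalarTower.algebraMap_eq]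

omit [Algebra k Ω] [IsScalarTower k K Ω] in
theorem geomPoint_extendPoint_snd :
    geomPoint Ω (extendPoint K f x hx) ≫ pullback.snd f (specMap k K) =
      Spec.map (CommRingCat.ofHom (algebraMap K Ω)) := by
  unfold geomPoint extendPoint
  rw [Category.assoc, pullback.lift_snd, Category.comp_id]

/-- The action of σ on Y is through Spec(σ⁻¹), so on the K-component it cancels the automorphism g
extending σ; on the X-component g is invisible because the point is defined over k. -/
theorem galois_comp_geomPoint_act [IsSepClosed Ω] (g : Ω ≃ₐ[k] Ω) (σ : K ≃ₐ[k] K)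
    (h : ∀ a, g (algebraMap K Ω a) = algebraMap K Ω (σ a)) :
    Spec.map (CommRingCat.ofHom (g : Ω →+* Ω)) ≫ geomPoint Ω (extendPoint K f x hx) ≫
      act (galAut K f) σ = geomPoint Ω (extendPoint K f x hx) := by
  apply pullback.hom_ext
  · rw [Category.assoc, Category.assoc, act_galAut_fst, geomPoint_extendPoint_fst,
      galois_comp_geomPoint]
  · rw [Category.assoc, Category.assoc, act_galAut_snd, ← Category.assoc (geomPoint _ _),
      geomPoint_extendPoint_snd, spec_map_comp, spec_map_comp]
    congr 2
    ext a
    exact (h (σ.symm a)).trans (congrArg _ (σ.apply_symm_apply a))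

variable [Fintype k] [FiniteDimensional k K] [Algebra.IsAlgebraic k Ω]

omit [IsScalarTower k K Ω] in
theorem frobenius_algebraMap (a : K) :
    FiniteField.frobeniusAlgEquivOfAlgebraic k Ω (algebraMap K Ω a) =
      algebraMap K Ω (FiniteField.frobeniusAlgEquivOfAlgebraic k K a) := by
  rw [FiniteField.coe_frobeniusAlgEquivOfAlgebraic, FiniteField.coe_frobeniusAlgEquivOfAlgebraic,
    map_pow]

omit [IsScalarTower k K Ω] in
theorem geomFrob_algebraMap (a : K) :
    geomFrob k Ω (algebraMap K Ω a) = algebraMap K Ω (geomFrob k K a) := by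
  have h := frobenius_algebraMap (k := k) (Ω := Ω) (geomFrob k K a)
  have h' : FiniteField.frobeniusAlgEquivOfAlgebraic k K (geomFrob k K a) = a :=
    (FiniteField.frobeniusAlgEquivOfAlgebraic k K).apply_symm_apply a
  rw [h'] at h
  rw [← h]
  exact (FiniteField.frobeniusAlgEquivOfAlgebraic k Ω).symm_apply_apply _

omit [IsScalarTower k K Ω] in
theorem geomFrob_pow_algebraMap' (i : ℕ) (a : K) :
    (geomFrob k Ω ^ i) (algebraMap K Ω a) = algebraMap K Ω ((geomFrob k K ^ i) a) := by
  induction i generalizing a with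
  | zero => rfl
  | succ i ih =>
    rw [pow_succ, pow_succ, AlgEquiv.mul_apply, AlgEquiv.mul_apply, geomFrob_algebraMap, ih]

theorem geomFrob_pow_bijective :
    Function.Bijective fun i : Fin (Module.finrank k K) => geomFrob k K ^ i.1 := by
  have : Finite K := Module.finite_of_finite k
  have h := FiniteField.bijective_frobeniusAlgEquivOfAlgebraic_pow k K
  have h' := (Equiv.inv (K ≃ₐ[k] K)).bijective.comp h
  refine (congrArg Function.Bijective (funext fun i => ?_)).mp h'
  exact (inv_pow _ _).symm

instance isIso_spec_algEquiv (g : Ω ≃ₐ[k] Ω) :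
    IsIso (Spec.map (CommRingCat.ofHom (g : Ω →+* Ω))) := by
  refine ⟨Spec.map (CommRingCat.ofHom (g.symm : Ω →+* Ω)), ?_, ?_⟩
  · rw [spec_map_comp]
    refine Eq.trans ?_ (Spec.map_id _)
    congr 1
    ext a
    exact g.apply_symm_apply a
  · rw [spec_map_comp]
    refine Eq.trans ?_ (Spec.map_id _)
    congr 1
    ext a
    exact g.symm_apply_apply a

/-- The orbit of the geometric point over a `k`-valued point under the Frobenius. -/
def frobeniusOrbit [IsSepClosed Ω] :
    CyclicOrbit (galAut K f) (geomPoint Ω (extendPoint K f x hx)) where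
  gen := geomFrob k K
  endo i := Spec.map (CommRingCat.ofHom ((geomFrob k Ω ^ i : Ω ≃ₐ[k] Ω) : Ω →+* Ω))
  isIso_endo i := isIso_spec_algEquiv _
  endo_zero := Spec.map_id _
  endo_succ i := by
    rw [spec_map_comp, pow_one, pow_succ]
    rfl
  endo_act i := galois_comp_geomPoint_act f x hx _ _ (geomFrob_pow_algebraMap' i)
  order := Module.finrank k K
  order_pos := Module.finrank_pos
  gen_pow_order := AlgEquiv.ext fun a => geomFrob_pow_algebraMap k K K a
  idx τ := (Equiv.ofBijective _ geomFrob_pow_bijective).symm τ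
  gen_pow_idx τ := (Equiv.ofBijective _ geomFrob_pow_bijective).apply_symm_apply τ
  idx_lt τ := Fin.is_lt _
  idx_gen_pow i hi := congrArg Fin.val
    ((Equiv.ofBijective _ (geomFrob_pow_bijective (k := k) (K := K))).symm_apply_apply ⟨i, hi⟩)

end Extend

/-! ### Kernels of tensor products of surjections -/

section PiTensor

variable {A ι : Type*} [CommRing A] {M N : ι → Type*} [∀ i, AddCommGroup (M i)]
  [∀ i, Module A (M i)] [∀ i, AddCommGroup (N i)] [∀ i, Module A (N i)] (g : ∀ i, M i →ₗ[A] N i)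

/-- The submodule of `⨂ M_i` spanned by the pure tensors with a factor in the kernel of `g_i`. -/
def tprodKer : Submodule A (⨂[A] i, M i) :=
  Submodule.span A {x | ∃ (m : ∀ i, M i) (i : ι), g i (m i) = 0 ∧ x = PiTensorProduct.tprod A m}

variable {g}

/-- The factors are exchanged one at a time: each exchange changes the tensor by a pure tensor with
the factor m i - m' i, which lies in the kernel of g i. -/
theorem tprod_sub_tprod_mem [Finite ι] {m m' : ∀ i, M i} (h : ∀ i, g i (m i) = g i (m' i)) :
    PiTensorProduct.tprod A m - PiTensorProduct.tprod A m' ∈ tprodKer g := by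
  classical
  have := Fintype.ofFinite ι
  have key (s : Finset ι) : PiTensorProduct.tprod A (s.piecewise m m') -
      PiTensorProduct.tprod A m' ∈ tprodKer g := by
    induction s using Finset.induction_on with
    | empty =>
      rw [Finset.piecewise_empty, sub_self]
      exact Submodule.zero_mem _
    | insert i s hi ih =>
      rw [Finset.piecewise_insert]
      refine (sub_add_sub_cancel _ (PiTensorProduct.tprod A (s.piecewise m m')) _) ▸
        Submodule.add_mem _ ?_ ih
      have e : PiTensorProduct.tprod A (s.piecewise m m') = PiTensorProduct.tprod A
          (Function.update (s.piecewise m m') i (m' i)) := by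
        rw [← Finset.piecewise_eq_of_notMem s m m' hi, Function.update_eq_self]
      rw [e, ← MultilinearMap.map_update_sub]
      refine Submodule.subset_span ⟨_, i, ?_, rfl⟩
      rw [Function.update_self, map_sub, h, sub_self]
  have h' := key Finset.univ
  rwa [Finset.piecewise_univ] at h'

/-- Right exactness of the tensor product. Set-theoretic sections l of the g i become multilinear
modulo `tprodKer`, and the resulting map provides a left inverse to the map induced on the quotient.
-/
theorem ker_piTensorProduct_map_le [Finite ι] (hg : ∀ i, Function.Surjective (g i)) :
    LinearMap.ker (PiTensorProduct.map g) ≤ tprodKer g := by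
  classical
  choose l hl using hg
  let ψ : MultilinearMap A N ((⨂[A] i, M i) ⧸ tprodKer g) :=
    { toFun n := (tprodKer g).mkQ (PiTensorProduct.tprod A fun i => l i (n i))
      map_update_add' := by
        intro _inst n i x y
        cases Subsingleton.elim (Classical.decEq ι) _inst
        have e (z : N i) : (fun j => l j (Function.update n i z j)) =
            Function.update (fun j => l j (n j)) i (l i z) := by
          funext j
          exact Function.apply_update (fun j => l j) n i z j
        rw [e, e, e, ← map_add, ← MultilinearMap.map_update_add]
        refine (Submodule.Quotient.eq _).2 (tprod_sub_tprod_mem fun j => ?_)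
        by_cases hj : j = i
        · subst hj
          simp only [Function.update_self, map_add, hl]
        · simp only [Function.update_of_ne hj]
      map_update_smul' := by
        intro _inst n i a x
        cases Subsingleton.elim (Classical.decEq ι) _inst
        have e (z : N i) : (fun j => l j (Function.update n i z j)) =
            Function.update (fun j => l j (n j)) i (l i z) := by
          funext j
          exact Function.apply_update (fun j => l j) n i z j
        rw [e, e, ← map_smul, ← MultilinearMap.map_update_smul]
        refine (Submodule.Quotient.eq _).2 (tprod_sub_tprod_mem fun j => ?_)
        by_cases hj : j = i
        · subst hj
          simp only [Function.update_self, map_smul, hl]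
        · simp only [Function.update_of_ne hj] }
  have h : PiTensorProduct.lift ψ ∘ₗ PiTensorProduct.map g = (tprodKer g).mkQ := by
    apply PiTensorProduct.ext
    ext m : 1
    refine (congrArg (PiTensorProduct.lift ψ) (PiTensorProduct.map_tprod g m)).trans ?_
    refine (PiTensorProduct.lift.tprod _).trans ?_
    exact (Submodule.Quotient.eq _).2 (tprod_sub_tprod_mem fun j => hl j _)
  intro x hx
  rw [← (tprodKer g).ker_mkQ, ← h, LinearMap.mem_ker, LinearMap.comp_apply, hx, map_zero]

theorem piTensorProduct_map_surjective (hg : ∀ i, Function.Surjective (g i)) :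
    Function.Surjective (PiTensorProduct.map g) := by
  intro x
  induction x using PiTensorProduct.induction_on with
  | smul_tprod a n =>
    choose l hl using hg
    refine ⟨a • PiTensorProduct.tprod A fun i => l i (n i), ?_⟩
    rw [map_smul, PiTensorProduct.map_tprod]
    congr 2
    funext i
    exact hl i _
  | add x y hx hy =>
    obtain ⟨x, rfl⟩ := hx
    obtain ⟨y, rfl⟩ := hy
    exact ⟨x + y, map_add _ _ _⟩

theorem piTensorProduct_smul_eq_zero (i : ι) {a : A} (h : ∀ m : M i, a • m = 0)
    (x : ⨂[A] i, M i) : a • x = 0 := by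
  classical
  induction x using PiTensorProduct.induction_on with
  | smul_tprod b m =>
    rw [smul_comm, ← Function.update_eq_self i m, ← MultilinearMap.map_update_smul, h,
      MultilinearMap.map_update_zero, smul_zero]
  | add x y hx hy => rw [smul_add, hx, hy, add_zero]

/-- A scalar can be moved onto any chosen factor, so tensoring commutes with reduction modulo I. A
factor must exist: the empty tensor product is A itself, which I need not annihilate. -/
theorem ker_piTensorProduct_map [Finite ι] [Nonempty ι] (hg : ∀ i, Function.Surjective (g i))
    (I : Ideal A) (hI : ∀ i, LinearMap.ker (g i) = I • (⊤ : Submodule A (M i))) :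
    LinearMap.ker (PiTensorProduct.map g) = I • (⊤ : Submodule A (⨂[A] i, M i)) := by
  classical
  apply le_antisymm
  · refine (ker_piTensorProduct_map_le hg).trans (Submodule.span_le.2 ?_)
    rintro _ ⟨m, i, hm, rfl⟩
    have h : m i ∈ I • (⊤ : Submodule A (M i)) := hI i ▸ LinearMap.mem_ker.2 hm
    have h' := Submodule.smul_top_le_comap_smul_top I
      ((PiTensorProduct.tprod A).toLinearMap m i) h
    rw [Submodule.mem_comap, MultilinearMap.toLinearMap_apply, Function.update_eq_self] at h'
    exact h'
  · refine Submodule.smul_le.2 fun a ha x _ => ?_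
    rw [LinearMap.mem_ker, map_smul]
    refine piTensorProduct_smul_eq_zero (Classical.arbitrary ι) (fun n => ?_) _
    obtain ⟨m, rfl⟩ := hg _ n
    rw [← map_smul]
    exact LinearMap.mem_ker.1 (hI _ ▸ Submodule.smul_mem_smul ha trivial)

theorem ker_piTensorProduct_map_torsion [IsDomain A] [Finite ι]
    (hg : ∀ i, Function.Surjective (g i))
    (ht : ∀ i m, g i m = 0 → ∃ a : A, a ≠ 0 ∧ a • m = 0) (x : ⨂[A] i, M i)
    (hx : PiTensorProduct.map g x = 0) : ∃ a : A, a ≠ 0 ∧ a • x = 0 := by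
  classical
  have h := ker_piTensorProduct_map_le hg (LinearMap.mem_ker.2 hx)
  refine Submodule.span_induction ?_ ⟨1, one_ne_zero, smul_zero _⟩ ?_ ?_ h
  · rintro _ ⟨m, i, hm, rfl⟩
    obtain ⟨a, ha, h⟩ := ht i (m i) hm
    refine ⟨a, ha, ?_⟩
    rw [← Function.update_eq_self i m, ← MultilinearMap.map_update_smul, h,
      MultilinearMap.map_update_zero]
  · rintro x y - - ⟨a, ha, hx⟩ ⟨b, hb, hy⟩
    exact ⟨a * b, mul_ne_zero ha hb, by rw [smul_add, mul_comm, mul_smul, hx, mul_comm, mul_smul,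
      hy, smul_zero, smul_zero, add_zero]⟩
  · rintro b x - ⟨a, ha, hx⟩
    exact ⟨a, ha, by rw [smul_comm, hx, smul_zero]⟩

end PiTensor

/-! ### The trace of the twisted cyclic operator -/

namespace CyclicOrbit

variable {A : Type u} [CommRing A] {X Y : Scheme.{u}} {π : Y ⟶ X} {G : Type u} [Group G]
  {ρ : G →* Aut (Over.mk π)} {Ω : Type u} [Field Ω] {t : Spec (.of Ω) ⟶ Y}
  (O : CyclicOrbit ρ t) {N N' : Type u} [AddCommGroup N] [Module A N] [AddCommGroup N'] [Module A N']

theorem cyclic_naturality (B : N →ₗ[A] N) (B' : N' →ₗ[A] N') (g : N →ₗ[A] N')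
    (h : ∀ n, g (B n) = B' (g n)) (x : ⨂[A] _ : G, N) :
    PiTensorProduct.map (fun _ => g) (O.cyclic B x) =
      O.cyclic B' (PiTensorProduct.map (fun _ => g) x) := by
  induction x using PiTensorProduct.induction_on with
  | smul_tprod a y =>
    simp only [map_smul, cyclic_tprod, PiTensorProduct.map_tprod]
    congr 2
    funext τ
    split
    · exact h _
    · rfl
  | add x y hx hy => simp only [map_add, hx, hy]

/-- The r - 1 steps other than the wraparound already join all elements of G into one chain starting
at 1. -/
theorem eq_of_forall_mul_gen {κ : Type*} (p : G → κ)
    (h : ∀ τ, O.idx τ + 1 ≠ O.order → p (τ * O.gen) = p τ) (τ : G) : p τ = p 1 := by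
  have key (i : ℕ) (hi : i < O.order) : p (O.gen ^ i) = p 1 := by
    induction i with
    | zero => rw [pow_zero]
    | succ i ih =>
      rw [pow_succ, h, ih (by omega)]
      rw [O.idx_gen_pow i (by omega)]
      omega
  have h' := key _ (O.idx_lt τ)
  rwa [O.gen_pow_idx] at h'

/-- In the tensor basis, the diagonal coefficient at p is a product over τ, and at each τ other than
the wraparound the factor is 1 or 0 according to whether p(τσ) = p(τ). Only constant p survive, each
contributing the corresponding diagonal coefficient of B. -/
theorem trace_cyclic [Finite G] [Module.Free A N] [Module.Finite A N] (B : N →ₗ[A] N) :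
    LinearMap.trace A _ (O.cyclic B) = LinearMap.trace A _ B := by
  classical
  have := Fintype.ofFinite G
  let b := Module.Free.chooseBasis A N
  rw [LinearMap.trace_eq_matrix_trace A (Basis.piTensorProduct fun _ : G => b),
    LinearMap.trace_eq_matrix_trace A b]
  refine (Fintype.sum_of_injective (fun j _ => j) (fun i j h => congrFun h 1) _ _ ?_ ?_).symm
  · intro p hp
    rw [Matrix.diag_apply, LinearMap.toMatrix_apply, Basis.piTensorProduct_apply, cyclic_tprod,
      Basis.piTensorProduct_repr_tprod_apply]
    by_contra h
    refine hp ⟨p 1, funext fun τ => (O.eq_of_forall_mul_gen p (fun τ hτ => ?_) τ).symm⟩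
    have h' := fun e => h (Finset.prod_eq_zero (Finset.mem_univ τ) e)
    by_contra hne
    apply h'
    rw [if_neg hτ, Module.Basis.repr_self, Finsupp.single_apply, if_neg hne]
  · intro j
    rw [Matrix.diag_apply, Matrix.diag_apply, LinearMap.toMatrix_apply, LinearMap.toMatrix_apply,
      Basis.piTensorProduct_apply, cyclic_tprod, Basis.piTensorProduct_repr_tprod_apply]
    -- The unique element at which B is applied.
    let τ₀ : G := O.gen ^ (O.order - 1)
    have hpos := O.order_pos
    have hτ₀ : O.idx τ₀ + 1 = O.order := by
      rw [O.idx_gen_pow _ (by omega)]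
      omega
    rw [Finset.prod_eq_single τ₀, if_pos hτ₀]
    · intro τ _ hτ
      have hne : O.idx τ + 1 ≠ O.order := fun h => hτ (by
        rw [← O.gen_pow_idx τ, show O.idx τ = O.order - 1 by omega])
      rw [if_neg hne, Module.Basis.repr_self, Finsupp.single_eq_same]
    · exact fun h => (h (Finset.mem_univ _)).elim

end CyclicOrbit

/-! ### Traces after extension of scalars to the fraction field -/

section Fraction

variable {O E : Type*} [CommRing O] [IsDomain O] [Field E] [Algebra O E] [IsFractionRing O E]
  {N N' : Type*} [AddCommGroup N] [Module O N] [AddCommGroup N'] [Module O N']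

theorem exists_smul_eq_one_tmul (z : E ⊗[O] N) :
    ∃ (a : O) (n : N), a ≠ 0 ∧ a • z = 1 ⊗ₜ n := by
  induction z using TensorProduct.induction_on with
  | zero => exact ⟨1, 0, one_ne_zero, by rw [smul_zero, TensorProduct.tmul_zero]⟩
  | tmul e n =>
    obtain ⟨b, a, ha, rfl⟩ := IsFractionRing.div_surjective (A := O) e
    have ha' : a ≠ 0 := nonZeroDivisors.ne_zero ha
    refine ⟨a, b • n, ha', ?_⟩
    rw [TensorProduct.smul_tmul', ← TensorProduct.smul_tmul, Algebra.smul_def, Algebra.smul_def,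
      mul_one, mul_div_cancel₀]
    exact IsFractionRing.to_map_eq_zero_iff.not.2 ha'
  | add x y hx hy =>
    obtain ⟨a, n, ha, hx⟩ := hx
    obtain ⟨b, m, hb, hy⟩ := hy
    refine ⟨a * b, b • n + a • m, mul_ne_zero ha hb, ?_⟩
    rw [smul_add, TensorProduct.tmul_add, TensorProduct.tmul_smul, TensorProduct.tmul_smul, ← hx,
      ← hy, smul_smul, smul_smul, mul_comm]

theorem one_tmul_eq_zero {n : N} (h : (1 : E) ⊗ₜ[O] n = 0) : ∃ a : O, a ≠ 0 ∧ a • n = 0 := by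
  have h' : TensorProduct.mk O E N 1 n = TensorProduct.mk O E N 1 0 := by
    rw [map_zero]
    exact h
  obtain ⟨c, hc⟩ := (IsLocalizedModule.eq_iff_exists (nonZeroDivisors O)
    (TensorProduct.mk O E N 1)).1 h'
  exact ⟨c, nonZeroDivisors.ne_zero c.2, hc.trans (smul_zero _)⟩

omit [IsDomain O] in
theorem smul_tensor_eq_zero {a : O} (ha : a ≠ 0) {z : E ⊗[O] N} (h : a • z = 0) : z = 0 := by
  rw [← algebraMap_smul E a z] at h
  exact (smul_eq_zero.1 h).resolve_left (IsFractionRing.to_map_eq_zero_iff.not.2 ha)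

/-- If `P : N → N'` has torsion kernel and cokernel, `E ⊗ P` is an isomorphism. -/
theorem baseChange_bijective (P : N →ₗ[O] N')
    (hker : ∀ n, P n = 0 → ∃ a : O, a ≠ 0 ∧ a • n = 0)
    (hcoker : ∀ n', ∃ (a : O) (n : N), a ≠ 0 ∧ a • n' = P n) :
    Function.Bijective (P.baseChange E) := by
  constructor
  · refine (injective_iff_map_eq_zero _).2 fun z hz => ?_
    obtain ⟨a, n, ha, h⟩ := exists_smul_eq_one_tmul z
    have h₁ : (1 : E) ⊗ₜ[O] P n = 0 := by
      rw [← LinearMap.baseChange_tmul, ← h, ← algebraMap_smul E a z, map_smul, hz, smul_zero]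
    obtain ⟨b, hb, h₂⟩ := one_tmul_eq_zero h₁
    rw [← map_smul] at h₂
    obtain ⟨c, hc, h₃⟩ := hker _ h₂
    refine smul_tensor_eq_zero (mul_ne_zero (mul_ne_zero hc hb) ha) ?_
    rw [mul_smul, mul_smul, h, ← TensorProduct.tmul_smul, ← TensorProduct.tmul_smul, h₃,
      TensorProduct.tmul_zero]
  · intro z
    obtain ⟨a, n', ha, h⟩ := exists_smul_eq_one_tmul z
    obtain ⟨b, n, hb, h'⟩ := hcoker n'
    refine ⟨(algebraMap O E (b * a))⁻¹ • (1 ⊗ₜ n), ?_⟩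
    have hne : algebraMap O E (b * a) ≠ 0 :=
      IsFractionRing.to_map_eq_zero_iff.not.2 (mul_ne_zero hb ha)
    rw [map_smul, LinearMap.baseChange_tmul, ← h', TensorProduct.tmul_smul, ← h, smul_smul,
      ← algebraMap_smul E (b * a) z, smul_smul, inv_mul_cancel₀ hne, one_smul]

/-- After extension of scalars P becomes an isomorphism intertwining f and f', and on the free
module N' the trace commutes with extension of scalars. -/
theorem trace_baseChange_eq [Module.Free O N'] [Module.Finite O N'] (P : N →ₗ[O] N')
    (hker : ∀ n, P n = 0 → ∃ a : O, a ≠ 0 ∧ a • n = 0)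
    (hcoker : ∀ n', ∃ (a : O) (n : N), a ≠ 0 ∧ a • n' = P n)
    (f : N →ₗ[O] N) (f' : N' →ₗ[O] N') (hf : ∀ n, P (f n) = f' (P n)) :
    LinearMap.trace E _ (f.baseChange E) = algebraMap O E (LinearMap.trace O _ f') := by
  let e := LinearEquiv.ofBijective _ (baseChange_bijective (E := E) P hker hcoker)
  rw [← LinearMap.trace_baseChange, ← LinearMap.trace_conj' (f.baseChange E) e]
  congr 1
  apply LinearMap.ext
  intro z
  obtain ⟨z, rfl⟩ := e.surjective z
  rw [LinearEquiv.conj_apply_apply, e.symm_apply_apply]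
  have h : P ∘ₗ f = f' ∘ₗ P := LinearMap.ext hf
  have h' := LinearMap.congr_fun (congrArg (LinearMap.baseChange E) h) z
  rwa [LinearMap.baseChange_comp, LinearMap.baseChange_comp] at h'

end Fraction

/-! ### Linear compactness -/

/-- Compatible systems of solvable linear equations in a finite module have solutions. -/
structure IsLinearlyCompact (O : Type u) [CommRing O] : Prop where
  exists_forall_eq : ∀ {M : Type u} [AddCommGroup M] [Module O M] [Module.Finite O M]
    {P : ℕ → Type u} [∀ n, AddCommGroup (P n)] [∀ n, Module O (P n)] (p : ∀ n, M →ₗ[O] P n)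
    (t : ∀ n, P (n + 1) →ₗ[O] P n), (∀ n x, t n (p (n + 1) x) = p n x) →
    ∀ v : ∀ n, P n, (∀ n, t n (v (n + 1)) = v n) → (∀ n, ∃ x, p n x = v n) →
      ∃ x, ∀ n, p n x = v n

theorem isClosed_submodule {R : Type*} [CommRing R] [TopologicalSpace R] [IsTopologicalRing R]
    [CompactSpace R] [T2Space R] [IsNoetherianRing R] {d : ℕ} (K : Submodule R (Fin d → R)) :
    IsClosed (K : Set (Fin d → R)) := by
  obtain ⟨e, ψ, hψ⟩ := Module.Finite.exists_fin' R K
  have hc : Continuous (K.subtype ∘ₗ ψ) := LinearMap.continuous_on_pi _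
  have h : (K : Set (Fin d → R)) = Set.range (K.subtype ∘ₗ ψ) := by
    ext a
    constructor
    · intro ha
      obtain ⟨b, hb⟩ := hψ ⟨a, ha⟩
      exact ⟨b, congrArg Subtype.val hb⟩
    · rintro ⟨b, rfl⟩
      exact (ψ b).2
  rw [h]
  exact (isCompact_range hc).isClosed

/-- After a surjection R^d → M, the solution sets at successive levels are nonempty nested cosets of
closed submodules in a compact space, so they have a common point. -/
theorem isLinearlyCompact_of_finite (R : Type*) [CommRing R] [TopologicalSpace R]
    [IsTopologicalRing R] [CompactSpace R] [T2Space R] [IsNoetherianRing R] (O : Type u)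
    [CommRing O] [Algebra R O] [Module.Finite R O] : IsLinearlyCompact O where
  exists_forall_eq {M} _ _ _ {P} _ _ p t hp v hv hex := by
    let : Module R M := Module.compHom M (algebraMap R O)
    have : IsScalarTower R O M := ⟨fun r a m => by rw [Algebra.smul_def, mul_smul]; rfl⟩
    have : Module.Finite R M := Module.Finite.trans O M
    obtain ⟨d, φ, hφ⟩ := Module.Finite.exists_fin' R M
    let S (n : ℕ) : Set (Fin d → R) := {a | p n (φ a) = v n}
    have hclosed (n : ℕ) : IsClosed (S n) := by
      obtain ⟨x, hx⟩ := hex n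
      obtain ⟨a, rfl⟩ := hφ x
      let K : Submodule R (Fin d → R) := ((LinearMap.ker (p n)).restrictScalars R).comap φ
      have h : S n = (fun b => b - a) ⁻¹' (K : Set (Fin d → R)) := by
        ext b
        change p n (φ b) = v n ↔ p n (φ (b - a)) = 0
        rw [map_sub, map_sub, hx, sub_eq_zero]
      rw [h]
      exact (isClosed_submodule K).preimage (by fun_prop)
    obtain ⟨a, ha⟩ := IsCompact.nonempty_iInter_of_sequence_nonempty_isCompact_isClosed S
      (fun n a ha => (hp n _).symm.trans ((congrArg (t n) ha).trans (hv n)))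
      (fun n => by
        obtain ⟨x, hx⟩ := hex n
        obtain ⟨a, rfl⟩ := hφ x
        exact ⟨a, hx⟩)
      (hclosed 0).isCompact hclosed
    exact ⟨φ a, fun n => Set.mem_iInter.1 ha n⟩

namespace IsLinearlyCompact

variable {O : Type u} [CommRing O] (hO : IsLinearlyCompact O)
include hO

theorem isPrecomplete (I : Ideal O) : IsPrecomplete I O where
  prec' f hf := by
    have hle (n : ℕ) : (I ^ (n + 1) • ⊤ : Submodule O O) ≤ I ^ n • ⊤ :=
      Submodule.smul_mono_left (Ideal.pow_le_pow_right n.le_succ)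
    obtain ⟨x, hx⟩ := hO.exists_forall_eq
      (fun n => (I ^ n • ⊤ : Submodule O O).mkQ)
      (fun n => Submodule.factor (hle n)) (fun n x => rfl)
      (fun n => (I ^ n • ⊤ : Submodule O O).mkQ (f n))
      (fun n => (hf n.le_succ).symm) (fun n => ⟨_, rfl⟩)
    exact ⟨x, fun n => (hx n).symm⟩

/-- A ring complete for the topology of a maximal ideal is local. Precompleteness comes from linear
compactness, separatedness from Krull's intersection theorem. -/
theorem isLocalRing [IsDomain O] [IsNoetherianRing O] (𝔪 : Ideal O) [𝔪.IsMaximal] :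
    IsLocalRing O := by
  have h₁ := hO.isPrecomplete 𝔪
  have h₂ := IsHausdorff.of_isDomain 𝔪 (Ideal.IsMaximal.ne_top ‹_›)
  have : IsAdicComplete 𝔪 O := { h₁, h₂ with }
  exact isLocalRing_of_isAdicComplete_maximal 𝔪

end IsLinearlyCompact

/-! ### Adic systems of modules -/

section AdicSystem

variable {O : Type u} [CommRing O] {M N : ℕ → Type u} [∀ n, AddCommGroup (M n)]
  [∀ n, Module O (M n)] [∀ n, AddCommGroup (N n)] [∀ n, Module O (N n)]

/-- The inverse limit of a system of modules. -/
def adicLimit (t : ∀ n, M (n + 1) →ₗ[O] M n) : Submodule O (∀ n, M n) where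
  carrier := {v | ∀ n, t n (v (n + 1)) = v n}
  add_mem' := fun hv hw n => by simp [hv n, hw n]
  zero_mem' := fun n => by simp
  smul_mem' := fun _ _ hv n => by simp [hv n]

/-- The projections of the inverse limit. -/
def adicLimitProj (t : ∀ n, M (n + 1) →ₗ[O] M n) (n : ℕ) : adicLimit t →ₗ[O] M n :=
  LinearMap.proj n ∘ₗ (adicLimit t).subtype

/-- The map of inverse limits induced by a map of systems. -/
def adicLimitMap {t : ∀ n, M (n + 1) →ₗ[O] M n} {t' : ∀ n, N (n + 1) →ₗ[O] N n}
    (g : ∀ n, M n →ₗ[O] N n) (h : ∀ n x, t' n (g (n + 1) x) = g n (t n x)) :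
    adicLimit t →ₗ[O] adicLimit t' :=
  LinearMap.restrict (LinearMap.pi fun n => g n ∘ₗ LinearMap.proj n)
    (fun _ hv n => (h n _).trans (congrArg (g n) (hv n)))

/-- The map to the inverse limit given by a compatible system of maps. -/
def adicLimitLift {L : Type*} [AddCommGroup L] [Module O L] {t : ∀ n, M (n + 1) →ₗ[O] M n}
    (g : ∀ n, L →ₗ[O] M n) (h : ∀ n x, t n (g (n + 1) x) = g n x) : L →ₗ[O] adicLimit t :=
  LinearMap.codRestrict _ (LinearMap.pi g) (fun x n => h n x)

/-- Systems `(M_n)` of `O ⧸ 𝔪 ^ n`-modules such that `M_{n+1} ⧸ 𝔪 ^ n M_{n+1} ≅ M_n`. -/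
structure IsAdicSystem (𝔪 : Ideal O) (t : ∀ n, M (n + 1) →ₗ[O] M n) : Prop where
  smul_eq_zero : ∀ n, ∀ a ∈ 𝔪 ^ n, ∀ m : M n, a • m = 0
  surjective : ∀ n, Function.Surjective (t n)
  ker : ∀ n, LinearMap.ker (t n) = 𝔪 ^ n • (⊤ : Submodule O (M (n + 1)))

namespace IsAdicSystem

variable {𝔪 : Ideal O} {t : ∀ n, M (n + 1) →ₗ[O] M n} (h : IsAdicSystem 𝔪 t)
include h

theorem subsingleton_zero : Subsingleton (M 0) :=
  subsingleton_of_forall_eq 0 fun m => by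
    rw [← one_smul O m]
    exact h.smul_eq_zero 0 1 (by rw [pow_zero, Ideal.one_eq_top]; trivial) m

theorem smul_top_le_ker (n : ℕ) {L : Type*} [AddCommGroup L] [Module O L] (g : L →ₗ[O] M n) :
    𝔪 ^ n • (⊤ : Submodule O L) ≤ LinearMap.ker g :=
  Submodule.smul_le.2 fun a ha x _ => by
    rw [LinearMap.mem_ker, map_smul, h.smul_eq_zero n a ha]

/-- Lifts are chosen successively along the surjective transition maps. The component at level 0
carries no information, as M 0 vanishes. -/
theorem exists_lift_one (x : M 1) : ∃ v : adicLimit t, v.1 1 = x := by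
  choose l hl using h.surjective
  let v (n : ℕ) : M n := Nat.rec (motive := M) 0
    (fun n y => if hn : n = 0 then hn ▸ x else l n y) n
  have hv : v 1 = x := rfl
  refine ⟨⟨v, fun n => ?_⟩, hv⟩
  cases n with
  | zero =>
    have := h.subsingleton_zero
    exact Subsingleton.elim _ _
  | succ n => exact hl (n + 1) _

/-- Going up one level, 𝔪^n M_{m+1} maps onto 𝔪^n M_m, and the error lies in the kernel 𝔪^m M_{m+1},
which is contained in 𝔪^n M_{m+1} because n ≤ m. -/
theorem mem_smul_top_of_eq_zero {v : ∀ n, M n} (hv : v ∈ adicLimit t) {n : ℕ} (h₀ : v n = 0)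
    (m : ℕ) (hm : n ≤ m) : v m ∈ 𝔪 ^ n • (⊤ : Submodule O (M m)) := by
  induction m, hm using Nat.le_induction with
  | base =>
    rw [h₀]
    exact Submodule.zero_mem _
  | succ m hm ih =>
    have h₁ : v m ∈ (𝔪 ^ n • (⊤ : Submodule O (M (m + 1)))).map (t m) := by
      rw [Submodule.map_smul'', Submodule.map_top, LinearMap.range_eq_top.2 (h.surjective m)]
      exact ih
    obtain ⟨y, hy, hy'⟩ := h₁
    have h₂ : v (m + 1) - y ∈ 𝔪 ^ n • (⊤ : Submodule O (M (m + 1))) := by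
      refine Submodule.smul_mono_left (Ideal.pow_le_pow_right hm) ?_
      rw [← h.ker m, LinearMap.mem_ker, map_sub, hy', hv m, sub_self]
    have h₃ := Submodule.add_mem _ h₂ hy
    rwa [sub_add_cancel] at h₃

variable [IsLocalRing O] [IsNoetherianRing O] (hm : 𝔪 ≠ ⊤) [∀ n, Module.Finite O (M n)]
include hm

omit [IsNoetherianRing O] in
-- Nakayama's lemma: for n ≥ 1 the kernel of M_{n+1} → M_n is contained in 𝔪 M_{n+1}. Level 1 has to
-- be given, since the kernel of M_1 → M_0 is all of M_1.
theorem surjective_of_surjective_one {L : Type*} [AddCommGroup L] [Module O L]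
    (g : ∀ n, L →ₗ[O] M n) (hg : ∀ n x, t n (g (n + 1) x) = g n x)
    (hs : Function.Surjective (g 1)) (n : ℕ) : Function.Surjective (g n) := by
  induction n with
  | zero =>
    have := h.subsingleton_zero
    exact fun x => ⟨0, Subsingleton.elim _ _⟩
  | succ n ih =>
    rcases Nat.eq_zero_or_pos n with rfl | hn
    · exact hs
    have key : (⊤ : Submodule O (M (n + 1))) ≤ LinearMap.range (g (n + 1)) := by
      refine Submodule.le_of_le_smul_of_le_jacobson_bot (I := 𝔪) Module.Finite.fg_top
        ((IsLocalRing.le_maximalIdeal hm).trans (IsLocalRing.maximalIdeal_le_jacobson _)) ?_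
      intro x _
      obtain ⟨a, ha⟩ := ih (t n x)
      have h₁ : x - g (n + 1) a ∈ 𝔪 ^ n • (⊤ : Submodule O (M (n + 1))) := by
        rw [← h.ker n, LinearMap.mem_ker, map_sub, hg, ha, sub_self]
      have h₂ := Submodule.smul_mono_left (N := ⊤) (Ideal.pow_le_self (I := 𝔪) hn.ne') h₁
      have h₃ := Submodule.add_mem_sup (LinearMap.mem_range_self (g (n + 1)) a) h₂
      rwa [add_sub_cancel] at h₃
    exact LinearMap.range_eq_top.1 (top_le_iff.1 key)

variable (hO : IsLinearlyCompact O)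
include hO

omit [IsNoetherianRing O] hO in
theorem exists_generators : ∃ (d : ℕ) (φ : (Fin d → O) →ₗ[O] adicLimit t),
    ∀ n, Function.Surjective (adicLimitProj t n ∘ₗ φ) := by
  obtain ⟨d, ψ, hψ⟩ := Module.Finite.exists_fin' O (M 1)
  choose l hl using h.exists_lift_one
  let φ : (Fin d → O) →ₗ[O] adicLimit t :=
    (Pi.basisFun O (Fin d)).constr O fun i => l (ψ (Pi.basisFun O (Fin d) i))
  refine ⟨d, φ, h.surjective_of_surjective_one hm _ (fun n x => (φ x).2 n) ?_⟩
  have e : adicLimitProj t 1 ∘ₗ φ = ψ := by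
    refine (Pi.basisFun O (Fin d)).ext fun i => ?_
    rw [LinearMap.comp_apply, Module.Basis.constr_basis]
    exact hl _
  rw [e]
  exact hψ

omit [IsNoetherianRing O] in
-- Generators of M_1, lifted to the limit, generate every level; linear compactness then finds
-- coefficients that work at all levels at once.
theorem finite_adicLimit : Module.Finite O (adicLimit t) := by
  obtain ⟨d, φ, hφ⟩ := h.exists_generators hm
  refine Module.Finite.of_surjective φ fun v => ?_
  obtain ⟨a, ha⟩ := hO.exists_forall_eq (fun n => adicLimitProj t n ∘ₗ φ) t (fun n x => (φ x).2 n)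
    v.1 v.2 (fun n => hφ n _)
  exact ⟨a, Subtype.ext (funext ha)⟩

omit [IsNoetherianRing O] hO in
theorem adicLimitProj_surjective (n : ℕ) : Function.Surjective (adicLimitProj t n) := by
  obtain ⟨d, φ, hφ⟩ := h.exists_generators hm
  intro x
  obtain ⟨a, ha⟩ := hφ n x
  exact ⟨φ a, ha⟩

/-- If v vanishes at level n, every component of v lies in the image of 𝔪^n O^d. Linear compactness
of this module, finite because O is noetherian, gives one element of it that maps to v. -/
theorem ker_adicLimitProj (n : ℕ) : LinearMap.ker (adicLimitProj t n) =
    𝔪 ^ n • (⊤ : Submodule O (adicLimit t)) := by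
  refine le_antisymm (fun v hv => ?_) (h.smul_top_le_ker n _)
  obtain ⟨d, φ, hφ⟩ := h.exists_generators hm
  let J : Submodule O (Fin d → O) := 𝔪 ^ n • ⊤
  have hJ (m : ℕ) : J.map (adicLimitProj t m ∘ₗ φ) = 𝔪 ^ n • (⊤ : Submodule O (M m)) := by
    rw [Submodule.map_smul'', Submodule.map_top, LinearMap.range_eq_top.2 (hφ m)]
  have hex (m : ℕ) : ∃ x : J, ((adicLimitProj t m ∘ₗ φ) ∘ₗ J.subtype) x = v.1 m := by
    rcases le_total n m with hnm | hnm
    · have h₁ := h.mem_smul_top_of_eq_zero v.2 (LinearMap.mem_ker.1 hv) m hnm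
      rw [← hJ] at h₁
      obtain ⟨a, ha, ha'⟩ := h₁
      exact ⟨⟨a, ha⟩, ha'⟩
    -- Below level n the component of v is the image of the vanishing component at n.
    · refine ⟨0, ?_⟩
      have h₁ (j : ℕ) : v.1 (m + j) = 0 → v.1 m = 0 := by
        induction j with
        | zero => exact id
        | succ j ih => exact fun h₂ => ih ((v.2 (m + j)).symm.trans
            ((congrArg (t (m + j)) h₂).trans (map_zero _)))
      have h₃ := h₁ (n - m) (by
        rw [Nat.add_sub_cancel' hnm]
        exact LinearMap.mem_ker.1 hv)
      rw [map_zero, h₃]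
  obtain ⟨a, ha⟩ := hO.exists_forall_eq (fun m => (adicLimitProj t m ∘ₗ φ) ∘ₗ J.subtype) t
    (fun m x => (φ x.1).2 m) v.1 v.2 hex
  have e : φ a.1 = v := Subtype.ext (funext ha)
  rw [← e]
  have h₁ : φ a.1 ∈ J.map φ := Submodule.mem_map_of_mem a.2
  rw [Submodule.map_smul''] at h₁
  exact Submodule.smul_mono le_rfl le_top h₁

end IsAdicSystem

/-- A finite module is the limit of its reductions modulo `𝔪 ^ n`. -/
theorem adicLimitLift_bijective [IsLocalRing O] [IsNoetherianRing O] (hO : IsLinearlyCompact O)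
    {𝔪 : Ideal O} (hm : 𝔪 ≠ ⊤) {L : Type u} [AddCommGroup L] [Module O L] [Module.Finite O L]
    {t : ∀ n, M (n + 1) →ₗ[O] M n} (g : ∀ n, L →ₗ[O] M n) (h : ∀ n x, t n (g (n + 1) x) = g n x)
    (hs : ∀ n, Function.Surjective (g n))
    (hk : ∀ n, LinearMap.ker (g n) = 𝔪 ^ n • (⊤ : Submodule O L)) :
    Function.Bijective (adicLimitLift g h) := by
  constructor
  · refine (injective_iff_map_eq_zero _).2 fun x hx => ?_
    have := IsHausdorff.of_isLocalRing 𝔪 L hm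
    refine IsHausdorff.haus this x fun n => ?_
    rw [SModEq.zero, ← hk n]
    exact congrFun (congrArg Subtype.val hx) n
  · intro v
    obtain ⟨x, hx⟩ := hO.exists_forall_eq g t h v.1 v.2 (fun n => hs n _)
    exact ⟨x, Subtype.ext (funext hx)⟩

end AdicSystem

/-! ### Tensor direct images of adic sheaves -/

section Reduction

variable {A : Type*} [CommRing A] {M N M' N' : Type*} [AddCommGroup M] [Module A M]
  [AddCommGroup N] [Module A N] [AddCommGroup M'] [Module A M'] [AddCommGroup N'] [Module A N']

/-- `g` identifies its target with the quotient of its source by `I`. -/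
structure IsReduction (I : Ideal A) (g : M →ₗ[A] N) : Prop where
  surjective : Function.Surjective g
  ker : LinearMap.ker g = I • (⊤ : Submodule A M)

theorem IsReduction.of_equiv {I : Ideal A} {g : M →ₗ[A] N} {g' : M' →ₗ[A] N'}
    (hg : IsReduction I g') (e : M ≃ₗ[A] M') (e' : N ≃ₗ[A] N') (h : ∀ x, e' (g x) = g' (e x)) :
    IsReduction I g where
  surjective y := by
    obtain ⟨x, hx⟩ := hg.surjective (e' y)
    refine ⟨e.symm x, e'.injective ?_⟩
    rw [h, e.apply_symm_apply, hx]
  ker := by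
    have h₁ : LinearMap.ker g = (LinearMap.ker g').comap e.toLinearMap := by
      ext x
      rw [Submodule.mem_comap, LinearMap.mem_ker, LinearMap.mem_ker, LinearEquiv.coe_coe, ← h,
        e'.map_eq_zero_iff]
    have h₂ : (I • (⊤ : Submodule A M)).map e.toLinearMap = I • (⊤ : Submodule A M') := by
      rw [Submodule.map_smul'', Submodule.map_top, LinearEquiv.range]
    rw [h₁, hg.ker, ← h₂, Submodule.comap_map_eq_of_injective e.injective]

theorem isReduction_piTensorProduct {ι : Type*} [Finite ι] [Nonempty ι] {M N : ι → Type*}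
    [∀ i, AddCommGroup (M i)] [∀ i, Module A (M i)] [∀ i, AddCommGroup (N i)]
    [∀ i, Module A (N i)] {I : Ideal A} {g : ∀ i, M i →ₗ[A] N i} (hg : ∀ i, IsReduction I (g i)) :
    IsReduction I (PiTensorProduct.map g) :=
  ⟨piTensorProduct_map_surjective fun i => (hg i).surjective,
    ker_piTensorProduct_map (fun i => (hg i).surjective) I fun i => (hg i).ker⟩

end Reduction

/-! ### Existence of tensor direct images of adic sheaves -/

section Existence

variable {A : Type u} [CommRing A] {X Y : Scheme.{u}} {π : Y ⟶ X} {G : Type u} [Group G]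
  (ρ : G →* Aut (Over.mk π))

section Stalk

variable {Ω : Type u} [Field Ω] [IsSepClosed Ω] (t : Spec (.of Ω) ⟶ Y)

theorem tensorSheafStalk_naturality [Finite G] {F F' : Shv A Y} (α : F ⟶ F')
    (p : (stalk t).obj (tensorSheaf ρ F)) :
    tensorSheafStalk ρ t F' (((stalk t).map (tensorSheafMap ρ α)).hom p) =
      PiTensorProduct.map (fun τ => ((stalk t).map ((restrict (act ρ τ)).map α)).hom)
        (tensorSheafStalk ρ t F p) := by
  induction p using tensorSheaf_stalk_induction with
  | add x y hx hy => rw [map_add, map_add, hx, hy, map_add, map_add]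
  | smul a x hx => rw [map_smul, map_smul, hx, map_smul, map_smul]
  | tens V v hv m =>
    refine Eq.trans ?_ (congrArg (PiTensorProduct.map fun τ =>
      ((stalk t).map ((restrict (act ρ τ)).map α)).hom) (tensorSheafStalk_germ ρ t F V v hv m)).symm
    refine Eq.trans ?_ (PiTensorProduct.map_tprod _ _).symm
    refine (congrArg _ (stalk_map_germ t (tensorSheafMap ρ α) V v hv _)).trans ?_
    rw [tensorSheafMap_tens]
    refine (tensorSheafStalk_germ ρ t F' V v hv _).trans ?_
    exact congrArg _ (funext fun τ =>
      (stalk_map_germ t ((restrict (act ρ τ)).map α) V v hv (m τ)).symm)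

end Stalk

theorem tensorSheaf_smul_eq_zero {F : Shv A Y} {a : A}
    (h : ∀ (U : Y.Etaleᵒᵖ) (m : F.obj.obj U), a • m = 0) (U : Y.Etaleᵒᵖ)
    (m : (tensorSheaf ρ F).obj.obj U) : a • m = 0 := by
  classical
  have key : a • 𝟙 (tensorSheaf ρ F) = 0 := by
    apply tensorSheaf_hom_ext
    intro V m
    change a • tens ρ F V m = 0
    rw [← Function.update_eq_self (1 : G) m, ← MultilinearMap.map_update_smul, h,
      MultilinearMap.map_update_zero]
  exact LinearMap.congr_fun (congrArg (fun φ : tensorSheaf ρ F ⟶ tensorSheaf ρ F =>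
    (φ.hom.app U).hom) key) m

variable [Etale π]

namespace AdicSheaf

variable {𝔪 : Ideal A}

theorem isReduction_trans (F : AdicSheaf X 𝔪) (n : ℕ) {Ω : Type u} [Field Ω] [IsSepClosed Ω]
    (s : Spec (.of Ω) ⟶ X) : IsReduction (𝔪 ^ n) ((EtaleSheaf.stalk s).map (F.trans n)).hom :=
  ⟨F.stalk_surjective n Ω s, F.stalk_ker n Ω s⟩

/-- The transition maps of the tensor direct image. -/
def descendTrans (F : AdicSheaf Y 𝔪) (n : ℕ) :
    descend (tensorEquivariant ρ (F.level (n + 1))) ⟶ descend (tensorEquivariant ρ (F.level n)) :=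
  descendMap _ _ (tensorSheafMap ρ (F.trans n)) (tensorSheafMap_perm ρ (F.trans n))

/-- The reduction property passes from F to τ^*F by moving the geometric point, to the tensor
product because tensoring commutes with reduction, to π^* of the descended sheaf by the descent
isomorphism, and finally to X because the stalks at s and t agree. -/
theorem isReduction_descendTrans [Finite G] (F : AdicSheaf Y 𝔪) (hρ : IsTorsor ρ) (n : ℕ)
    {Ω : Type u} [Field Ω] [IsSepClosed Ω] (t : Spec (.of Ω) ⟶ Y) (s : Spec (.of Ω) ⟶ X)
    (hs : 𝟙 _ ≫ t ≫ π = s) :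
    IsReduction (𝔪 ^ n) ((EtaleSheaf.stalk s).map (descendTrans ρ F n)).hom := by
  have h₁ (τ : G) : IsReduction (𝔪 ^ n)
      ((EtaleSheaf.stalk t).map ((restrict (act ρ τ)).map (F.trans n))).hom :=
    (F.isReduction_trans n (t ≫ act ρ τ)).of_equiv
      (pushStalkEquiv (act ρ τ) (𝟙 _) (Category.id_comp _) _)
      (pushStalkEquiv (act ρ τ) (𝟙 _) (Category.id_comp _) _)
      (pushStalk_naturality (act ρ τ) (𝟙 _) (Category.id_comp _) (F.trans n))
  have h₂ : IsReduction (𝔪 ^ n)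
      ((EtaleSheaf.stalk t).map (tensorSheafMap ρ (F.trans n))).hom :=
    (isReduction_piTensorProduct h₁).of_equiv (tensorSheafStalk ρ t _) (tensorSheafStalk ρ t _)
      (tensorSheafStalk_naturality ρ t (F.trans n))
  have h₃ : IsReduction (𝔪 ^ n)
      ((EtaleSheaf.stalk t).map ((restrict π).map (descendTrans ρ F n))).hom := by
    refine h₂.of_equiv
      ((EtaleSheaf.stalk t).mapIso (descendIso (tensorEquivariant ρ _) hρ)).toLinearEquiv
      ((EtaleSheaf.stalk t).mapIso (descendIso (tensorEquivariant ρ _) hρ)).toLinearEquiv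
      fun p => ?_
    have h := congrArg (fun α => ((EtaleSheaf.stalk t).map α).hom p)
      (descendMap_comm (tensorEquivariant ρ (F.level (n + 1))) (tensorEquivariant ρ (F.level n))
        (tensorSheafMap ρ (F.trans n)) (tensorSheafMap_perm ρ (F.trans n)))
    simp only [Functor.map_comp] at h
    exact h.symm
  refine h₃.of_equiv (pushStalkEquiv π (𝟙 _) hs _).symm (pushStalkEquiv π (𝟙 _) hs _).symm
    fun p => ?_
  obtain ⟨q, rfl⟩ := (pushStalkEquiv π (𝟙 _) hs _).surjective p
  rw [LinearEquiv.symm_apply_apply, LinearEquiv.symm_apply_eq]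
  exact (pushStalk_naturality π (𝟙 _) hs (descendTrans ρ F n) q).symm

/-- The tensor direct image of an adic sheaf obtained by Galois descent. -/
def tensorDirectImage [Finite G] (F : AdicSheaf Y 𝔪) (hρ : IsTorsor ρ)
    (hπ : ∀ (Ω : Type u) [Field Ω] [IsSepClosed Ω] (s : Spec (.of Ω) ⟶ X), ∃ t, t ≫ π = s) :
    TensorDirectImage ρ F where
  sheaf :=
    { level := fun n => descend (tensorEquivariant ρ (F.level n))
      trans := descendTrans ρ F
      smul_eq_zero := fun n U m a ha => Subtype.ext
        (tensorSheaf_smul_eq_zero ρ (fun V m => F.smul_eq_zero n V m a ha) _ m.1)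
      stalk_surjective := fun n Ω _ _ s => by
        obtain ⟨t, ht⟩ := hπ Ω s
        exact (isReduction_descendTrans ρ F hρ n t s ((Category.id_comp _).trans ht)).surjective
      stalk_ker := fun n Ω _ _ s => by
        obtain ⟨t, ht⟩ := hπ Ω s
        exact (isReduction_descendTrans ρ F hρ n t s ((Category.id_comp _).trans ht)).ker }
  iso n := descendIso (tensorEquivariant ρ (F.level n)) hρ
  comm n σ := descendHom_comm ρ σ
  comm_trans n := descendMap_comm _ _ _ (tensorSheafMap_perm ρ (F.trans n))

/-- A tensor direct image, regarded up to isogeny. -/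
def TensorDirectImage.toRational [Nontrivial A] {ρ : G →* Aut (Over.mk π)} {F : AdicSheaf Y 𝔪}
    (T : TensorDirectImage ρ F) : RationalTensorDirectImage ρ F where
  sheaf := T.sheaf
  hom n := (T.iso n).hom
  inv n := (T.iso n).inv
  hom_trans := T.comm_trans
  inv_trans n := by
    rw [Iso.inv_comp_eq, ← Category.assoc, T.comm_trans, Category.assoc, Iso.hom_inv_id,
      Category.comp_id]
  c := 1
  c_ne_zero := one_ne_zero
  hom_inv n := by rw [Iso.hom_inv_id, one_smul]
  inv_hom n := by rw [Iso.inv_hom_id, one_smul]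
  comm := T.comm

end AdicSheaf

end Existence

/-! ### Stalks of tensor direct images of adic sheaves -/

section StalkSystem

variable {A : Type u} [CommRing A] {X : Scheme.{u}} {𝔪 : Ideal A} {Ω : Type u} [Field Ω]
  [IsSepClosed Ω]

theorem stalk_map_smul_id (s : Spec (.of Ω) ⟶ X) (F : Shv A X) (a : A) (p : (stalk s).obj F) :
    ((stalk s).map (a • 𝟙 F)).hom p = a • p := by
  obtain ⟨V, v, hv, m, rfl⟩ := exists_germ s F.obj p
  refine (stalk_map_germ s (a • 𝟙 F) V v hv m).trans ?_
  exact (germ s F.obj V v hv).map_smul a m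

theorem AdicSheaf.isAdicSystem (F : AdicSheaf X 𝔪) (s : Spec (.of Ω) ⟶ X) :
    IsAdicSystem (M := fun n => (EtaleSheaf.stalk s).obj (F.level n)) 𝔪
      fun n => ((EtaleSheaf.stalk s).map (F.trans n)).hom where
  smul_eq_zero n a ha p := by
    obtain ⟨V, v, hv, m, rfl⟩ := exists_germ s (F.level n).obj p
    refine ((germ s (F.level n).obj V v hv).map_smul a m).symm.trans ?_
    exact (congrArg _ (F.smul_eq_zero n _ m a ha)).trans (map_zero _)
  surjective n := F.stalk_surjective n Ω s
  ker n := F.stalk_ker n Ω s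

variable (hO : IsLinearlyCompact A) [IsLocalRing A] [IsNoetherianRing A] (hm : 𝔪 ≠ ⊤)
  (F : AdicSheaf X 𝔪) (s : Spec (.of Ω) ⟶ X)
  [∀ n, Module.Finite A ((EtaleSheaf.stalk s).obj (F.level n))]
include hO hm

omit [IsNoetherianRing A] in
theorem AdicSheaf.finite_stalk : Module.Finite A (F.stalk s) :=
  (F.isAdicSystem s).finite_adicLimit hm hO

theorem AdicSheaf.isReduction_proj (n : ℕ) :
    IsReduction (𝔪 ^ n) (LinearMap.proj n ∘ₗ (F.stalk s).subtype) :=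
  ⟨(F.isAdicSystem s).adicLimitProj_surjective hm n, (F.isAdicSystem s).ker_adicLimitProj hm hO n⟩

variable (G : Type u) [Finite G] [Nonempty G]

omit hO hm [IsLocalRing A] [IsNoetherianRing A]
  [∀ n, Module.Finite A ((EtaleSheaf.stalk s).obj (F.level n))] [Finite G] [Nonempty G] in
theorem AdicSheaf.tensorPower_trans_proj (n : ℕ) (x : ⨂[A] _ : G, F.stalk s) :
    PiTensorProduct.map (fun _ : G => ((EtaleSheaf.stalk s).map (F.trans n)).hom)
        (PiTensorProduct.map (fun _ => LinearMap.proj (n + 1) ∘ₗ (F.stalk s).subtype) x) =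
      PiTensorProduct.map (fun _ => LinearMap.proj n ∘ₗ (F.stalk s).subtype) x := by
  refine (LinearMap.congr_fun (PiTensorProduct.map_comp _ _) x).symm.trans ?_
  congr 2
  funext _
  exact LinearMap.ext fun v => v.2 n

/-- The tensor power of the stalk of an adic sheaf as a limit. -/
def AdicSheaf.tensorPowerLimit : (⨂[A] _ : G, F.stalk s) ≃ₗ[A]
    adicLimit (M := fun n => ⨂[A] _ : G, (EtaleSheaf.stalk s).obj (F.level n))
      fun n => PiTensorProduct.map
      fun _ : G => ((EtaleSheaf.stalk s).map (F.trans n)).hom :=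
  have := F.finite_stalk hO hm s
  let M (n : ℕ) : Type u := ⨂[A] _ : G, (EtaleSheaf.stalk s).obj (F.level n)
  LinearEquiv.ofBijective
    (adicLimitLift (L := ⨂[A] _ : G, F.stalk s) (M := M) _ (F.tensorPower_trans_proj s G))
    (adicLimitLift_bijective (L := ⨂[A] _ : G, F.stalk s) (M := M) hO hm _ _
      (fun n => (isReduction_piTensorProduct fun _ => F.isReduction_proj hO hm s n).surjective)
      (fun n => (isReduction_piTensorProduct fun _ => F.isReduction_proj hO hm s n).ker))

theorem AdicSheaf.tensorPowerLimit_apply (x : ⨂[A] _ : G, F.stalk s) (n : ℕ) :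
    (F.tensorPowerLimit hO hm s G x).1 n =
      PiTensorProduct.map (fun _ => LinearMap.proj n ∘ₗ (F.stalk s).subtype) x :=
  rfl

end StalkSystem

/-! ### Comparison maps in both directions, at each level and in the limit -/

namespace CyclicOrbit

variable {A : Type u} [CommRing A] {X Y : Scheme.{u}} {π : Y ⟶ X} [Etale π] {G : Type u} [Group G]
  [Finite G] {ρ : G →* Aut (Over.mk π)} {Ω : Type u} [Field Ω] [IsSepClosed Ω]
  {t : Spec (.of Ω) ⟶ Y} (C : CyclicOrbit ρ t)

section Level

variable {F F' : Shv A Y} {𝒢 𝒢' : Shv A X} {s : Spec (.of Ω) ⟶ X} (hs : 𝟙 _ ≫ t ≫ π = s)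

/-- The map from the tensor power of the stalk of `F` to the stalk of `𝒢` given by
`⨂_τ τ^* F ⟶ π^* 𝒢`. -/
def cocomparison (h : tensorSheaf ρ F ⟶ (restrict π).obj 𝒢) :
    (⨂[A] _ : G, (stalk t).obj F) →ₗ[A] (stalk s).obj 𝒢 :=
  pushStalk π (𝟙 _) hs 𝒢 ∘ₗ ((stalk t).map h).hom ∘ₗ (C.tensorPower F).symm.toLinearMap

theorem cocomparison_tensorPower (h : tensorSheaf ρ F ⟶ (restrict π).obj 𝒢)
    (p : (stalk t).obj (tensorSheaf ρ F)) :
    C.cocomparison hs h (C.tensorPower F p) = pushStalk π (𝟙 _) hs 𝒢 (((stalk t).map h).hom p) :=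
  congrArg (fun z => pushStalk π (𝟙 _) hs 𝒢 (((stalk t).map h).hom z))
    ((C.tensorPower F).symm_apply_apply p)

theorem cocomparison_comparison (h : (restrict π).obj 𝒢 ⟶ tensorSheaf ρ F)
    (h' : tensorSheaf ρ F ⟶ (restrict π).obj 𝒢) {c : A} (hc : h ≫ h' = c • 𝟙 _)
    (p : (stalk s).obj 𝒢) : C.cocomparison hs h' (C.comparison hs h p) = c • p := by
  obtain ⟨q, rfl⟩ := pushStalk_surjective π (𝟙 _) hs 𝒢 p
  rw [comparison_pushStalk, cocomparison_tensorPower, ← map_smul, ← stalk_map_smul_id, ← hc,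
    Functor.map_comp]
  rfl

theorem comparison_cocomparison (h : (restrict π).obj 𝒢 ⟶ tensorSheaf ρ F)
    (h' : tensorSheaf ρ F ⟶ (restrict π).obj 𝒢) {c : A} (hc : h' ≫ h = c • 𝟙 _)
    (p : ⨂[A] _ : G, (stalk t).obj F) : C.comparison hs h (C.cocomparison hs h' p) = c • p := by
  obtain ⟨q, rfl⟩ := (C.tensorPower F).surjective p
  rw [cocomparison_tensorPower, comparison_pushStalk, ← map_smul, ← stalk_map_smul_id, ← hc,
    Functor.map_comp]
  rfl

theorem cocomparison_naturality (h : tensorSheaf ρ F ⟶ (restrict π).obj 𝒢)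
    (h' : tensorSheaf ρ F' ⟶ (restrict π).obj 𝒢') (α : F ⟶ F') (β : 𝒢 ⟶ 𝒢')
    (hc : h ≫ (restrict π).map β = tensorSheafMap ρ α ≫ h') (p : ⨂[A] _ : G, (stalk t).obj F) :
    ((stalk s).map β).hom (C.cocomparison hs h p) =
      C.cocomparison hs h' (PiTensorProduct.map (fun _ => ((stalk t).map α).hom) p) := by
  obtain ⟨q, rfl⟩ := (C.tensorPower F).surjective p
  rw [cocomparison_tensorPower, ← tensorPower_naturality, cocomparison_tensorPower,
    ← pushStalk_naturality]
  have h₁ := congrArg (fun α => ((stalk t).map α).hom q) hc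
  simp only [Functor.map_comp] at h₁
  exact congrArg (pushStalk π (𝟙 _) hs 𝒢') h₁

end Level

section Adic

variable {𝔪 : Ideal A} (hO : IsLinearlyCompact A) [IsLocalRing A] [IsNoetherianRing A]
  (hm : 𝔪 ≠ ⊤) {F : AdicSheaf Y 𝔪} (T : AdicSheaf.RationalTensorDirectImage ρ F)
  {s : Spec (.of Ω) ⟶ X} (hs : 𝟙 _ ≫ t ≫ π = s)
  [∀ n, Module.Finite A ((stalk t).obj (F.level n))]

/-- The map from the stalk of the tensor direct image to the tensor power of the stalk. -/
def adicComparison : T.sheaf.stalk s →ₗ[A] ⨂[A] _ : G, F.stalk t :=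
  (F.tensorPowerLimit hO hm t G).symm.toLinearMap ∘ₗ
    adicLimitMap (t := fun n => ((stalk s).map (T.sheaf.trans n)).hom)
      (fun n => C.comparison hs (T.hom n))
      (fun n p => (C.comparison_naturality hs (T.hom (n + 1)) (T.hom n) (F.trans n)
        (T.sheaf.trans n) (T.hom_trans n) p).symm)

/-- The map from the tensor power of the stalk to the stalk of the tensor direct image. -/
def adicCocomparison : (⨂[A] _ : G, F.stalk t) →ₗ[A] T.sheaf.stalk s :=
  adicLimitMap (t' := fun n => ((stalk s).map (T.sheaf.trans n)).hom)
      (fun n => C.cocomparison hs (T.inv n))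
      (fun n p => C.cocomparison_naturality hs (T.inv (n + 1)) (T.inv n) (F.trans n)
        (T.sheaf.trans n) (T.inv_trans n) p) ∘ₗ (F.tensorPowerLimit hO hm t G).toLinearMap

theorem tensorPowerLimit_adicComparison (v : T.sheaf.stalk s) (n : ℕ) :
    (F.tensorPowerLimit hO hm t G (C.adicComparison hO hm T hs v)).1 n =
      C.comparison hs (T.hom n) (v.1 n) :=
  congrArg (fun w => w.1 n) ((F.tensorPowerLimit hO hm t G).apply_symm_apply _)

theorem adicCocomparison_adicComparison (v : T.sheaf.stalk s) :
    C.adicCocomparison hO hm T hs (C.adicComparison hO hm T hs v) = T.c • v := by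
  apply Subtype.ext
  funext n
  exact (congrArg (C.cocomparison hs (T.inv n))
    (C.tensorPowerLimit_adicComparison hO hm T hs v n)).trans
      (C.cocomparison_comparison hs _ _ (T.hom_inv n) _)

theorem adicComparison_adicCocomparison (x : ⨂[A] _ : G, F.stalk t) :
    C.adicComparison hO hm T hs (C.adicCocomparison hO hm T hs x) = T.c • x := by
  apply (F.tensorPowerLimit hO hm t G).injective
  rw [map_smul]
  apply Subtype.ext
  funext n
  exact (C.tensorPowerLimit_adicComparison hO hm T hs _ n).trans
    (C.comparison_cocomparison hs _ _ (T.inv_hom n) _)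

/-- Equality in the limit is tested at each level, where it is `comparison_stalkEnd`; the twisted
shift commutes with the projection to a level by `cyclic_naturality`. -/
theorem adicComparison_stalkEnd (w : C.endo 1 ≫ s = s) (γ : T.sheaf.stalk s →ₗ[A] T.sheaf.stalk s)
    (hγ : ∀ v n, (γ v).1 n = ((stalkEnd s (C.endo 1) w).app (T.sheaf.level n)).hom (v.1 n))
    (B : F.stalk t →ₗ[A] F.stalk t)
    (hB : ∀ v n, (B v).1 n = C.monodromy (F.level n) (v.1 n)) (v : T.sheaf.stalk s) :
    C.adicComparison hO hm T hs (γ v) = C.cyclic B (C.adicComparison hO hm T hs v) := by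
  apply (F.tensorPowerLimit hO hm t G).injective
  apply Subtype.ext
  funext n
  refine (C.tensorPowerLimit_adicComparison hO hm T hs _ n).trans ?_
  rw [hγ, F.tensorPowerLimit_apply]
  refine (C.comparison_stalkEnd hs w _ (T.comm n C.gen) _).trans ?_
  refine Eq.trans ?_ (C.cyclic_naturality B (C.monodromy (F.level n)) _
    (fun v => hB v n) _).symm
  exact congrArg _ (C.tensorPowerLimit_adicComparison hO hm T hs v n).symm

end Adic

end CyclicOrbit

/-! ### Traces on the stalks of tensor direct images -/

theorem trace_eq_of_equiv {A M N : Type*} [CommRing A] [AddCommGroup M]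
    [Module A M] [AddCommGroup N] [Module A N] (e : M ≃ₗ[A] N) {f : M →ₗ[A] M} {f' : N →ₗ[A] N}
    (h : ∀ x, e (f x) = f' (e x)) : LinearMap.trace A M f = LinearMap.trace A N f' := by
  rw [← LinearMap.trace_conj' f e]
  congr 1
  apply LinearMap.ext
  intro y
  rw [LinearEquiv.conj_apply_apply, h, e.apply_symm_apply]

namespace CyclicOrbit

section Isogeny

variable {A : Type u} [CommRing A] {X Y : Scheme.{u}} {π : Y ⟶ X} {G : Type u} [Group G]
  [Finite G] {ρ : G →* Aut (Over.mk π)} {Ω : Type u} [Field Ω] {t : Spec (.of Ω) ⟶ Y}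

/-- The quotient of L by its torsion is free over the principal ideal domain A, so `trace_cyclic`
applies to it. The map from N to its tensor power still intertwines the operators, and its kernel
and cokernel are torsion, so nothing changes over E. -/
theorem trace_baseChange_of_isogeny (C : CyclicOrbit ρ t) [IsDomain A] [IsPrincipalIdealRing A]
    (E : Type*) [Field E] [Algebra A E] [IsFractionRing A E] {L : Type u} {N : Type*}
    [AddCommGroup L] [Module A L] [Module.Finite A L] [AddCommGroup N] [Module A N]
    (P : N →ₗ[A] ⨂[A] _ : G, L) (Q : (⨂[A] _ : G, L) →ₗ[A] N) {c : A} (hc : c ≠ 0)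
    (hPQ : ∀ y, P (Q y) = c • y) (hQP : ∀ n, Q (P n) = c • n) (γ : N →ₗ[A] N) (B : L →ₗ[A] L)
    (h : ∀ n, P (γ n) = C.cyclic B (P n)) :
    LinearMap.trace E _ (γ.baseChange E) = LinearMap.trace E _ (B.baseChange E) := by
  let tor := Submodule.torsion A L
  have htor : tor ≤ tor.comap B := by
    rintro x ⟨a, ha⟩
    refine ⟨a, ?_⟩
    exact (map_smul B (a : A) x).symm.trans ((congrArg B ha).trans (map_zero B))
  have hker (x : L) (hx : tor.mkQ x = 0) : ∃ a : A, a ≠ 0 ∧ a • x = 0 := by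
    obtain ⟨a, ha⟩ := (Submodule.Quotient.mk_eq_zero tor).1 hx
    exact ⟨a, nonZeroDivisors.ne_zero a.2, ha⟩
  let q : (⨂[A] _ : G, L) →ₗ[A] ⨂[A] _ : G, L ⧸ tor := PiTensorProduct.map fun _ => tor.mkQ
  have h₁ (n : N) (hn : (q ∘ₗ P) n = 0) : ∃ a : A, a ≠ 0 ∧ a • n = 0 := by
    obtain ⟨a, ha, h⟩ := ker_piTensorProduct_map_torsion (g := fun _ : G => tor.mkQ)
      (fun _ => tor.mkQ_surjective) (fun _ => hker) _ hn
    -- The scalar a kills P n, and c · n = Q (P n).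
    refine ⟨c * a, mul_ne_zero hc ha, ?_⟩
    rw [mul_smul, ← hQP, map_smul, h, map_zero]
  have h₂ (y : ⨂[A] _ : G, L ⧸ tor) : ∃ (a : A) (n : N), a ≠ 0 ∧ a • y = (q ∘ₗ P) n := by
    obtain ⟨x, rfl⟩ := piTensorProduct_map_surjective (g := fun _ : G => tor.mkQ)
      (fun _ => tor.mkQ_surjective) y
    refine ⟨c, Q x, hc, ?_⟩
    rw [LinearMap.comp_apply, hPQ, map_smul]
  have h₃ (y : L ⧸ tor) : ∃ (a : A) (x : L), a ≠ 0 ∧ a • y = tor.mkQ x := by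
    obtain ⟨x, rfl⟩ := tor.mkQ_surjective y
    exact ⟨1, x, one_ne_zero, one_smul _ _⟩
  have h₄ (n : N) : (q ∘ₗ P) (γ n) = C.cyclic (tor.mapQ tor B htor) ((q ∘ₗ P) n) := by
    rw [LinearMap.comp_apply, h]
    exact C.cyclic_naturality B (tor.mapQ tor B htor) tor.mkQ (fun _ => rfl) _
  have : Module.Free A (L ⧸ tor) := inferInstance
  have : Module.Free A (⨂[A] _ : G, L ⧸ tor) :=
    .of_basis (Basis.piTensorProduct fun _ : G => Module.Free.chooseBasis A (L ⧸ tor))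
  rw [trace_baseChange_eq (q ∘ₗ P) h₁ h₂ γ _ h₄, C.trace_cyclic,
    trace_baseChange_eq tor.mkQ hker h₃ B (tor.mapQ tor B htor) fun _ => rfl]

end Isogeny

variable {A : Type u} [CommRing A] {X Y : Scheme.{u}} {π : Y ⟶ X} [Etale π] {G : Type u} [Group G]
  [Finite G] {ρ : G →* Aut (Over.mk π)} {Ω : Type u} [Field Ω] [IsSepClosed Ω]
  {t : Spec (.of Ω) ⟶ Y} (C : CyclicOrbit ρ t) {s : Spec (.of Ω) ⟶ X} (hs : 𝟙 _ ≫ t ≫ π = s)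
  (w : C.endo 1 ≫ s = s)
include hs

theorem trace_stalkEnd {F : Shv A Y} [Module.Free A ((stalk t).obj F)]
    [Module.Finite A ((stalk t).obj F)] (T : TensorDirectImage ρ F) :
    LinearMap.trace A _ ((stalkEnd s (C.endo 1) w).app T.sheaf).hom =
      LinearMap.trace A _ (C.monodromy F) := by
  let e : (stalk s).obj T.sheaf ≃ₗ[A] ⨂[A] _ : G, (stalk t).obj F :=
    LinearEquiv.ofLinearMap (C.comparison hs T.iso.hom) (C.cocomparison hs T.iso.inv)
      (LinearMap.ext fun x => (C.comparison_cocomparison hs _ _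
        (T.iso.inv_hom_id.trans (one_smul A _).symm) x).trans (one_smul A x))
      (LinearMap.ext fun x => (C.cocomparison_comparison hs _ _
        (T.iso.hom_inv_id.trans (one_smul A _).symm) x).trans (one_smul A x))
  rw [← C.trace_cyclic (C.monodromy F)]
  exact trace_eq_of_equiv e (C.comparison_stalkEnd hs w _ (T.comm C.gen))

variable {𝔪 : Ideal A} (hO : IsLinearlyCompact A) [IsLocalRing A] [IsNoetherianRing A]
  (hm : 𝔪 ≠ ⊤) {F : AdicSheaf Y 𝔪} [∀ n, Module.Finite A ((stalk t).obj (F.level n))]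
  (B : F.stalk t →ₗ[A] F.stalk t) (hB : ∀ v n, (B v).1 n = C.monodromy (F.level n) (v.1 n))
include hO hm hB

theorem trace_adic [Module.Free A (F.stalk t)] (T : AdicSheaf.TensorDirectImage ρ F)
    (γ : T.sheaf.stalk s →ₗ[A] T.sheaf.stalk s)
    (hγ : ∀ v n, (γ v).1 n = ((stalkEnd s (C.endo 1) w).app (T.sheaf.level n)).hom (v.1 n)) :
    LinearMap.trace A _ γ = LinearMap.trace A _ B := by
  have := F.finite_stalk hO hm t
  let e : T.sheaf.stalk s ≃ₗ[A] ⨂[A] _ : G, F.stalk t :=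
    -- An honest tensor direct image is an isogeny with c = 1, so the two comparison maps are
    -- mutually inverse.
    LinearEquiv.ofLinearMap (C.adicComparison hO hm T.toRational hs)
      (C.adicCocomparison hO hm T.toRational hs)
      (LinearMap.ext fun x =>
        (C.adicComparison_adicCocomparison hO hm T.toRational hs x).trans (one_smul A x))
      (LinearMap.ext fun x =>
        (C.adicCocomparison_adicComparison hO hm T.toRational hs x).trans (one_smul A x))
  have he (v : T.sheaf.stalk s) : e (γ v) = C.cyclic B (e v) :=
    C.adicComparison_stalkEnd hO hm T.toRational hs w γ hγ B hB v
  rw [← C.trace_cyclic B]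
  exact trace_eq_of_equiv (N := ⨂[A] _ : G, F.stalk t) e he

theorem trace_rational [IsDomain A] [IsPrincipalIdealRing A] {E : Type*} [Field E] [Algebra A E]
    [IsFractionRing A E] (T : AdicSheaf.RationalTensorDirectImage ρ F)
    (γ : T.sheaf.stalk s →ₗ[A] T.sheaf.stalk s)
    (hγ : ∀ v n, (γ v).1 n = ((stalkEnd s (C.endo 1) w).app (T.sheaf.level n)).hom (v.1 n)) :
    LinearMap.trace E _ (γ.baseChange E) = LinearMap.trace E _ (B.baseChange E) :=
  have := F.finite_stalk hO hm t
  C.trace_baseChange_of_isogeny E (C.adicComparison hO hm T hs) (C.adicCocomparison hO hm T hs)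
    T.c_ne_zero (C.adicComparison_adicCocomparison hO hm T hs)
    (C.adicCocomparison_adicComparison hO hm T hs) γ B
    (C.adicComparison_stalkEnd hO hm T hs w γ hγ B hB)

end CyclicOrbit

/-! ### The geometric Frobenius -/

section Frobenius

variable {A : Type u} [CommRing A] {k K Ω : Type u} [Field k] [Fintype k] [Field K] [Algebra k K]
  [FiniteDimensional k K] [Field Ω] [IsSepClosed Ω] [Algebra k Ω] [Algebra.IsAlgebraic k Ω]
  [Algebra K Ω] [IsScalarTower k K Ω] {X : Scheme.{u}} (f : X ⟶ Spec (.of k))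
  (x : Spec (.of k) ⟶ X) (hx : x ≫ f = 𝟙 _)

theorem stalkEnd_congr {s : Spec (.of Ω) ⟶ X} {h h' : Spec (.of Ω) ⟶ Spec (.of Ω)} (e : h = h')
    (w : h ≫ s = s) (w' : h' ≫ s = s) : stalkEnd (A := A) s h w = stalkEnd s h' w' := by
  subst e
  rfl

theorem frobeniusOrbit_endo_one :
    (frobeniusOrbit (K := K) (Ω := Ω) f x hx).endo 1 =
      Spec.map (CommRingCat.ofHom (geomFrob k Ω : Ω →+* Ω)) :=
  congrArg (fun g : Ω ≃ₐ[k] Ω => Spec.map (CommRingCat.ofHom (g : Ω →+* Ω))) (pow_one _)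

theorem frobeniusOrbit_endo_one_comp :
    (frobeniusOrbit (K := K) (Ω := Ω) f x hx).endo 1 ≫ geomPoint Ω x = geomPoint Ω x := by
  rw [frobeniusOrbit_endo_one]
  exact galois_comp_geomPoint x _

theorem galStalk_geomFrob (𝒢 : Shv A X) : galStalk x (geomFrob k Ω) 𝒢 =
    ((stalkEnd _ _ (frobeniusOrbit_endo_one_comp (K := K) (Ω := Ω) f x hx)).app 𝒢).hom := by
  unfold galStalk
  rw [stalkEnd_congr (frobeniusOrbit_endo_one (K := K) (Ω := Ω) f x hx).symm]

omit [Fintype k] [FiniteDimensional k K] [IsSepClosed Ω] [Algebra.IsAlgebraic k Ω] in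
theorem id_comp_geomPoint_extendPoint :
    𝟙 _ ≫ geomPoint Ω (extendPoint K f x hx) ≫ extendProj K f = geomPoint Ω x :=
  (Category.id_comp _).trans (geomPoint_extendPoint_fst f x hx)

end Frobenius

end

end EtaleSheaf

/-! ### The trace formula for the three kinds of coefficients -/

theorem mainTheorem7
    -- `k ⊆ K = k_r ⊆ Ω`, with `k` finite, `K / k` finite and `Ω` an algebraic closure of `k`
    {k K Ω : Type u} [Field k] [Fintype k] [Field K] [Algebra k K] [FiniteDimensional k K]
    [Field Ω] [IsAlgClosed Ω] [Algebra k Ω] [Algebra.IsAlgebraic k Ω] [Algebra K Ω]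
    [IsScalarTower k K Ω]
    -- `X` is of finite type over `k`, and `x ∈ X(k)`
    {X : Scheme.{u}} (f : X ⟶ Spec (.of k)) [LocallyOfFiniteType f] [QuasiCompact f]
    (x : Spec (.of k) ⟶ X) (hx : x ≫ f = 𝟙 _)
    -- `E` is a finite extension of `ℚ_ℓ`, `O` its ring of integers, with maximal ideal `𝔪`
    (ℓ : ℕ) [Fact ℓ.Prime] (hℓ : (ℓ : k) ≠ 0)
    {E O : Type u} [Field E] [Algebra ℚ_[ℓ] E] [FiniteDimensional ℚ_[ℓ] E]
    [Algebra ℤ_[ℓ] E] [IsScalarTower ℤ_[ℓ] ℚ_[ℓ] E]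
    [CommRing O] [Algebra ℤ_[ℓ] O] [Algebra O E] [IsScalarTower ℤ_[ℓ] O E]
    [IsIntegralClosure O ℤ_[ℓ] E] (𝔪 : Ideal O) [𝔪.IsMaximal] :
    -- coefficients `A = O ⧸ 𝔪 ^ n`
    (∀ n : ℕ, 1 ≤ n → ∀ F : EtaleSheaf.Shv (O ⧸ 𝔪 ^ n) (EtaleSheaf.extend K f),
      EtaleSheaf.IsConstructible F → EtaleSheaf.HasFreeStalks F →
        Nonempty (EtaleSheaf.TensorDirectImage (EtaleSheaf.galAut K f) F) ∧
        ∀ T : EtaleSheaf.TensorDirectImage (EtaleSheaf.galAut K f) F,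
          LinearMap.trace (O ⧸ 𝔪 ^ n) _
              (EtaleSheaf.galStalk x (EtaleSheaf.geomFrob k Ω) T.sheaf) =
            LinearMap.trace (O ⧸ 𝔪 ^ n) _
              (EtaleSheaf.galStalk (EtaleSheaf.extendPoint K f x hx)
                (EtaleSheaf.geomFrobPow k K Ω) F)) ∧
    -- coefficients `A = O`
    (∀ F : EtaleSheaf.AdicSheaf (EtaleSheaf.extend K f) 𝔪, F.IsConstructible → F.HasFreeStalks →
        Nonempty (EtaleSheaf.AdicSheaf.TensorDirectImage (EtaleSheaf.galAut K f) F) ∧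
        ∀ T : EtaleSheaf.AdicSheaf.TensorDirectImage (EtaleSheaf.galAut K f) F,
          LinearMap.trace O _
              (EtaleSheaf.AdicSheaf.galStalk x (EtaleSheaf.geomFrob k Ω) T.sheaf) =
            LinearMap.trace O _
              (EtaleSheaf.AdicSheaf.galStalk (EtaleSheaf.extendPoint K f x hx)
                (EtaleSheaf.geomFrobPow k K Ω) F)) ∧
    -- coefficients `A = E`
    (∀ F : EtaleSheaf.AdicSheaf (EtaleSheaf.extend K f) 𝔪, F.IsConstructible →
        Nonempty (EtaleSheaf.AdicSheaf.RationalTensorDirectImage (EtaleSheaf.galAut K f) F) ∧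
        ∀ T : EtaleSheaf.AdicSheaf.RationalTensorDirectImage (EtaleSheaf.galAut K f) F,
          LinearMap.trace E _
              ((EtaleSheaf.AdicSheaf.galStalk x (EtaleSheaf.geomFrob k Ω) T.sheaf).baseChange E) =
            LinearMap.trace E _
              ((EtaleSheaf.AdicSheaf.galStalk (EtaleSheaf.extendPoint K f x hx)
                (EtaleSheaf.geomFrobPow k K Ω) F).baseChange E)) := by
  have : Finite K := Module.finite_of_finite k
  have : Normal k K := inferInstance
  have : Finite (K ≃ₐ[k] K) := inferInstance
  have hρ := EtaleSheaf.isTorsor_galAut (k := k) (K := K) f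
  have hs := EtaleSheaf.id_comp_geomPoint_extendPoint (K := K) (Ω := Ω) f x hx
  have w := EtaleSheaf.frobeniusOrbit_endo_one_comp (K := K) (Ω := Ω) f x hx
  let C := EtaleSheaf.frobeniusOrbit (K := K) (Ω := Ω) f x hx
  have : IsDomain O := (IsIntegralClosure.algebraMap_injective O ℤ_[ℓ] E).isDomain _
  have : IsFractionRing O E :=
    IsIntegralClosure.isFractionRing_of_finite_extension ℤ_[ℓ] ℚ_[ℓ] E O
  have : Module.Finite ℤ_[ℓ] O := IsIntegralClosure.finite ℤ_[ℓ] ℚ_[ℓ] E O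
  have : IsDedekindDomain O := IsIntegralClosure.isDedekindDomain ℤ_[ℓ] ℚ_[ℓ] E O
  -- The ring O is finite over the compact noetherian ring ℤ_ℓ. Linear compactness makes O complete
  -- and hence local, and a local Dedekind domain is principal.
  have hO : EtaleSheaf.IsLinearlyCompact O := EtaleSheaf.isLinearlyCompact_of_finite ℤ_[ℓ] O
  have hm : 𝔪 ≠ ⊤ := Ideal.IsMaximal.ne_top ‹_›
  have : IsLocalRing O := hO.isLocalRing 𝔪
  have : IsPrincipalIdealRing O := inferInstance
  refine ⟨fun n _ F hF hfree => ⟨⟨EtaleSheaf.tensorDirectImage _ F hρ⟩, fun T => ?_⟩,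
    fun F hF hfree => ⟨⟨EtaleSheaf.AdicSheaf.tensorDirectImage _ F hρ
      fun Ω _ _ s => EtaleSheaf.exists_lift_geomPoint f s⟩, fun T => ?_⟩,
    fun F hF => ⟨⟨(EtaleSheaf.AdicSheaf.tensorDirectImage _ F hρ
      fun Ω _ _ s => EtaleSheaf.exists_lift_geomPoint f s).toRational⟩, fun T => ?_⟩⟩
  · have := hF.finite_stalk Ω (EtaleSheaf.geomPoint Ω (EtaleSheaf.extendPoint K f x hx))
    have := hfree Ω (EtaleSheaf.geomPoint Ω (EtaleSheaf.extendPoint K f x hx))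
    rw [EtaleSheaf.galStalk_geomFrob (K := K) f x hx]
    exact C.trace_stalkEnd hs w T
  · have (n : ℕ) := (hF n).finite_stalk Ω (EtaleSheaf.geomPoint Ω (EtaleSheaf.extendPoint K f x hx))
    have := hfree Ω (EtaleSheaf.geomPoint Ω (EtaleSheaf.extendPoint K f x hx))
    -- The action of F_x^r on the stalk of F is definitionally the monodromy of the Frobenius orbit
    -- at each level, so `rfl` suffices on that side.
    exact C.trace_adic hs w hO hm _ (fun _ _ => rfl) T _ fun v n =>
      LinearMap.congr_fun (EtaleSheaf.galStalk_geomFrob (K := K) f x hx _) (v.1 n)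
  · have (n : ℕ) := (hF n).finite_stalk Ω (EtaleSheaf.geomPoint Ω (EtaleSheaf.extendPoint K f x hx))
    exact C.trace_rational hs w hO hm _ (fun _ _ => rfl) T _ fun v n =>
      LinearMap.congr_fun (EtaleSheaf.galStalk_geomFrob (K := K) f x hx _) (v.1 n)
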